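/- **Theorem 2.1.** Let $d\in\{1,2,3\}$, let $\lambda\in\mathbb R\setminus\{0\}$, and let $\Omega$ be either $\mathbb R^d$, or a bounded domain in $\mathbb R^d$ with the homogeneous Dirichlet boundary condition, or a box $\prod_{i=1}^d(a_i,b_i)$ with the periodic boundary condition. For $\varepsilon>0$ consider the regularized logarithmic Schrödinger equation $$i\partial_t u^\varepsilon+\Delta u^\varepsilon=\lambda\,u^\varepsilon\ln\big((\varepsilon+|u^\varepsilon|)^2\big),\qquad u^\varepsilon(0)=u_0,$$ on $\Omega$ with the given boundary condition. For a time step $\tau>0$, let $t_n=n\tau$, and let the Lie–Trotter splitting be defined by $$u^{\varepsilon,0}=u_0,\qquad u^{\varepsilon,n+1}=e^{i\tau\Delta}\,\Phi_B^\tau(u^{\varepsilon,n}),\qquad \Phi_B^\tau(\omega)=\omega\, e^{-i\tau\lambda\ln((\varepsilon+|\omega|)^2)},$$ where $e^{it\Delta}v_0$ is the solution at time $t$ of $i\partial_t v=-\Delta v$, $v(0)=v_0$, with the given boundary condition. There are functions $\varepsilon_0:\mathbb R\to(0,\infty)$ and $C:\mathbb R^2\to\mathbb R$, depending only on $d$,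 $\Omega$, the boundary condition and $\lambda$, such that the following holds. Let $T>0$, let $M,m\ge 0$, let $0<\varepsilon\le\varepsilon_0(M)$, and let $u^\varepsilon\in C([0,T];L^2(\Omega))$ be a weak solution of the equation on $[0,T]$ with $$\|u^\varepsilon\|_{L^\infty(0,T;H^1(\Omega))}\le M\ \text{ if } d=1,\qquad \|u^\varepsilon\|_{L^\infty(0,T;H^2(\Omega))}\le M\ \text{ if } d=2,3,$$ and $\|u^\varepsilon\|_{L^\infty(0,T;H^1(\Omega))}\le m$. Then for all $\tau>0$ and all integers $n\ge0$ with $n\tau\le T$, $$\|u^{\varepsilon,n}-u^\varepsilon(t_n)\|_{L^2(\Omega)}\le C(T,m)\,\ln(\varepsilon^{-1})\,\tau^{1/2}.$$ In particular the constant $C(T,m)$ does not depend on $\varepsilon$, $\tau$, $n$, nor on $M$. -/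

import Mathlib

open MeasureTheory Set
open scoped ENNReal ContDiff Laplacian

noncomputable section

/-- The space `ℝ^d` with its Euclidean norm. -/
abbrev Space (d : ℕ) : Type := EuclideanSpace ℝ (Fin d)

/-- The spatial settings: the whole space `ℝ^d`; a bounded domain (an open connected set, no
regularity of the boundary being required) with the homogeneous Dirichlet boundary condition; a box
`∏ (a i, b i)` with the periodic boundary condition. -/
inductive Setting (d : ℕ) : Type
  | whole : Setting d
  | dirichlet (U : Set (Space d)) (isOpen : IsOpen U) (isConnected : IsConnected U)
      (isBounded : Bornology.IsBounded U) : Setting d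
  | periodic (a b : Fin d → ℝ) (lt : ∀ i, a i < b i) : Setting d

/-- The phase function `z ↦ ln ((ε + |z|)²)` of the regularized logarithm. -/
def logPhase (ε : ℝ) (z : ℂ) : ℝ := Real.log ((ε + ‖z‖) ^ 2)

/-- The regularized nonlinearity `φ^ε(z) = z ln ((ε + |z|)²)`. -/
def regNonlin (ε : ℝ) (z : ℂ) : ℂ := z * (logPhase ε z : ℂ)

/-- The pointwise flow `z ↦ z exp (-i t λ ln ((ε + |z|)²))` of `i ω' = λ φ^ε(ω)`. -/
def nonlinFlow (lam ε t : ℝ) (z : ℂ) : ℂ :=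
  z * Complex.exp (((-(t * lam * logPhase ε z) : ℝ) : ℂ) * Complex.I)

lemma norm_nonlinFlow (lam ε t : ℝ) (z : ℂ) : ‖nonlinFlow lam ε t z‖ = ‖z‖ := by
  rw [nonlinFlow, norm_mul, Complex.norm_exp_ofReal_mul_I, mul_one]

lemma measurable_nonlinFlow (lam ε t : ℝ) : Measurable (nonlinFlow lam ε t) := by
  unfold nonlinFlow logPhase
  fun_prop

/-- The partial derivative `∂_j ψ`. -/
def partialDeriv {d : ℕ} (j : Fin d) (ψ : Space d → ℂ) (x : Space d) : ℂ :=
  fderiv ℝ ψ x (EuclideanSpace.single j 1)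

namespace Setting

variable {d : ℕ}

/-- The set `Ω`. -/
def carrier : Setting d → Set (Space d)
  | whole => univ
  | dirichlet U _ _ _ => U
  | periodic a b _ => {x | ∀ i, a i < x i ∧ x i < b i}

/-- The test functions: `C_c^∞(Ω)` for the whole space and for the Dirichlet condition, the smooth
functions on `ℝ^d` of period `b i - a i` in the `i`-th variable for the periodic condition. -/
def IsTest : Setting d → (Space d → ℂ) → Prop
  | whole, ψ => ContDiff ℝ ∞ ψ ∧ HasCompactSupport ψ
  | dirichlet U _ _ _, ψ => ContDiff ℝ ∞ ψ ∧ HasCompactSupport ψ ∧ tsupport ψ ⊆ U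
  | periodic a b _, ψ => ContDiff ℝ ∞ ψ ∧
      ∀ (i : Fin d) (x : Space d), ψ (x + EuclideanSpace.single i (b i - a i)) = ψ x

/-- Lebesgue measure on `Ω`. -/
abbrev meas (D : Setting d) : Measure (Space d) := volume.restrict D.carrier

/-- The Hilbert space `L²(Ω)` of complex-valued functions. -/
abbrev L2 (D : Setting d) : Type := Lp ℂ 2 D.meas

/-- `g ∈ L²(Ω)` is the weak derivative `∂_j u` of `u ∈ L²(Ω)`. (In the periodic setting the test
functions are the periodic ones, so that this is the weak derivative on the torus.) -/
def HasWeakDeriv (D : Setting d) (j : Fin d) (u g : D.L2) : Prop :=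
  ∀ ψ, D.IsTest ψ → ∫ x, u x * partialDeriv j ψ x ∂D.meas = -∫ x, g x * ψ x ∂D.meas

/-- The norm of `H¹(Ω)`; it is `⊤` when `u ∉ H¹(Ω)`. Weak derivatives are unique, so the infimum
runs over at most one family. -/
def h1Norm (D : Setting d) (u : D.L2) : ℝ≥0∞ :=
  ⨅ (g : Fin d → D.L2) (_ : ∀ j, D.HasWeakDeriv j u (g j)),
    ENNReal.ofReal (Real.sqrt (‖u‖ ^ 2 + ∑ j, ‖g j‖ ^ 2))

/-- The norm of `H²(Ω)`; it is `⊤` when `u ∉ H²(Ω)`. -/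
def h2Norm (D : Setting d) (u : D.L2) : ℝ≥0∞ :=
  ⨅ (g : Fin d → D.L2) (h : Fin d → Fin d → D.L2)
    (_ : ∀ j, D.HasWeakDeriv j u (g j)) (_ : ∀ j k, D.HasWeakDeriv k (g j) (h j k)),
    ENNReal.ofReal (Real.sqrt (‖u‖ ^ 2 + ∑ j, ‖g j‖ ^ 2 + ∑ j, ∑ k, ‖h j k‖ ^ 2))

/-- The norm in which the solution is assumed bounded: that of `H¹(Ω)` if `d = 1`, that of `H²(Ω)`
in the other dimensions. -/
def regNorm (D : Setting d) (u : D.L2) : ℝ≥0∞ := if d = 1 then D.h1Norm u else D.h2Norm u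

/-- The norm of `L^∞(0,T;X)`, for a norm `N` (that of `X`) on a subspace `X` of `L²(Ω)`. -/
def linftyNorm (D : Setting d) (T : ℝ) (N : D.L2 → ℝ≥0∞) (u : ℝ → D.L2) : ℝ≥0∞ :=
  essSup (fun t => N (u t)) (volume.restrict (Ioo 0 T))

/-- Membership in the energy space, the closure of the test functions in `H¹(Ω)`: it is `H¹(ℝ^d)`
for the whole space, `H¹₀(Ω)` for the Dirichlet condition, and the space of periodic `H¹` functions
for the periodic condition. -/
def MemEnergy (D : Setting d) (u : D.L2) : Prop :=
  ∃ g : Fin d → D.L2, (∀ j, D.HasWeakDeriv j u (g j)) ∧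
    ∀ δ : ℝ, 0 < δ → ∃ ψ, D.IsTest ψ ∧
      eLpNorm (fun x => u x - ψ x) 2 D.meas < ENNReal.ofReal δ ∧
      ∀ j, eLpNorm (fun x => g j x - partialDeriv j ψ x) 2 D.meas < ENNReal.ofReal δ

/-- The graph of the (self-adjoint) Laplacian on `L²(Ω)` with the boundary condition: `w` is in the
energy space and its distributional Laplacian is `f ∈ L²(Ω)`. -/
def IsLaplacian (D : Setting d) (w f : D.L2) : Prop :=
  D.MemEnergy w ∧
    ∀ ψ, D.IsTest ψ → ∫ x, w x * (Δ ψ) x ∂D.meas = ∫ x, f x * ψ x ∂D.meas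

/-- `v ∈ C(ℝ; L²(Ω))` is the (weak) solution of `i ∂ₜ v = -Δ v`, `v(0) = v₀`, with the boundary
condition: `d/dt ⟨w, v(t)⟩ = i ⟨Δ w, v(t)⟩` for all `w` in the domain of the Laplacian. -/
def IsFreeSolution (D : Setting d) (v₀ : D.L2) (v : ℝ → D.L2) : Prop :=
  Continuous v ∧ v 0 = v₀ ∧ ∀ w f, D.IsLaplacian w f → ∀ t : ℝ,
    HasDerivAt (fun s => inner ℂ w (v s)) (Complex.I * inner ℂ f (v t)) t

open Classical in
/-- The evolution operator `Φ_A^t = e^{itΔ}` on `L²(Ω)`: the value at time `t` of the solution of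
the free Schrödinger equation (which exists and is unique for every `v₀ ∈ L²(Ω)`, the Laplacian
being self-adjoint). -/
def flowA (D : Setting d) (t : ℝ) (v₀ : D.L2) : D.L2 :=
  if h : ∃ v, D.IsFreeSolution v₀ v then h.choose t else 0

lemma memLp_nonlinFlow (D : Setting d) (lam ε t : ℝ) (z : D.L2) :
    MemLp (fun x => nonlinFlow lam ε t (z x)) 2 D.meas :=
  (Lp.memLp z).of_le
    ((measurable_nonlinFlow lam ε t).comp_aemeasurable
      (Lp.aestronglyMeasurable z).aemeasurable).aestronglyMeasurable
    (Filter.Eventually.of_forall fun x => (norm_nonlinFlow lam ε t (z x)).le)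

/-- The evolution operator `Φ_B^t(z) = z exp (-i t λ ln ((ε + |z|)²))` on `L²(Ω)`. -/
def flowB (D : Setting d) (lam ε t : ℝ) (z : D.L2) : D.L2 :=
  (D.memLp_nonlinFlow lam ε t z).toLp _

/-- The Lie–Trotter splitting `u^{n+1} = Φ_A^τ(Φ_B^τ(u^n))`, `u^0 = u₀`, with time step `τ`. -/
def lieTrotter (D : Setting d) (lam ε τ : ℝ) (u₀ : D.L2) : ℕ → D.L2
  | 0 => u₀
  | n + 1 => D.flowA τ (D.flowB lam ε τ (lieTrotter D lam ε τ u₀ n))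

/-- `u ∈ C([0,T]; L²(Ω))` is a weak solution on `[0,T]` of
`i ∂ₜ u + Δ u = λ u ln ((ε + |u|)²)` with initial value `u₀` and the boundary condition. -/
structure IsSolution (D : Setting d) (lam ε T : ℝ) (u₀ : D.L2) (u : ℝ → D.L2) : Prop where
  continuousOn : ContinuousOn u (Icc 0 T)
  initial : u 0 = u₀
  boundary : ∀ᵐ t ∂(volume.restrict (Ioo 0 T)), D.MemEnergy (u t)
  equation : ∀ ψ, D.IsTest ψ → ∀ t ∈ Ioo 0 T,
    HasDerivAt (fun s => ∫ x, u s x * ψ x ∂D.meas)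
      (Complex.I * ∫ x, u t x * (Δ ψ) x ∂D.meas
        - Complex.I * (lam * ∫ x, regNonlin ε (u t x) * ψ x ∂D.meas)) t

end Setting

end

/-! The proof combines stability with a local error bound in `L²`, arranged so that `ε` enters only
through one factor `ln(1/ε)`.

Stability: `e^{iτΔ}` is unitary, and `Φ_B^τ` is Lipschitz with constant `1 + 2|τλ|`, uniformly in
`ε` (`norm_nonlinFlow_sub_le`), because for `|w| ≤ |z|` the difference of the phases is multiplied
by `|w|` and `|w| |ln(ε+|z|) - ln(ε+|w|)| ≤ |z - w|`.

Local error (`norm_step_sub_le`): both `Φ_B^τ(u(t))` and `e^{-iτΔ} u(t+τ)` are compared with `u(t) -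
iλτ φ(u(t))`. The first comparison is a Taylor expansion. The second is Duhamel's formula, where
`e^{-irΔ} φ(u(t+r)) - φ(u(t))` has to be small. The group moves an element of the energy space by
`O(√r)` times its gradient norm (`norm_graphGroup_sub_le`), and `φ` acts on the values of `u` as a
Lipschitz map with constant `O(ln(1/ε))`. If `ln(1/ε) √τ ≤ 1`, the local error is `O(ln(1/ε)
τ^{3/2})`, and a discrete Gronwall argument sums it. Otherwise conservation of the `L²` norm by the
scheme already gives the bound.

The Lipschitz constant of `φ` requires `|u| ≤ K(M)` with `K(M)` well below `1/ε`; this is the only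
role of `M`, and it is absorbed into `ε₀(M)`. The bound `K(M)` comes from `H¹ ⊆ L^∞` if `d = 1`. If
`d = 2, 3`, the boundary may be arbitrarily rough, so it comes from a level set iteration for `(1 -
Δ)w = w - f` that uses only `H¹ ⊆ L⁶` (`ae_re_le`).

The three settings are treated together: the gradient is the closure of its restriction to test
functions, `Δ = -∇^*∇`, the resolvent is a component of the orthogonal projection onto the graph,
and `e^{itΔ}` is built from the resolvent by the continuous functional calculus. Existence and
uniqueness of weak free solutions identify it with `flowA` (`flowA_eq`). -/

noncomputable section

/-! ### The unitary group generated by a self-adjoint contraction with dense range -/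

section UnitaryGroup

open Filter Topology

/-- The function `r ↦ r exp (i t (1 - 1/r))`. -/
def resolventPhase (t : ℝ) (r : ℝ) : ℂ := (r : ℂ) * Complex.exp ((t * (1 - r⁻¹) : ℝ) * Complex.I)

lemma norm_resolventPhase (t r : ℝ) : ‖resolventPhase t r‖ = |r| := by
  rw [resolventPhase, norm_mul, Complex.norm_exp_ofReal_mul_I, mul_one, Complex.norm_real,
    Real.norm_eq_abs]

lemma resolventPhase_zero_left (r : ℝ) : resolventPhase 0 r = r := by
  simp [resolventPhase]

/-- The exponential oscillates without limit as `r → 0`; the factor `r` removes this, so the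
continuous functional calculus applies even if `0` is in the spectrum. For `R = (1 - Δ)⁻¹` one has
`1 - R⁻¹ = Δ`. -/
lemma continuous_resolventPhase (t : ℝ) : Continuous (resolventPhase t) := by
  rw [continuous_iff_continuousAt]
  intro r
  rcases eq_or_ne r 0 with rfl | hr
  · have h : resolventPhase t 0 = 0 := by simp [resolventPhase]
    rw [ContinuousAt, h]
    refine squeeze_zero_norm (a := fun r => |r|) (fun r => (norm_resolventPhase t r).le) ?_
    simpa using (continuous_abs.tendsto (0 : ℝ))
  · unfold resolventPhase
    fun_prop (disch := exact hr)

lemma resolventPhase_mul (s t r : ℝ) :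
    resolventPhase s r * resolventPhase t r = r * resolventPhase (s + t) r := by
  unfold resolventPhase
  have : Complex.exp (((s + t) * (1 - r⁻¹) : ℝ) * Complex.I)
      = Complex.exp ((s * (1 - r⁻¹) : ℝ) * Complex.I)
        * Complex.exp ((t * (1 - r⁻¹) : ℝ) * Complex.I) := by
    rw [← Complex.exp_add]; push_cast; ring_nf
  rw [this]; ring

lemma star_resolventPhase (t r : ℝ) : star (resolventPhase t r) = resolventPhase (-t) r := by
  unfold resolventPhase
  rw [star_mul', Complex.star_def, Complex.conj_ofReal, ← Complex.exp_conj,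
    map_mul, Complex.conj_ofReal, Complex.conj_I]
  push_cast; ring_nf

lemma norm_exp_mul_I_sub_one_le (x : ℝ) : ‖Complex.exp (x * Complex.I) - 1‖ ≤ |x| := by
  have h := Real.norm_exp_I_mul_ofReal_sub_one_le (x := x)
  rwa [mul_comm, Real.norm_eq_abs] at h

lemma norm_exp_mul_I_sub_one_sub_le (x : ℝ) :
    ‖Complex.exp (x * Complex.I) - 1 - x * Complex.I‖ ≤ 2 * x ^ 2 := by
  have hx : ‖(x * Complex.I : ℂ)‖ = |x| := by simp
  rcases le_total |x| 1 with h | h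
  · have := Complex.norm_exp_sub_one_sub_id_le (x := x * Complex.I) (by rwa [hx])
    rw [hx, sq_abs] at this
    nlinarith [sq_nonneg x]
  · calc _ ≤ ‖Complex.exp (x * Complex.I) - 1‖ + ‖(x * Complex.I : ℂ)‖ := norm_sub_le _ _
      _ ≤ |x| + |x| := by rw [hx]; gcongr; exact norm_exp_mul_I_sub_one_le x
      _ ≤ 2 * |x| ^ 2 := by nlinarith
      _ = 2 * x ^ 2 := by rw [sq_abs]

/-- One factor `r` tames one time derivative, as `r (1 - r⁻¹) = r - 1` is bounded on the spectrum.
The functional calculus turns this into norm continuity of `phaseOp`. -/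
lemma norm_resolventPhase_sub_le (s t r : ℝ) (hr : |r| ≤ 1) :
    ‖resolventPhase t r - resolventPhase s r‖ ≤ 2 * |t - s| := by
  rcases eq_or_ne r 0 with rfl | h0
  · simp [resolventPhase]
  have h1 : resolventPhase t r - resolventPhase s r
      = resolventPhase s r * (Complex.exp (((t - s) * (1 - r⁻¹) : ℝ) * Complex.I) - 1) := by
    unfold resolventPhase
    have : Complex.exp ((t * (1 - r⁻¹) : ℝ) * Complex.I)
      = Complex.exp ((s * (1 - r⁻¹) : ℝ) * Complex.I)
        * Complex.exp (((t - s) * (1 - r⁻¹) : ℝ) * Complex.I) := by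
      rw [← Complex.exp_add]; push_cast; ring_nf
    rw [this]; ring
  rw [h1, norm_mul, norm_resolventPhase]
  calc |r| * _ ≤ |r| * |(t - s) * (1 - r⁻¹)| := by gcongr; exact norm_exp_mul_I_sub_one_le _
    _ = |t - s| * |r - 1| := by
      rw [← abs_mul, ← abs_mul]; congr 1; field_simp
    _ ≤ |t - s| * 2 := by
      gcongr
      rw [abs_le] at *; constructor <;> linarith
    _ = _ := mul_comm _ _

/-- A second factor `r` also tames the second time derivative: `r² (1 - r⁻¹)² = (r - 1)² ≤ 4`. -/
lemma norm_resolventPhase_taylor_le (t h r : ℝ) (hr : |r| ≤ 1) :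
    ‖r * resolventPhase (t + h) r - r * resolventPhase t r
      - h * (Complex.I * ((r - 1) * resolventPhase t r))‖ ≤ 8 * h ^ 2 := by
  rcases eq_or_ne r 0 with rfl | h0
  · simp only [resolventPhase, Complex.ofReal_zero, zero_mul, mul_zero, sub_zero, norm_zero]
    positivity
  have hc : (r : ℂ) ≠ 0 := by exact_mod_cast h0
  have h1 : r * resolventPhase (t + h) r - r * resolventPhase t r
      - h * (Complex.I * ((r - 1) * resolventPhase t r))
      = r * resolventPhase t r * (Complex.exp ((h * (1 - r⁻¹) : ℝ) * Complex.I) - 1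
        - (h * (1 - r⁻¹) : ℝ) * Complex.I) := by
    unfold resolventPhase
    have : Complex.exp (((t + h) * (1 - r⁻¹) : ℝ) * Complex.I)
      = Complex.exp ((t * (1 - r⁻¹) : ℝ) * Complex.I)
        * Complex.exp ((h * (1 - r⁻¹) : ℝ) * Complex.I) := by
      rw [← Complex.exp_add]; push_cast; ring_nf
    rw [this]; push_cast; field_simp
  rw [h1, norm_mul, norm_mul, norm_resolventPhase, Complex.norm_real, Real.norm_eq_abs]
  calc |r| * |r| * _ ≤ |r| * |r| * (2 * (h * (1 - r⁻¹)) ^ 2) := by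
        gcongr; exact norm_exp_mul_I_sub_one_sub_le _
    _ = 2 * h ^ 2 * (r - 1) ^ 2 := by rw [abs_mul_abs_self]; field_simp
    _ ≤ 2 * h ^ 2 * 4 := by
      gcongr; rw [abs_le] at hr; nlinarith
    _ = _ := by ring

/-! ### Functional calculus of the resolvent and extension by density -/

variable {H : Type*} [NormedAddCommGroup H] [InnerProductSpace ℂ H] [CompleteSpace H]

/-- For a self-adjoint `R`, the operator `R exp (i t (1 - R⁻¹))`. -/
def phaseOp (R : H →L[ℂ] H) (t : ℝ) : H →L[ℂ] H := cfc (fun z : ℂ => resolventPhase t z.re) R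

/-- For a self-adjoint contraction `R` with dense range, the unitary `exp (i t (1 - R⁻¹))`. -/
def unitaryGroup (R : H →L[ℂ] H) (t : ℝ) : H →L[ℂ] H :=
  ((phaseOp R t : H →L[ℂ] H) : H →ₗ[ℂ] H).extendOfNorm (R : H →ₗ[ℂ] H)

/-- Self-adjoint contractions with dense range; this is what resolvents at `1` of nonpositive
self-adjoint operators are. -/
structure IsResolvent (R : H →L[ℂ] H) : Prop where
  selfAdjoint : IsSelfAdjoint R
  norm_le : ‖R‖ ≤ 1
  denseRange : DenseRange R

namespace IsResolvent

variable {R : H →L[ℂ] H}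

lemma re_of_mem (hR : IsResolvent R) {z : ℂ} (hz : z ∈ spectrum ℂ R) : (z.re : ℂ) = z :=
  (hR.selfAdjoint.mem_spectrum_eq_re hz).symm

lemma abs_re_le (hR : IsResolvent R) {z : ℂ} (hz : z ∈ spectrum ℂ R) : |z.re| ≤ 1 := by
  have h1 := spectrum.norm_le_norm_mul_of_mem hz
  have h2 : ‖(1 : H →L[ℂ] H)‖ ≤ 1 := ContinuousLinearMap.norm_id_le
  calc |z.re| ≤ ‖z‖ := Complex.abs_re_le_norm z
    _ ≤ ‖R‖ * ‖(1 : H →L[ℂ] H)‖ := h1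
    _ ≤ 1 * 1 := by gcongr; exact hR.norm_le
    _ = 1 := one_mul 1

lemma continuousOn_phase (t : ℝ) (s : Set ℂ) :
    ContinuousOn (fun z : ℂ => resolventPhase t z.re) s :=
  ((continuous_resolventPhase t).comp Complex.continuous_re).continuousOn

lemma cfc_re (hR : IsResolvent R) : cfc (fun z : ℂ => (z.re : ℂ)) R = R := by
  have h : IsStarNormal R := hR.selfAdjoint.isStarNormal
  rw [cfc_congr (g := fun z : ℂ => z) fun z hz => hR.re_of_mem hz]
  exact cfc_id' ℂ R

lemma phaseOp_zero (hR : IsResolvent R) : phaseOp R 0 = R := by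
  rw [phaseOp]
  simp_rw [resolventPhase_zero_left]
  exact hR.cfc_re

lemma phaseOp_mul (hR : IsResolvent R) (s t : ℝ) :
    phaseOp R s * phaseOp R t = R * phaseOp R (s + t) := by
  have h : IsStarNormal R := hR.selfAdjoint.isStarNormal
  conv_rhs => rw [← hR.cfc_re]
  have hc := hR.cfc_re
  unfold phaseOp at *
  rw [hc, ← cfc_mul _ _ R (continuousOn_phase _ _) (continuousOn_phase _ _)]
  conv_rhs => enter [1]; rw [← hc]
  rw [← cfc_mul _ _ R (by fun_prop) (continuousOn_phase _ _)]
  simp_rw [resolventPhase_mul]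

lemma phaseOp_comm (hR : IsResolvent R) (t : ℝ) : phaseOp R t * R = R * phaseOp R t := by
  have h : IsStarNormal R := hR.selfAdjoint.isStarNormal
  have := hR.phaseOp_mul t 0
  rwa [hR.phaseOp_zero, add_zero] at this

lemma star_phaseOp (t : ℝ) : star (phaseOp R t) = phaseOp R (-t) := by
  rw [phaseOp, phaseOp, ← cfc_star]
  simp_rw [star_resolventPhase]

/-- By the multiplication rule `star (phaseOp R t) * phaseOp R t` collapses to `R * R`. This
equality of norms makes `unitaryGroup` isometric. -/
lemma norm_phaseOp_apply (hR : IsResolvent R) (t : ℝ) (x : H) : ‖phaseOp R t x‖ = ‖R x‖ := by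
  have key : star (phaseOp R t) * phaseOp R t = star R * R := by
    rw [star_phaseOp, hR.phaseOp_mul, neg_add_cancel, hR.phaseOp_zero, hR.selfAdjoint.star_eq]
  have h (S : H →L[ℂ] H) : ‖S x‖ ^ 2 = RCLike.re (inner ℂ ((star S * S) x) x) := by
    rw [mul_apply_eq_comp, ContinuousLinearMap.star_eq_adjoint,
      ContinuousLinearMap.adjoint_inner_left, inner_self_eq_norm_sq]
  have : ‖phaseOp R t x‖ ^ 2 = ‖R x‖ ^ 2 := by rw [h, h, key]
  exact (sq_eq_sq₀ (norm_nonneg _) (norm_nonneg _)).1 this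

lemma norm_phaseOp_sub_le (hR : IsResolvent R) (s t : ℝ) :
    ‖phaseOp R t - phaseOp R s‖ ≤ 2 * |t - s| := by
  have h : IsStarNormal R := hR.selfAdjoint.isStarNormal
  rw [phaseOp, phaseOp, ← cfc_sub _ _ R (continuousOn_phase _ _) (continuousOn_phase _ _)]
  exact norm_cfc_le (by positivity) fun z hz =>
    norm_resolventPhase_sub_le s t z.re (hR.abs_re_le hz)

lemma norm_phaseOp_taylor_le (hR : IsResolvent R) (t h : ℝ) :
    ‖R * phaseOp R (t + h) - R * phaseOp R t
      - (h : ℂ) • (Complex.I • ((R - 1) * phaseOp R t))‖ ≤ 8 * h ^ 2 := by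
  have hn : IsStarNormal R := hR.selfAdjoint.isStarNormal
  have hre : Continuous fun z : ℂ => (z.re : ℂ) := by fun_prop
  have hp (t : ℝ) : Continuous fun z : ℂ => resolventPhase t z.re :=
    (continuous_resolventPhase t).comp Complex.continuous_re
  have e1 (t : ℝ) : R * phaseOp R t = cfc (fun z : ℂ => (z.re : ℂ) * resolventPhase t z.re) R := by
    rw [cfc_mul _ _ R hre.continuousOn (hp t).continuousOn, hR.cfc_re, phaseOp]
  have e2 : (h : ℂ) • (Complex.I • ((R - 1) * phaseOp R t)) = cfc (fun z : ℂ =>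
      (h : ℂ) * (Complex.I * (((z.re : ℂ) - 1) * resolventPhase t z.re))) R := by
    have hq : Continuous fun z : ℂ => ((z.re : ℂ) - 1) * resolventPhase t z.re :=
      (hre.sub continuous_const).mul (hp t)
    rw [cfc_const_mul _ _ R (hq.const_mul _).continuousOn, cfc_const_mul _ _ R hq.continuousOn,
      cfc_mul _ _ R (by fun_prop) (hp t).continuousOn,
      cfc_sub _ _ R hre.continuousOn (by fun_prop), hR.cfc_re, cfc_const_one ℂ R, phaseOp]
  rw [e1, e1, e2, ← cfc_sub _ _ R (by fun_prop) (by fun_prop),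
    ← cfc_sub _ _ R (by fun_prop) (by fun_prop)]
  exact norm_cfc_le (by positivity) fun z hz =>
    norm_resolventPhase_taylor_le t h z.re (hR.abs_re_le hz)

/-- The assignment `R x ↦ phaseOp R t x` is well defined and bounded since both sides have the same
norm. The group identities are then checked on the dense range of `R` and extended by continuity. -/
lemma unitaryGroup_apply (hR : IsResolvent R) (t : ℝ) (x : H) :
    unitaryGroup R t (R x) = phaseOp R t x :=
  LinearMap.extendOfNorm_eq (f := (phaseOp R t : H →ₗ[ℂ] H)) (e := (R : H →ₗ[ℂ] H)) hR.denseRange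
    ⟨1, fun x => by simpa using (hR.norm_phaseOp_apply t x).le⟩ x

lemma norm_unitaryGroup (hR : IsResolvent R) (t : ℝ) (x : H) : ‖unitaryGroup R t x‖ = ‖x‖ := by
  refine hR.denseRange.induction_on (p := fun x => ‖unitaryGroup R t x‖ = ‖x‖) x
    (isClosed_eq (by fun_prop) (by fun_prop)) fun y => ?_
  rw [hR.unitaryGroup_apply, hR.norm_phaseOp_apply]

lemma unitaryGroup_comm (hR : IsResolvent R) (t : ℝ) (x : H) :
    unitaryGroup R t (R x) = R (unitaryGroup R t x) := by
  refine hR.denseRange.induction_on (p := fun x => unitaryGroup R t (R x)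
    = R (unitaryGroup R t x)) x (isClosed_eq (by fun_prop) (by fun_prop)) fun y => ?_
  rw [hR.unitaryGroup_apply, hR.unitaryGroup_apply]
  exact DFunLike.congr_fun (hR.phaseOp_comm t) y

lemma unitaryGroup_zero (hR : IsResolvent R) (x : H) : unitaryGroup R 0 x = x := by
  refine hR.denseRange.induction_on (p := fun x => unitaryGroup R 0 x = x) x
    (isClosed_eq (by fun_prop) (by fun_prop)) fun y => ?_
  rw [hR.unitaryGroup_apply, hR.phaseOp_zero]

lemma unitaryGroup_add (hR : IsResolvent R) (s t : ℝ) (x : H) :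
    unitaryGroup R (s + t) x = unitaryGroup R s (unitaryGroup R t x) := by
  refine hR.denseRange.induction_on (p := fun x => unitaryGroup R (s + t) x
    = unitaryGroup R s (unitaryGroup R t x)) x (isClosed_eq (by fun_prop) (by fun_prop)) fun y => ?_
  refine hR.denseRange.induction_on (p := fun y => unitaryGroup R (s + t) (R y)
    = unitaryGroup R s (unitaryGroup R t (R y))) y
    (isClosed_eq (by fun_prop) (by fun_prop)) fun z => ?_
  have e := DFunLike.congr_fun (hR.phaseOp_mul s t) z
  have e' := DFunLike.congr_fun (hR.phaseOp_comm t) z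
  simp only [mul_apply_eq_comp] at e e'
  rw [hR.unitaryGroup_apply t, e', hR.unitaryGroup_apply s, e, hR.unitaryGroup_comm,
    hR.unitaryGroup_apply]

lemma unitaryGroup_apply_neg (hR : IsResolvent R) (t : ℝ) (x : H) :
    unitaryGroup R t (unitaryGroup R (-t) x) = x := by
  rw [← hR.unitaryGroup_add, add_neg_cancel, hR.unitaryGroup_zero]

lemma inner_unitaryGroup (hR : IsResolvent R) (t : ℝ) (x y : H) :
    inner ℂ (unitaryGroup R t x) (unitaryGroup R t y) = inner ℂ x y :=
  LinearIsometry.inner_map_map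
    ⟨(unitaryGroup R t : H →ₗ[ℂ] H), fun x => hR.norm_unitaryGroup t x⟩ x y

lemma inner_unitaryGroup_left (hR : IsResolvent R) (t : ℝ) (x y : H) :
    inner ℂ (unitaryGroup R t x) y = inner ℂ x (unitaryGroup R (-t) y) := by
  rw [← hR.inner_unitaryGroup t x, hR.unitaryGroup_apply_neg]

lemma continuous_unitaryGroup (hR : IsResolvent R) (x : H) :
    Continuous fun t => unitaryGroup R t x := by
  have h0 : ∀ y, Continuous fun t => unitaryGroup R t (R y) := fun y => by
    simp_rw [hR.unitaryGroup_apply]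
    have : Continuous fun t => phaseOp R t := by
      refine LipschitzWith.continuous (K := 2) (LipschitzWith.of_dist_le_mul fun s t => ?_)
      rw [dist_eq_norm, Real.dist_eq]
      exact hR.norm_phaseOp_sub_le t s
    fun_prop
  rw [Metric.continuous_iff]
  intro t ε hε
  obtain ⟨y, hy⟩ := hR.denseRange.exists_dist_lt x (ε := ε / 3) (by positivity)
  obtain ⟨δ, hδ, h⟩ := Metric.continuous_iff.1 (h0 y) t (ε / 3) (by positivity)
  refine ⟨δ, hδ, fun s hs => ?_⟩
  have e (r : ℝ) : dist (unitaryGroup R r x) (unitaryGroup R r (R y)) = dist x (R y) := by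
    rw [dist_eq_norm, ← map_sub, hR.norm_unitaryGroup, dist_eq_norm]
  have h1 := h s hs
  have h2 := dist_triangle4 (unitaryGroup R s x) (unitaryGroup R s (R y)) (unitaryGroup R t (R y))
    (unitaryGroup R t x)
  rw [e, dist_comm (unitaryGroup R t (R y)), e] at h2
  linarith

lemma continuous_unitaryGroup_apply (hR : IsResolvent R) {X : Type*} [TopologicalSpace X]
    {τ : X → ℝ} {f : X → H} {s : Set X} (hτ : ContinuousOn τ s) (hf : ContinuousOn f s) :
    ContinuousOn (fun x => unitaryGroup R (τ x) (f x)) s := by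
  intro a ha
  rw [ContinuousWithinAt, tendsto_iff_norm_sub_tendsto_zero]
  have h1 : Tendsto (fun x => ‖f x - f a‖
      + ‖unitaryGroup R (τ x) (f a) - unitaryGroup R (τ a) (f a)‖) (𝓝[s] a) (𝓝 0) := by
    have e1 := tendsto_iff_norm_sub_tendsto_zero.1 (hf a ha)
    have e2 := tendsto_iff_norm_sub_tendsto_zero.1
      (((hR.continuous_unitaryGroup (f a)).tendsto (τ a)).comp (hτ a ha))
    simpa using e1.add e2
  refine squeeze_zero (fun _ => norm_nonneg _) (fun x => ?_) h1
  calc _ = ‖unitaryGroup R (τ x) (f x - f a)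
        + (unitaryGroup R (τ x) (f a) - unitaryGroup R (τ a) (f a))‖ := by
          rw [map_sub]; congr 1; abel
    _ ≤ _ := (norm_add_le _ _).trans (by rw [hR.norm_unitaryGroup])

/-- On the domain `R(H)` of the generator the group is strongly differentiable. -/
lemma hasDerivAt_unitaryGroup (hR : IsResolvent R) (k : H) (t : ℝ) :
    HasDerivAt (fun s => unitaryGroup R s (R k))
      (Complex.I • unitaryGroup R t (R k - k)) t := by
  -- On `R²(H)` the Taylor bound in operator norm applies. The range `R(H)` is then reached by
  -- letting `R (y n) → k`: the derivatives converge uniformly in time because the group is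
  -- isometric.
  have base : ∀ y t, HasDerivAt (fun s => unitaryGroup R s (R (R y)))
      (Complex.I • unitaryGroup R t (R (R y) - R y)) t := fun y t => by
    have e (s : ℝ) : unitaryGroup R s (R (R y)) = (R * phaseOp R s) y := by
      rw [hR.unitaryGroup_apply, ← hR.phaseOp_comm]; rfl
    have e' : unitaryGroup R t (R (R y) - R y) = ((R - 1) * phaseOp R t) y := by
      rw [map_sub, e, hR.unitaryGroup_apply]
      simp [sub_mul]
    rw [e', hasDerivAt_iff_isLittleO_nhds_zero]
    simp_rw [e]
    refine Asymptotics.IsBigO.trans_isLittleO (g := fun h : ℝ => h ^ 2) ?_ ?_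
    · refine Asymptotics.IsBigO.of_bound (8 * ‖y‖) (Eventually.of_forall fun h => ?_)
      have := ((R * phaseOp R (t + h) - R * phaseOp R t
        - (h : ℂ) • (Complex.I • ((R - 1) * phaseOp R t)))).le_of_opNorm_le
        (hR.norm_phaseOp_taylor_le t h) y
      rw [Real.norm_of_nonneg (sq_nonneg h), mul_right_comm]
      exact this
    · simpa using Asymptotics.isLittleO_pow_pow (𝕜 := ℝ) (m := 1) (n := 2) (by norm_num)
  obtain ⟨y, hy⟩ : ∃ y : ℕ → H, Tendsto (fun n => R (y n)) atTop (𝓝 k) := by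
    obtain ⟨v, hv, hlim⟩ := mem_closure_iff_seq_limit.1 (hR.denseRange k)
    choose y hy using hv
    exact ⟨y, by simpa only [hy] using hlim⟩
  refine hasDerivAt_of_tendstoUniformlyOn (s := univ) (l := atTop)
    (f := fun n s => unitaryGroup R s (R (R (y n))))
    (f' := fun n t => Complex.I • unitaryGroup R t (R (R (y n)) - R (y n)))
    (g' := fun t => Complex.I • unitaryGroup R t (R k - k)) isOpen_univ ?_
    (Eventually.of_forall fun n t _ => base (y n) t) (fun s _ => ?_) (mem_univ t)
  · have h0 : Tendsto (fun n => ‖R k - k - (R (R (y n)) - R (y n))‖) atTop (𝓝 0) := by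
      have h1 : Tendsto (fun n => R (R (y n)) - R (y n)) atTop (𝓝 (R k - k)) :=
        ((R.continuous.tendsto k).comp hy).sub hy
      have := (tendsto_const_nhds (x := R k - k)).sub h1
      simpa using this.norm
    rw [Metric.tendstoUniformlyOn_iff]
    intro ε hε
    filter_upwards [h0.eventually (gt_mem_nhds hε)] with n hn t _
    rwa [dist_eq_norm, ← smul_sub, ← map_sub, norm_smul, Complex.norm_I, one_mul,
      hR.norm_unitaryGroup]
  · exact ((unitaryGroup R s).continuous.tendsto _).comp ((R.continuous.tendsto k).comp hy)

end IsResolvent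

end UnitaryGroup

end

noncomputable section

set_option linter.unusedSectionVars false

/-! ### The self-adjoint operator of a closed gradient -/

section GradientGraph

open Filter Topology

variable {H E : Type*} [NormedAddCommGroup H] [InnerProductSpace ℂ H] [CompleteSpace H]
  [NormedAddCommGroup E] [InnerProductSpace ℂ E] [CompleteSpace E]

/-- `f = -∇^* ∇ w`, where `G` is the graph of `∇`. -/
def GraphLaplacian (G : Submodule ℂ (WithLp 2 (H × E))) (w f : H) : Prop :=
  ∃ g, WithLp.toLp 2 (w, g) ∈ G ∧ ∀ p ∈ G, inner ℂ g p.snd = -inner ℂ f p.fst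

/-- `(1 + ∇^* ∇)⁻¹`, where `G` is the graph of `∇`. -/
def graphResolvent (G : Submodule ℂ (WithLp 2 (H × E))) [G.HasOrthogonalProjection] : H →L[ℂ] H :=
  WithLp.fstL 2 ℂ H E ∘L G.starProjection ∘L
    ((WithLp.prodContinuousLinearEquiv 2 ℂ H E).symm : H × E →L[ℂ] WithLp 2 (H × E)) ∘L
      ContinuousLinearMap.inl ℂ H E

section

variable (G : Submodule ℂ (WithLp 2 (H × E))) [G.HasOrthogonalProjection]

lemma graphResolvent_apply (f : H) :
    graphResolvent G f = (G.starProjection (WithLp.toLp 2 (f, 0))).fst := rfl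

/-- That `(f, 0)` minus its projection is orthogonal to `G` is the weak form of `(1 + ∇^*∇) w = f`;
the second component of the projection is `∇w`. -/
lemma exists_graphResolvent_eq (f : H) : ∃ g, WithLp.toLp 2 (graphResolvent G f, g) ∈ G ∧
    ∀ p ∈ G, inner ℂ g p.snd = inner ℂ (f - graphResolvent G f) p.fst := by
  set q := G.starProjection (WithLp.toLp 2 (f, 0)) with hq
  refine ⟨q.snd, ?_, fun p hp => ?_⟩
  · have : WithLp.toLp 2 (graphResolvent G f, q.snd) = q := rfl
    rw [this]
    exact G.starProjection_apply_mem _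
  · have h := (G.mem_orthogonal' _).1
      (G.sub_starProjection_mem_orthogonal (WithLp.toLp 2 (f, 0))) p hp
    rw [← hq, WithLp.prod_inner_apply] at h
    simp only [WithLp.ofLp_sub, Prod.fst_sub, Prod.snd_sub, zero_sub, inner_neg_left] at h
    rw [← sub_eq_add_neg, sub_eq_zero] at h
    exact h.symm

/-- Two solutions with difference `(w, g)` satisfy `‖g‖² = -‖w‖²`, by testing with the difference
itself. -/
lemma eq_graphResolvent {f w : H} {g : E} (hw : WithLp.toLp 2 (w, g) ∈ G)
    (h : ∀ p ∈ G, inner ℂ g p.snd = inner ℂ (f - w) p.fst) : w = graphResolvent G f := by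
  obtain ⟨g', hw', h'⟩ := exists_graphResolvent_eq G f
  have hd := G.sub_mem hw hw'
  have e1 := h _ hd
  have e2 := h' _ hd
  simp only [← WithLp.toLp_sub, Prod.mk_sub_mk, WithLp.toLp_fst, WithLp.toLp_snd] at e1 e2
  have e3 : inner ℂ (g - g') (g - g')
      = -inner ℂ (w - graphResolvent G f) (w - graphResolvent G f) := by
    rw [inner_sub_left, e1, e2, ← inner_sub_left, ← inner_neg_left]; congr 1; abel
  have e4 := congrArg RCLike.re e3
  rw [map_neg, inner_self_eq_norm_sq, inner_self_eq_norm_sq] at e4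
  have : ‖w - graphResolvent G f‖ ^ 2 = 0 :=
    le_antisymm (by nlinarith [sq_nonneg ‖g - g'‖]) (sq_nonneg _)
  exact sub_eq_zero.1 (norm_eq_zero.1 (pow_eq_zero_iff two_ne_zero |>.1 this))

/-- `Δw = f` means `(1 - Δ)w = w - f`. This identifies the domain of `Δ` with the range of the
resolvent, where the group is differentiable. -/
lemma graphLaplacian_iff {w f : H} :
    GraphLaplacian G w f ↔ w = graphResolvent G (w - f) := by
  constructor
  · rintro ⟨g, hg, h⟩
    refine eq_graphResolvent G hg fun p hp => ?_
    rw [h p hp, sub_sub_cancel_left, inner_neg_left]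
  · intro h
    obtain ⟨g, hg, h'⟩ := exists_graphResolvent_eq G (w - f)
    rw [← h] at hg h'
    refine ⟨g, hg, fun p hp => ?_⟩
    rw [h' p hp, sub_sub_cancel_left, inner_neg_left]

lemma graphLaplacian_graphResolvent (k : H) :
    GraphLaplacian G (graphResolvent G k) (graphResolvent G k - k) := by
  rw [graphLaplacian_iff, sub_sub_cancel]

/-- The resolvent at `1` of the operator of a densely defined gradient. -/
lemma isResolvent_graphResolvent (hG : ∀ f : H, (∀ p ∈ G, inner ℂ f p.fst = 0) → f = 0) :
    IsResolvent (graphResolvent G) := by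
  have hin (x y : H) : inner ℂ x (graphResolvent G y)
      = inner ℂ (WithLp.toLp 2 (x, (0 : E))) (G.starProjection (WithLp.toLp 2 (y, 0))) := by
    rw [WithLp.prod_inner_apply]; simp [graphResolvent_apply]
  have hsym : ∀ x y : H, inner ℂ (graphResolvent G x) y = inner ℂ x (graphResolvent G y) :=
    fun x y => by
      have := G.starProjection_isSymmetric (WithLp.toLp 2 (x, (0 : E))) (WithLp.toLp 2 (y, (0 : E)))
      rw [hin, ← inner_conj_symm, hin]
      simp only [ContinuousLinearMap.coe_coe] at this
      rw [← this, inner_conj_symm]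
  refine ⟨ContinuousLinearMap.isSelfAdjoint_iff_isSymmetric.2 hsym, ?_, ?_⟩
  · refine ContinuousLinearMap.opNorm_le_bound _ zero_le_one fun x => ?_
    rw [one_mul, graphResolvent_apply]
    calc _ ≤ ‖G.starProjection (WithLp.toLp 2 (x, (0 : E)))‖ := WithLp.norm_fst_le _ _
      _ ≤ ‖WithLp.toLp 2 (x, (0 : E))‖ := G.norm_starProjection_apply_le _
      _ = ‖x‖ := by simp
  -- The range of a symmetric operator is dense once its kernel is trivial. If the resolvent kills
  -- `f`, the gradient part vanishes too, so `f` is orthogonal to all first components of `G`.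
  · have hd : Dense ((graphResolvent G).range : Set H) := by
      rw [Submodule.dense_iff_topologicalClosure_eq_top, Submodule.topologicalClosure_eq_top_iff,
        Submodule.eq_bot_iff]
      intro f hf
      have hf0 : graphResolvent G f = 0 := by
        refine ext_inner_left ℂ fun y => ?_
        rw [← hsym, inner_zero_right]
        exact (Submodule.mem_orthogonal _ _).1 hf _ ⟨y, rfl⟩
      obtain ⟨g, hg, h⟩ := exists_graphResolvent_eq G f
      rw [hf0] at hg h
      have hg0 : g = 0 := by
        have := h _ hg
        simpa using this
      refine hG f fun p hp => ?_
      rw [← sub_zero f, ← h p hp, hg0, inner_zero_left]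
    exact hd

end

/-- The graph of `√σ ∇`, where `G` is the graph of `∇`. -/
def scaledGraph (G : Submodule ℂ (WithLp 2 (H × E))) (σ : ℝ) : Submodule ℂ (WithLp 2 (H × E)) where
  carrier := {p | WithLp.toLp 2 (p.fst, ((Real.sqrt σ)⁻¹ : ℂ) • p.snd) ∈ G}
  zero_mem' := by
    change WithLp.toLp 2 ((0 : H), ((Real.sqrt σ)⁻¹ : ℂ) • (0 : E)) ∈ G
    rw [smul_zero]; exact G.zero_mem
  add_mem' {p q} hp hq := by
    have := G.add_mem hp hq
    simpa [← WithLp.toLp_add, smul_add] using! this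
  smul_mem' c p hp := by
    have := G.smul_mem c hp
    simpa [← WithLp.toLp_smul, smul_comm c] using! this

lemma isClosed_scaledGraph (G : Submodule ℂ (WithLp 2 (H × E))) (hG : IsClosed (G : Set (WithLp 2 (H × E))))
    (σ : ℝ) : IsClosed (scaledGraph G σ : Set (WithLp 2 (H × E))) := by
  refine hG.preimage (f := fun p : WithLp 2 (H × E) =>
    WithLp.toLp 2 (p.fst, ((Real.sqrt σ)⁻¹ : ℂ) • p.snd)) ?_
  fun_prop

/-- Approximation in the domain of the gradient by the domain of the operator. -/
lemma exists_graphLaplacian_near {G : Submodule ℂ (WithLp 2 (H × E))} (hG : IsClosed (G : Set (WithLp 2 (H × E))))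
    {u : H} {g : E} (hu : WithLp.toLp 2 (u, g) ∈ G) {r : ℝ} (hr : 0 < r) :
    ∃ w f, GraphLaplacian G w f ∧ ‖u - w‖ ≤ r * ‖g‖ ∧ r * ‖f‖ ≤ ‖g‖ := by
  have hsq : Real.sqrt (r ^ 2) = r := Real.sqrt_sq hr.le
  have hrc : (r : ℂ) ≠ 0 := by exact_mod_cast hr.ne'
  have : CompleteSpace (scaledGraph G (r ^ 2)) :=
    (isClosed_scaledGraph G hG (r ^ 2)).completeSpace_coe
  -- The approximation is `w = (1 - r²Δ)⁻¹ u`, with `γ = r∇w` and `Δw = (w - u)/r²`.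
  obtain ⟨γ, hγ, h⟩ := exists_graphResolvent_eq (scaledGraph G (r ^ 2)) u
  set w := graphResolvent (scaledGraph G (r ^ 2)) u with hw
  have hmem : WithLp.toLp 2 (w, (r⁻¹ : ℂ) • γ) ∈ G := by
    have : WithLp.toLp 2 (w, ((Real.sqrt (r ^ 2))⁻¹ : ℂ) • γ) ∈ G := hγ
    rwa [hsq] at this
  have hmem' : ∀ p ∈ G, (r : ℂ) * inner ℂ γ p.snd = inner ℂ (u - w) p.fst := fun p hp => by
    have := h (WithLp.toLp 2 (p.fst, (r : ℂ) • p.snd)) (by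
      change WithLp.toLp 2 (p.fst, ((Real.sqrt (r ^ 2))⁻¹ : ℂ) • (r : ℂ) • p.snd) ∈ G
      rw [hsq, smul_smul, inv_mul_cancel₀ hrc, one_smul]
      exact hp)
    rwa [WithLp.toLp_fst, WithLp.toLp_snd, inner_smul_right] at this
  -- Testing with `(u, g) - (w, γ/r)` gives `‖u - w‖² = r⟨γ, g⟩ - ‖γ‖²`; completing the square
  -- bounds this by `(r‖g‖)²/4`.
  have key : ‖u - w‖ ^ 2 ≤ (r * ‖g‖) ^ 2 := by
    have e := hmem' _ (G.sub_mem hu hmem)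
    simp only [← WithLp.toLp_sub, Prod.mk_sub_mk, WithLp.toLp_fst, WithLp.toLp_snd, inner_sub_right,
      inner_smul_right] at e
    rw [← inner_sub_right, mul_sub, mul_inv_cancel_left₀ hrc] at e
    have e' := congrArg RCLike.re e
    rw [inner_self_eq_norm_sq, map_sub, inner_self_eq_norm_sq] at e'
    have e3 : RCLike.re ((r : ℂ) * inner ℂ γ g) ≤ r * (‖γ‖ * ‖g‖) := by
      refine (RCLike.re_le_norm _).trans ?_
      rw [norm_mul, Complex.norm_real, Real.norm_of_nonneg hr.le]
      gcongr
      exact norm_inner_le_norm _ _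
    nlinarith [sq_nonneg (‖γ‖ - r * ‖g‖ / 2), norm_nonneg g, norm_nonneg γ, sq_nonneg (r * ‖g‖)]
  have key' : ‖u - w‖ ≤ r * ‖g‖ := abs_le_of_sq_le_sq key (by positivity) |> (abs_le.1 · |>.2)
  refine ⟨w, ((r ^ 2 : ℝ) : ℂ)⁻¹ • (w - u), ⟨(r⁻¹ : ℂ) • γ, hmem, fun p hp => ?_⟩, key', ?_⟩
  · rw [inner_smul_left, inner_smul_left, ← neg_sub u w, inner_neg_left, ← hmem' p hp]
    simp only [map_inv₀, Complex.conj_ofReal]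
    push_cast
    field_simp
  · rw [norm_smul, norm_inv, Complex.norm_real, Real.norm_of_nonneg (by positivity), norm_sub_rev]
    calc r * ((r ^ 2)⁻¹ * ‖u - w‖) ≤ r * ((r ^ 2)⁻¹ * (r * ‖g‖)) := by gcongr
      _ = ‖g‖ := by field_simp

/-! ### The unitary group of `-∇^*∇` and weak solutions -/

section

variable (G : Submodule ℂ (WithLp 2 (H × E))) [G.HasOrthogonalProjection]

/-- The unitary group `e^{itΔ}`, where `Δ = -∇^* ∇` and `G` is the graph of `∇`. -/
def graphGroup (t : ℝ) : H →L[ℂ] H := unitaryGroup (graphResolvent G) t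

variable {G} {w f : H}

lemma GraphLaplacian.hasDerivAt (hR : IsResolvent (graphResolvent G)) (h : GraphLaplacian G w f)
    (t : ℝ) : HasDerivAt (fun s => graphGroup G s w) (Complex.I • graphGroup G t f) t := by
  have e := (graphLaplacian_iff G).1 h
  have := hR.hasDerivAt_unitaryGroup (w - f) t
  rwa [← e, sub_sub_cancel] at this

lemma GraphLaplacian.graphGroup (hR : IsResolvent (graphResolvent G)) (h : GraphLaplacian G w f)
    (t : ℝ) : GraphLaplacian G (graphGroup G t w) (graphGroup G t f) := by
  have e := (graphLaplacian_iff G).1 h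
  rw [graphLaplacian_iff, ← map_sub]
  change unitaryGroup (graphResolvent G) t w = _
  conv_lhs => rw [e]
  exact hR.unitaryGroup_comm t _

lemma GraphLaplacian.norm_graphGroup_sub_le (hR : IsResolvent (graphResolvent G))
    (h : GraphLaplacian G w f) {t : ℝ} : ‖_root_.graphGroup G t w - w‖ ≤ ‖f‖ * |t| := by
  have := Convex.norm_image_sub_le_of_norm_hasDerivWithin_le (𝕜 := ℝ) (s := univ) (x := 0) (y := t)
    (f := fun s => _root_.graphGroup G s w) (C := ‖f‖)
    (fun s _ => (h.hasDerivAt hR s).hasDerivWithinAt) (fun s _ => by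
      rw [norm_smul, Complex.norm_I, one_mul]; exact (hR.norm_unitaryGroup s f).le) convex_univ
    (mem_univ _) (mem_univ _)
  have h0 : _root_.graphGroup G 0 w = w := hR.unitaryGroup_zero w
  simpa [h0] using this

/-- The group moves an element of the form domain by `O(√t)`. -/
lemma norm_graphGroup_sub_le (hG : IsClosed (G : Set (WithLp 2 (H × E)))) (hR : IsResolvent (graphResolvent G))
    {u : H} {g : E} (hu : WithLp.toLp 2 (u, g) ∈ G) (t : ℝ) :
    ‖graphGroup G t u - u‖ ≤ 3 * Real.sqrt |t| * ‖g‖ := by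
  rcases eq_or_ne t 0 with rfl | ht
  · have h0 : graphGroup G 0 u = u := hR.unitaryGroup_zero u
    simp [h0]
  have hr : 0 < Real.sqrt |t| := Real.sqrt_pos.2 (abs_pos.2 ht)
  -- The scale `r = √|t|` balances the approximation error `r‖g‖`, which occurs twice, and the
  -- displacement `|t|‖f‖ ≤ (|t|/r)‖g‖` of `w`; hence the constant `3`.
  obtain ⟨w, f, h, h1, h2⟩ := exists_graphLaplacian_near hG hu hr
  have h3 := h.norm_graphGroup_sub_le hR (t := t)
  have h4 : ‖graphGroup G t (u - w)‖ = ‖u - w‖ := hR.norm_unitaryGroup t _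
  have h5 : ‖f‖ * |t| ≤ Real.sqrt |t| * ‖g‖ := by
    calc ‖f‖ * |t| = Real.sqrt |t| * (Real.sqrt |t| * ‖f‖) := by
          rw [← mul_assoc, Real.mul_self_sqrt (abs_nonneg t), mul_comm]
      _ ≤ _ := by gcongr
  calc ‖graphGroup G t u - u‖ = ‖graphGroup G t (u - w) + (graphGroup G t w - w) - (u - w)‖ := by
        rw [map_sub]; congr 1; abel
    _ ≤ ‖graphGroup G t (u - w)‖ + ‖graphGroup G t w - w‖ + ‖u - w‖ :=
      (norm_sub_le _ _).trans (by gcongr; exact norm_add_le _ _)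
    _ ≤ _ := by rw [h4]; linarith

/-- The variation of constants formula, in weak form. -/
lemma hasDerivAt_inner_graphGroup_neg (hR : IsResolvent (graphResolvent G)) {v : ℝ → H} {N : H}
    {I : Set ℝ} {t : ℝ} (hI : I ∈ 𝓝 t) (hv : ContinuousOn v I)
    (hd : ∀ w f, GraphLaplacian G w f →
      HasDerivAt (fun s => inner ℂ w (v s)) (Complex.I * inner ℂ f (v t) + inner ℂ w N) t)
    (h : GraphLaplacian G w f) :
    HasDerivAt (fun s => inner ℂ w (graphGroup G (-s) (v s)))
      (inner ℂ w (graphGroup G (-t) N)) t := by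
  have hU (s : ℝ) (y : H) : inner ℂ w (graphGroup G (-s) y) = inner ℂ (graphGroup G s w) y :=
    (hR.inner_unitaryGroup_left s w y).symm
  simp_rw [hU]
  have h1 := hd _ _ (h.graphGroup hR t)
  -- A product rule although `v` is only continuous in norm: the difference quotients of the moving
  -- test vector converge strongly and are paired with `v s → v t`. The remaining term has a fixed
  -- test vector, to which the weak equation applies.
  have h2 : HasDerivAt (fun s => inner ℂ (graphGroup G s w - graphGroup G t w) (v s))
      (inner ℂ (Complex.I • graphGroup G t f) (v t)) t := by
    rw [hasDerivAt_iff_tendsto_slope]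
    have h3 := (hasDerivAt_iff_tendsto_slope.1 (h.hasDerivAt hR t)).inner (𝕜 := ℂ)
      ((hv.continuousAt hI).tendsto.mono_left (nhdsWithin_le_nhds (s := {t}ᶜ)))
    refine h3.congr fun s => ?_
    rw [slope_def_module, slope_def_module, sub_self, inner_zero_left, sub_zero,
      ← Complex.coe_smul, ← Complex.coe_smul, inner_smul_left, Complex.conj_ofReal, smul_eq_mul]
  refine (h2.add h1).congr_deriv ?_ |>.congr_of_eventuallyEq (Eventually.of_forall fun s => ?_)
  · rw [inner_smul_left, Complex.conj_I]; ring
  · simp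

/-- Uniqueness for the free evolution in the weak sense. -/
lemma eq_graphGroup_of_weak (hR : IsResolvent (graphResolvent G)) {v : ℝ → H} (hv : Continuous v)
    (hd : ∀ w f, GraphLaplacian G w f → ∀ t,
      HasDerivAt (fun s => inner ℂ w (v s)) (Complex.I * inner ℂ f (v t)) t) (t : ℝ) :
    v t = graphGroup G t (v 0) := by
  have key : graphGroup G (-t) (v t) = v 0 := by
    refine hR.denseRange.eq_of_inner_left ℂ ?_
    intro k
    -- Without a source term, `e^{-isΔ} v(s)` tested against the range of the resolvent has zero
    -- derivative.
    have hc := is_const_of_deriv_eq_zero (𝕜 := ℝ)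
      (f := fun s => inner ℂ (graphResolvent G k) (graphGroup G (-s) (v s)))
      (fun s => ?_) (fun s => ?_) t 0
    · have h0 : graphGroup G (-0) (v 0) = v 0 := by
        rw [neg_zero]; exact hR.unitaryGroup_zero _
      rw [h0] at hc
      have := congrArg (starRingEnd ℂ) hc
      rwa [inner_conj_symm, inner_conj_symm] at this
    · exact (hasDerivAt_inner_graphGroup_neg (N := 0) hR univ_mem hv.continuousOn
        (fun w f h => by simpa using hd w f h s)
        (graphLaplacian_graphResolvent G k)).differentiableAt
    · simpa using (hasDerivAt_inner_graphGroup_neg (N := 0) hR univ_mem hv.continuousOn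
        (fun w f h => by simpa using hd w f h s)
        (graphLaplacian_graphResolvent G k)).deriv
  rw [← key]
  exact (hR.unitaryGroup_apply_neg t (v t)).symm

/-- The group gives the free evolution in the weak sense. -/
lemma hasDerivAt_inner_graphGroup (hR : IsResolvent (graphResolvent G)) (h : GraphLaplacian G w f)
    (y : H) (t : ℝ) : HasDerivAt (fun s => inner ℂ w (graphGroup G s y))
      (Complex.I * inner ℂ f (graphGroup G t y)) t := by
  have hU (s : ℝ) (x : H) : inner ℂ x (graphGroup G s y) = inner ℂ (graphGroup G (-s) x) y := by
    have := (hR.inner_unitaryGroup_left (-s) x y).symm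
    rwa [neg_neg] at this
  simp_rw [hU]
  have h1 := HasDerivAt.scomp t (h.hasDerivAt hR (-t)) (hasDerivAt_neg t)
  have h2 := h1.inner ℂ (hasDerivAt_const t y)
  refine h2.congr_deriv ?_
  simp [inner_smul_left]

/-- Mean value inequality for the interaction picture of an inhomogeneous equation. -/
lemma norm_graphGroup_neg_sub_le (hR : IsResolvent (graphResolvent G)) {v N : ℝ → H} {c : H}
    {a b B : ℝ} (hab : a ≤ b) (hv : ContinuousOn v (Icc a b))
    (hd : ∀ w f, GraphLaplacian G w f → ∀ t ∈ Ioo a b,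
      HasDerivAt (fun s => inner ℂ w (v s)) (Complex.I * inner ℂ f (v t) + inner ℂ w (N t)) t)
    (hB : ∀ t ∈ Ioo a b, ‖graphGroup G (a - t) (N t) - c‖ ≤ B) :
    ‖graphGroup G (a - b) (v b) - v a - ((b - a : ℝ) : ℂ) • c‖ ≤ B * (b - a) := by
  rcases hab.eq_or_lt with rfl | hlt
  · have h0 : graphGroup G (a - a) (v a) = v a := by
      rw [sub_self]; exact hR.unitaryGroup_zero _
    rw [h0]; simp
  have hB0 : 0 ≤ B := (norm_nonneg _).trans (hB ((a + b) / 2) ⟨by linarith, by linarith⟩)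
  have hadd (s t : ℝ) (x : H) : graphGroup G (s + t) x = graphGroup G s (graphGroup G t x) :=
    hR.unitaryGroup_add s t x
  set e : ℝ → H := fun s => graphGroup G (a - s) (v s) - ((s - a : ℝ) : ℂ) • c with he
  have hec : ContinuousOn e (Icc a b) := by
    refine ContinuousOn.sub (hR.continuous_unitaryGroup_apply (by fun_prop) hv) (by fun_prop)
  -- The curve `e` is differentiable only when paired with the domain of `Δ`, so the mean value
  -- inequality is proved for these pairings and the norm is recovered by duality.
  have hin : ∀ w f, GraphLaplacian G w f → ‖inner ℂ w (e b - e a)‖ ≤ ‖w‖ * (B * (b - a)) := by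
    intro w f h
    have hder : ∀ t ∈ Ioo a b, HasDerivAt (fun s => inner ℂ w (e s))
        (inner ℂ w (graphGroup G (a - t) (N t) - c)) t := by
      intro t ht
      have h1 := hasDerivAt_inner_graphGroup_neg hR (Icc_mem_nhds ht.1 ht.2) hv
        (fun w f h => hd w f h t ht) (h.graphGroup hR (-a))
      have hU (s : ℝ) (y : H) : inner ℂ (graphGroup G (-a) w) (graphGroup G (-s) y)
          = inner ℂ w (graphGroup G (a - s) y) := by
        have := hR.inner_unitaryGroup_left (-a) w (graphGroup G (-s) y)
        rw [neg_neg] at this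
        rw [sub_eq_add_neg, hadd]; exact this
      simp_rw [hU] at h1
      have h2 : HasDerivAt (fun s : ℝ => ((s - a : ℝ) : ℂ) * inner ℂ w c) (1 * inner ℂ w c) t := by
        refine HasDerivAt.mul_const ?_ _
        exact_mod_cast ((hasDerivAt_id t).sub_const a).ofReal_comp
      rw [one_mul] at h2
      simp only [he, inner_sub_right, inner_smul_right]
      exact h1.sub h2
    have hcont : ContinuousOn (fun s => inner ℂ w (e s)) (Icc a b) :=
      continuousOn_const.inner hec
    have hmv : ∀ x ∈ Ioo a b, ∀ y ∈ Ioo a b, ‖inner ℂ w (e y) - inner ℂ w (e x)‖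
        ≤ ‖w‖ * B * ‖y - x‖ := fun x hx y hy =>
      Convex.norm_image_sub_le_of_norm_hasDerivWithin_le (𝕜 := ℝ) (s := Ioo a b)
        (fun t ht => (hder t ht).hasDerivWithinAt) (fun t ht => (norm_inner_le_norm _ _).trans
          (by gcongr; exact hB t ht)) (convex_Ioo a b) hx hy
    -- The equation is known only in the open interval; continuity carries the increment bound to
    -- the endpoints.
    have hcl : ∀ p ∈ Icc a b ×ˢ Icc a b, ‖inner ℂ w (e p.2) - inner ℂ w (e p.1)‖
        ≤ ‖w‖ * B * ‖p.2 - p.1‖ := by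
      have hclo : closure (Ioo a b ×ˢ Ioo a b) = Icc a b ×ˢ Icc a b := by
        rw [closure_prod_eq, closure_Ioo hlt.ne]
      rw [← hclo]
      intro p hp
      refine ContinuousWithinAt.closure_le hp (f := fun p : ℝ × ℝ =>
        ‖inner ℂ w (e p.2) - inner ℂ w (e p.1)‖) (g := fun p => ‖w‖ * B * ‖p.2 - p.1‖) ?_
        (by fun_prop) (fun q hq => hmv q.1 hq.1 q.2 hq.2)
      have hp' : p ∈ Icc a b ×ˢ Icc a b := hclo ▸ hp
      have hsub : Ioo a b ×ˢ Ioo a b ⊆ Icc a b ×ˢ Icc a b :=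
        prod_mono Ioo_subset_Icc_self Ioo_subset_Icc_self
      have c1 : ContinuousOn (fun p : ℝ × ℝ => inner ℂ w (e p.2)) (Icc a b ×ˢ Icc a b) :=
        hcont.comp continuousOn_snd fun q hq => hq.2
      have c2 : ContinuousOn (fun p : ℝ × ℝ => inner ℂ w (e p.1)) (Icc a b ×ˢ Icc a b) :=
        hcont.comp continuousOn_fst fun q hq => hq.1
      exact ((c1.sub c2).norm p hp').mono hsub
    have := hcl (a, b) ⟨left_mem_Icc.2 hab, right_mem_Icc.2 hab⟩
    rw [← inner_sub_right, Real.norm_of_nonneg (sub_nonneg.2 hab)] at this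
    linarith
  have hall : ∀ w, ‖inner ℂ w (e b - e a)‖ ≤ ‖w‖ * (B * (b - a)) := fun w =>
    hR.denseRange.induction_on (p := fun w => ‖inner ℂ w (e b - e a)‖ ≤ ‖w‖ * (B * (b - a))) w
      (isClosed_le (by fun_prop) (by fun_prop))
      fun k => hin _ _ (graphLaplacian_graphResolvent G k)
  have hea : e b - e a = graphGroup G (a - b) (v b) - v a - ((b - a : ℝ) : ℂ) • c := by
    have h0 : graphGroup G (a - a) (v a) = v a := by
      rw [sub_self]; exact hR.unitaryGroup_zero _
    simp only [he, h0]; simp; abel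
  rw [← hea]
  -- The test vectors are now arbitrary, so the increment is tested with itself.
  have h1 := hall (e b - e a)
  rw [inner_self_eq_norm_sq_to_K] at h1
  rcases (norm_nonneg (e b - e a)).eq_or_lt with h0 | h0
  · rw [← h0]; exact mul_nonneg hB0 (sub_nonneg.2 hab)
  · refine le_of_mul_le_mul_left ?_ h0
    simpa [sq] using h1

end

end GradientGraph

end

noncomputable section

/-! ### Test functions -/

lemma partialDeriv_mul {d : ℕ} {ψ χ : Space d → ℂ} (hψ : Differentiable ℝ ψ)
    (hχ : Differentiable ℝ χ) (j : Fin d) (x : Space d) :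
    partialDeriv j (fun y => ψ y * χ y) x = partialDeriv j ψ x * χ x + ψ x * partialDeriv j χ x := by
  have h : HasFDerivAt (fun y => ψ y * χ y) (ψ x • fderiv ℝ χ x + χ x • fderiv ℝ ψ x) x :=
    (hψ x).hasFDerivAt.mul (hχ x).hasFDerivAt
  rw [partialDeriv, h.fderiv]
  simp [partialDeriv]; ring

lemma contDiff_partialDeriv {d : ℕ} {ψ : Space d → ℂ} (hψ : ContDiff ℝ ∞ ψ) (j : Fin d) :
    ContDiff ℝ ∞ (partialDeriv j ψ) := by
  have : ContDiff ℝ ∞ (fderiv ℝ ψ) := hψ.fderiv_right le_rfl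
  exact this.clm_apply contDiff_const

lemma laplacian_eq_sum_partialDeriv {d : ℕ} {ψ : Space d → ℂ} (hψ : ContDiff ℝ ∞ ψ) (x : Space d) :
    (Δ ψ) x = ∑ j, partialDeriv j (partialDeriv j ψ) x := by
  rw [InnerProductSpace.laplacian_eq_iteratedFDeriv_orthonormalBasis ψ
    (EuclideanSpace.basisFun (Fin d) ℝ)]
  refine Finset.sum_congr rfl fun j _ => ?_
  rw [iteratedFDeriv_two_apply]
  have h1 : DifferentiableAt ℝ (fderiv ℝ ψ) x :=
    ((hψ.fderiv_right (m := ∞) le_rfl).differentiable (by simp)) x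
  unfold partialDeriv
  rw [fderiv_clm_apply h1 (differentiableAt_const _)]
  simp

lemma norm_fderiv_le_sum_partialDeriv {d : ℕ} (ψ : Space d → ℂ) (x : Space d) :
    ‖fderiv ℝ ψ x‖ ≤ ∑ j, ‖partialDeriv j ψ x‖ := by
  refine ContinuousLinearMap.opNorm_le_bound _ (by positivity) fun v => ?_
  have hv : v = ∑ j, v j • EuclideanSpace.single j (1 : ℝ) := by
    have := (EuclideanSpace.basisFun (Fin d) ℝ).sum_repr v
    simpa using this.symm
  conv_lhs => rw [hv, map_sum]
  rw [Finset.sum_mul]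
  refine (norm_sum_le _ _).trans (Finset.sum_le_sum fun j _ => ?_)
  rw [map_smul, norm_smul, mul_comm]
  exact mul_le_mul_of_nonneg_left (PiLp.norm_apply_le v j) (norm_nonneg _)

lemma norm_partialDeriv_comp_le {d : ℕ} {F : ℂ → ℂ} {K : NNReal} (hF : LipschitzWith K F)
    (hF' : Differentiable ℝ F) {ψ : Space d → ℂ} (hψ : Differentiable ℝ ψ) (j : Fin d)
    (x : Space d) : ‖partialDeriv j (F ∘ ψ) x‖ ≤ K * ‖partialDeriv j ψ x‖ := by
  unfold partialDeriv
  rw [fderiv_comp x (hF' _) (hψ x), ContinuousLinearMap.comp_apply]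
  exact (fderiv ℝ F (ψ x)).le_of_opNorm_le (norm_fderiv_le_of_lipschitz ℝ hF) _

/-- A closed box in Euclidean space. -/
def closedBox {d : ℕ} (a b : Fin d → ℝ) : Set (Space d) := WithLp.toLp 2 '' Icc a b

lemma isCompact_closedBox {d : ℕ} (a b : Fin d → ℝ) : IsCompact (closedBox a b) :=
  isCompact_Icc.image (PiLp.continuous_toLp 2 _)

lemma mem_closedBox {d : ℕ} {a b : Fin d → ℝ} {x : Space d} :
    x ∈ closedBox a b ↔ ∀ i, a i ≤ x i ∧ x i ≤ b i := by
  constructor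
  · rintro ⟨y, hy, rfl⟩ i
    exact ⟨hy.1 i, hy.2 i⟩
  · intro h
    exact ⟨WithLp.ofLp x, ⟨fun i => (h i).1, fun i => (h i).2⟩, rfl⟩

lemma integral_openBox {d : ℕ} (a b : Fin d → ℝ) (f : Space d → ℂ) :
    ∫ x in {x : Space d | ∀ i, a i < x i ∧ x i < b i}, f x
      = ∫ y in Icc a b, f (WithLp.toLp 2 y) := by
  rw [← (PiLp.volume_preserving_toLp (Fin d)).setIntegral_preimage_emb
    (MeasurableEquiv.toLp 2 (Fin d → ℝ)).measurableEmbedding]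
  refine setIntegral_congr_set ?_
  have : (WithLp.toLp 2 ⁻¹' {x : Space d | ∀ i, a i < x i ∧ x i < b i})
      = Set.pi univ fun i => Ioo (a i) (b i) := by
    ext y; simp
  rw [this, volume_pi]
  exact Measure.univ_pi_Ioo_ae_eq_Icc

/-! ### Test functions of the three settings and integration by parts -/

namespace Setting

variable {d : ℕ} {D : Setting d} {ψ χ : Space d → ℂ}

lemma isOpen_carrier (D : Setting d) : IsOpen D.carrier := by
  cases D with
  | whole => exact isOpen_univ
  | dirichlet U h _ _ => exact h
  | periodic a b _ =>
    simp only [carrier, ofPred_forall, ofPred_and]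
    exact isOpen_iInter_of_finite fun i => (isOpen_lt (by fun_prop) (by fun_prop)).inter
      (isOpen_lt (by fun_prop) (by fun_prop))

lemma measurableSet_carrier (D : Setting d) : MeasurableSet D.carrier :=
  D.isOpen_carrier.measurableSet

lemma periodic_carrier_subset (a b : Fin d → ℝ) (h : ∀ i, a i < b i) :
    (periodic a b h).carrier ⊆ closedBox a b := fun _ hx =>
  mem_closedBox.2 fun i => ⟨(hx i).1.le, (hx i).2.le⟩

lemma volume_periodic_carrier_lt_top (a b : Fin d → ℝ) (h : ∀ i, a i < b i) :
    volume (periodic a b h).carrier < ⊤ :=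
  (measure_mono (periodic_carrier_subset a b h)).trans_lt (isCompact_closedBox a b).measure_lt_top

namespace IsTest

lemma contDiff (hψ : D.IsTest ψ) : ContDiff ℝ ∞ ψ := by
  cases D <;> exact hψ.1

lemma continuous (hψ : D.IsTest ψ) : Continuous ψ := hψ.contDiff.continuous

lemma differentiable (hψ : D.IsTest ψ) : Differentiable ℝ ψ := hψ.contDiff.differentiable (by simp)

lemma comp (hψ : D.IsTest ψ) {F : ℂ → ℂ} (hF : ContDiff ℝ ∞ F) (h0 : F 0 = 0) :
    D.IsTest (F ∘ ψ) := by
  cases D with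
  | whole => exact ⟨hF.comp hψ.1, hψ.2.comp_left h0⟩
  | dirichlet U _ _ _ =>
    exact ⟨hF.comp hψ.1, hψ.2.1.comp_left h0, (tsupport_comp_subset h0 ψ).trans hψ.2.2⟩
  | periodic a b _ => exact ⟨hF.comp hψ.1, fun i x => congrArg F (hψ.2 i x)⟩

lemma const_mul (hψ : D.IsTest ψ) (c : ℂ) : D.IsTest (fun x => c * ψ x) :=
  hψ.comp (F := fun z => c * z) (by fun_prop) (mul_zero c)

lemma conj (hψ : D.IsTest ψ) : D.IsTest (fun x => starRingEnd ℂ (ψ x)) :=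
  hψ.comp (F := fun z => starRingEnd ℂ z) Complex.conjCLE.contDiff (map_zero _)

lemma add (hψ : D.IsTest ψ) (hχ : D.IsTest χ) : D.IsTest (fun x => ψ x + χ x) := by
  cases D with
  | whole => exact ⟨hψ.1.add hχ.1, hψ.2.add hχ.2⟩
  | dirichlet U _ _ _ =>
    exact ⟨hψ.1.add hχ.1, hψ.2.1.add hχ.2.1,
      (tsupport_add ψ χ).trans (union_subset hψ.2.2 hχ.2.2)⟩
  | periodic a b _ => exact ⟨hψ.1.add hχ.1, fun i x => congrArg₂ (· + ·) (hψ.2 i x) (hχ.2 i x)⟩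

lemma mul (hψ : D.IsTest ψ) (hχ : D.IsTest χ) : D.IsTest (fun x => ψ x * χ x) := by
  cases D with
  | whole => exact ⟨hψ.1.mul hχ.1, hψ.2.mul_right⟩
  | dirichlet U _ _ _ =>
    exact ⟨hψ.1.mul hχ.1, hψ.2.1.mul_right, (tsupport_mul_subset_left).trans hψ.2.2⟩
  | periodic a b _ => exact ⟨hψ.1.mul hχ.1, fun i x => congrArg₂ (· * ·) (hψ.2 i x) (hχ.2 i x)⟩

lemma zero (D : Setting d) : D.IsTest (fun _ => 0) := by
  cases D with
  | whole => exact ⟨contDiff_const, HasCompactSupport.zero⟩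
  | dirichlet U _ _ _ =>
    refine ⟨contDiff_const, HasCompactSupport.zero, ?_⟩
    have : tsupport (fun _ : Space d => (0 : ℂ)) = ∅ := tsupport_eq_empty_iff.2 rfl
    rw [this]; exact empty_subset _
  | periodic a b _ => exact ⟨contDiff_const, fun _ _ => rfl⟩

lemma partialDeriv (hψ : D.IsTest ψ) (j : Fin d) : D.IsTest (partialDeriv j ψ) := by
  have hc := contDiff_partialDeriv hψ.contDiff j
  have hsub : tsupport (_root_.partialDeriv j ψ) ⊆ tsupport ψ :=
    (closure_mono fun x hx => by
      rw [Function.mem_support] at hx ⊢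
      intro h; exact hx (by simp [_root_.partialDeriv, h])).trans (tsupport_fderiv_subset ℝ)
  cases D with
  | whole => exact ⟨hc, hψ.2.of_isClosed_subset (isClosed_tsupport _) hsub⟩
  | dirichlet U _ _ _ =>
    exact ⟨hc, hψ.2.1.of_isClosed_subset (isClosed_tsupport _) hsub, hsub.trans hψ.2.2⟩
  | periodic a b _ =>
    refine ⟨hc, fun i x => ?_⟩
    unfold _root_.partialDeriv
    rw [← fderiv_comp_add_right]
    simp_rw [hψ.2 i]

lemma memLp (hψ : D.IsTest ψ) (p : ℝ≥0∞) : MemLp ψ p D.meas := by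
  cases D with
  | whole => exact (hψ.continuous.memLp_of_hasCompactSupport hψ.2).restrict _
  | dirichlet U _ _ _ => exact (hψ.continuous.memLp_of_hasCompactSupport hψ.2.1).restrict _
  | periodic a b h =>
    obtain ⟨C, hC⟩ := (isCompact_closedBox a b).exists_bound_of_continuousOn
      hψ.continuous.continuousOn
    have : IsFiniteMeasure (periodic a b h).meas :=
      isFiniteMeasure_restrict.2 (volume_periodic_carrier_lt_top a b h).ne
    exact MemLp.of_bound hψ.continuous.aestronglyMeasurable C
      ((ae_restrict_iff' (measurableSet_carrier _)).2 (Filter.Eventually.of_forall fun x hx =>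
        hC x (periodic_carrier_subset a b h hx)))

lemma integrable (hψ : D.IsTest ψ) : Integrable ψ D.meas := memLp_one_iff_integrable.1 (hψ.memLp 1)

/-- For compact support this is integration by parts against the constant `1`. On a box it is the
divergence theorem, the integrals over opposite faces cancelling by periodicity. -/
lemma integral_partialDeriv (hψ : D.IsTest ψ) (j : Fin d) :
    ∫ x, _root_.partialDeriv j ψ x ∂D.meas = 0 := by
  have hcs (hs : HasCompactSupport ψ) : ∫ x, _root_.partialDeriv j ψ x = 0 := by
    have hi : Integrable (_root_.partialDeriv j ψ) := by
      refine (contDiff_partialDeriv hψ.contDiff j).continuous.integrable_of_hasCompactSupport ?_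
      exact (hs.fderiv ℝ).comp_left (g := fun L => L (EuclideanSpace.single j 1)) (by simp)
    have := integral_mul_fderiv_eq_neg_fderiv_mul_of_integrable (μ := volume)
      (f := fun _ : Space d => (1 : ℂ)) (g := ψ) (v := EuclideanSpace.single j 1)
      (by simp) (by simpa using! hi)
      (by simpa using! hψ.continuous.integrable_of_hasCompactSupport hs)
      (fun x _ => by fun_prop) (fun x _ => hψ.differentiable x)
    simpa using! this
  cases D with
  | whole => simpa [meas, carrier] using hcs hψ.2
  | dirichlet U _ _ _ =>
    rw [← hcs hψ.2.1]
    refine setIntegral_eq_integral_of_forall_compl_eq_zero fun x hx => ?_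
    have : x ∉ tsupport (fderiv ℝ ψ) := fun h => hx (hψ.2.2 (tsupport_fderiv_subset ℝ h))
    simp [_root_.partialDeriv, image_eq_zero_of_notMem_tsupport this]
  | periodic a b h =>
    obtain ⟨n, rfl⟩ : ∃ n, d = n + 1 := ⟨d - 1, by have := j.pos; omega⟩
    change ∫ x in {x : Space (n + 1) | ∀ i, a i < x i ∧ x i < b i}, _ = 0
    rw [integral_openBox]
    have hd (y : Fin (n + 1) → ℝ) : HasFDerivAt (fun y => ψ (WithLp.toLp 2 y))
        ((fderiv ℝ ψ (WithLp.toLp 2 y)).comp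
          ((PiLp.continuousLinearEquiv 2 ℝ fun _ : Fin (n + 1) => ℝ).symm :
            (Fin (n + 1) → ℝ) →L[ℝ] Space (n + 1))) y :=
      HasFDerivAt.comp y (hψ.differentiable _).hasFDerivAt
        ((PiLp.continuousLinearEquiv 2 ℝ fun _ : Fin (n + 1) => ℝ).symm.hasFDerivAt)
    have hcont : Continuous fun y : Fin (n + 1) → ℝ => ψ (WithLp.toLp 2 y) :=
      hψ.continuous.comp (PiLp.continuous_toLp 2 _)
    have hpc : Continuous fun y : Fin (n + 1) → ℝ => _root_.partialDeriv j ψ (WithLp.toLp 2 y) :=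
      (contDiff_partialDeriv hψ.contDiff j).continuous.comp (PiLp.continuous_toLp 2 _)
    set f' : Fin (n + 1) → (Fin (n + 1) → ℝ) → (Fin (n + 1) → ℝ) →L[ℝ] ℂ := fun i y =>
      if i = j then ((fderiv ℝ ψ (WithLp.toLp 2 y)).comp
          ((PiLp.continuousLinearEquiv 2 ℝ fun _ : Fin (n + 1) => ℝ).symm :
            (Fin (n + 1) → ℝ) →L[ℝ] Space (n + 1))) else 0 with hf'
    have hsum (y : Fin (n + 1) → ℝ) : ∑ i, f' i y (Pi.single i 1)
        = _root_.partialDeriv j ψ (WithLp.toLp 2 y) := by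
      rw [Finset.sum_eq_single j (fun i _ hi => by simp [hf', hi]) (by simp)]
      simp only [hf', if_true]
      rfl
    -- The vector field has `ψ` as its `j`-th component and zero elsewhere, so its divergence is
    -- `∂_j ψ` and only the two faces orthogonal to `e_j` contribute.
    have key := integral_divergence_of_hasFDerivAt_off_countable' a b (fun i => (h i).le)
      (fun i y => if i = j then ψ (WithLp.toLp 2 y) else 0) f' ∅ countable_empty
      (fun i => by
        split_ifs
        · exact hcont.continuousOn
        · exact continuousOn_const)
      (fun y _ i => by
        simp only [hf']
        split_ifs
        · exact hd y
        · exact hasFDerivAt_const _ _)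
      (by simp_rw [hsum]; exact hpc.continuousOn.integrableOn_compact isCompact_Icc)
    simp_rw [hsum] at key
    rw [key]
    refine Finset.sum_eq_zero fun i _ => ?_
    rw [sub_eq_zero]
    refine integral_congr_ae (Filter.Eventually.of_forall fun y => ?_)
    by_cases hi : i = j
    · simp only [hi, if_true]
      rw [← hψ.2 j (WithLp.toLp 2 (j.insertNth (a j) y))]
      congr 1
      ext k
      refine Fin.succAboveCases j ?_ (fun k => ?_) k
      · simp
      · simp
    · simp [hi]

lemma integral_mul_partialDeriv (hψ : D.IsTest ψ) (hχ : D.IsTest χ) (j : Fin d) :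
    ∫ x, ψ x * _root_.partialDeriv j χ x ∂D.meas = -∫ x, _root_.partialDeriv j ψ x * χ x ∂D.meas := by
  have h := (hψ.mul hχ).integral_partialDeriv j
  simp_rw [partialDeriv_mul hψ.differentiable hχ.differentiable] at h
  rw [integral_add ((hψ.partialDeriv j).mul hχ).integrable (hψ.mul (hχ.partialDeriv j)).integrable]
    at h
  exact (neg_eq_of_add_eq_zero_right h).symm

lemma laplacian (hψ : D.IsTest ψ) : D.IsTest (Δ ψ) := by
  have : Δ ψ = fun x => ∑ j, _root_.partialDeriv j (_root_.partialDeriv j ψ) x :=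
    funext fun x => laplacian_eq_sum_partialDeriv hψ.contDiff x
  rw [this]
  have key : ∀ s : Finset (Fin d), D.IsTest fun x =>
      ∑ j ∈ s, _root_.partialDeriv j (_root_.partialDeriv j ψ) x := fun s => by
    classical
    induction s using Finset.induction_on with
    | empty => simpa using zero D
    | insert i s hi ih =>
      simp_rw [Finset.sum_insert hi]
      exact ((hψ.partialDeriv i).partialDeriv i).add ih
  exact key _

end IsTest

end Setting

end

noncomputable section

/-! ### Density of test functions -/

section Periodize

open Filter Topology

variable {d : ℕ} {a b : Fin d → ℝ}

/-- The representative of a point in the half-open box modulo the periods. -/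
def wrapBox (h : ∀ i, a i < b i) (x : Space d) : Space d :=
  WithLp.toLp 2 fun i => toIcoMod (sub_pos.2 (h i)) (a i) (x i)

lemma wrapBox_add_single (h : ∀ i, a i < b i) (i : Fin d) (x : Space d) :
    wrapBox h (x + EuclideanSpace.single i (b i - a i)) = wrapBox h x := by
  ext j
  rcases eq_or_ne j i with rfl | hj
  · simp [wrapBox]
  · simp [wrapBox, hj]

lemma wrapBox_of_mem (h : ∀ i, a i < b i) {x : Space d} (hx : ∀ i, a i < x i ∧ x i < b i) :
    wrapBox h x = x := by
  ext i
  exact (toIcoMod_eq_self _).2 ⟨(hx i).1.le, by linarith [(hx i).2]⟩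

lemma toIcoMod_eq_sub_of_mem {p : ℝ} (hp : 0 < p) (c : ℝ) {t : ℝ} {n : ℤ}
    (h : t - n * p ∈ Ico c (c + p)) : toIcoMod hp c t = t - n * p :=
  (toIcoMod_eq_iff hp).2 ⟨h, n, by simp⟩

/-- Near a point whose representative is interior, `wrapBox` is a translation. Near any other point
the composition vanishes, because the support of `χ` stays away from the faces. -/
lemma contDiff_comp_wrapBox (h : ∀ i, a i < b i) {χ : Space d → ℂ} (hχ : ContDiff ℝ ∞ χ)
    (hc : HasCompactSupport χ) (hs : tsupport χ ⊆ {x | ∀ i, a i < x i ∧ x i < b i}) :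
    ContDiff ℝ ∞ (χ ∘ wrapBox h) := by
  rw [contDiff_iff_contDiffAt]
  intro x
  have hmem (i : Fin d) := toIcoMod_mem_Ico (sub_pos.2 (h i)) (a i) (x i)
  have hdiv (i : Fin d) : toIcoMod (sub_pos.2 (h i)) (a i) (x i)
      = x i - toIcoDiv (sub_pos.2 (h i)) (a i) (x i) * (b i - a i) := by
    rw [toIcoMod, zsmul_eq_mul]
  set n : Fin d → ℤ := fun i => toIcoDiv (sub_pos.2 (h i)) (a i) (x i) with hn
  have hcoord (i : Fin d) : Continuous fun y : Space d => y i := by fun_prop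
  by_cases hA : ∀ i, a i < toIcoMod (sub_pos.2 (h i)) (a i) (x i)
  · set c : Space d := WithLp.toLp 2 fun i => (n i : ℝ) * (b i - a i) with hcdef
    have heq : (χ ∘ wrapBox h) =ᶠ[𝓝 x] fun y => χ (y - c) := by
      have hev : ∀ i, ∀ᶠ y : Space d in 𝓝 x,
          y i - n i * (b i - a i) ∈ Ioo (a i) (a i + (b i - a i)) := fun i => by
        have hct : ContinuousAt (fun y : Space d => y i - n i * (b i - a i)) x :=
          ((hcoord i).sub continuous_const).continuousAt
        refine hct.eventually_mem (isOpen_Ioo.mem_nhds ?_)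
        rw [← hdiv i]
        exact ⟨hA i, (hmem i).2⟩
      filter_upwards [eventually_all.2 hev] with y hy
      have : wrapBox h y = y - c := by
        ext i
        exact toIcoMod_eq_sub_of_mem (sub_pos.2 (h i)) (a i) (Ioo_subset_Ico_self (hy i))
      rw [Function.comp_apply, this]
    exact (hχ.comp (contDiff_id.sub contDiff_const)).contDiffAt.congr_of_eventuallyEq heq
  · push Not at hA
    obtain ⟨i, hi⟩ := hA
    have hi' : x i - n i * (b i - a i) = a i := by
      rw [← hdiv i]; exact le_antisymm hi (hmem i).1
    set S : Set ℝ := (fun y : Space d => y i) '' tsupport χ with hS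
    have hSc : IsClosed S := (hc.isCompact.image (hcoord i)).isClosed
    have haS : a i ∉ S := by
      rintro ⟨y, hy, hya⟩; exact (hs hy i).1.ne' hya
    have hbS : b i ∉ S := by
      rintro ⟨y, hy, hyb⟩; exact (hs hy i).2.ne hyb
    have hev1 : ∀ᶠ y : Space d in 𝓝 x, y i - n i * (b i - a i) ∉ S := by
      have hct : ContinuousAt (fun y : Space d => y i - n i * (b i - a i)) x :=
        ((hcoord i).sub continuous_const).continuousAt
      exact hct.eventually_mem (hSc.isOpen_compl.mem_nhds (by simpa [hi'] using haS))
    -- Across the face the representative jumps from near `a i` to near `b i`; the shift by `n i -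
    -- 1` describes this second side.
    have hev2 : ∀ᶠ y : Space d in 𝓝 x, y i - (n i - 1 : ℤ) * (b i - a i) ∉ S := by
      have hct : ContinuousAt (fun y : Space d => y i - (n i - 1 : ℤ) * (b i - a i)) x :=
        ((hcoord i).sub continuous_const).continuousAt
      refine hct.eventually_mem (hSc.isOpen_compl.mem_nhds ?_)
      have : x i - (n i - 1 : ℤ) * (b i - a i) = b i := by push_cast; linarith
      rwa [this]
    have hev3 : ∀ᶠ y : Space d in 𝓝 x,
        y i - n i * (b i - a i) ∈ Ioo (a i - (b i - a i)) (a i + (b i - a i)) := by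
      have hct : ContinuousAt (fun y : Space d => y i - n i * (b i - a i)) x :=
        ((hcoord i).sub continuous_const).continuousAt
      refine hct.eventually_mem (isOpen_Ioo.mem_nhds ?_)
      rw [hi']
      have := h i
      constructor <;> linarith
    have heq : (χ ∘ wrapBox h) =ᶠ[𝓝 x] fun _ => 0 := by
      filter_upwards [hev1, hev2, hev3] with y h1 h2 h3
      have hnot : toIcoMod (sub_pos.2 (h i)) (a i) (y i) ∉ S := by
        by_cases hy : a i ≤ y i - n i * (b i - a i)
        · rwa [toIcoMod_eq_sub_of_mem (n := n i) _ _ ⟨hy, h3.2⟩]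
        · rwa [toIcoMod_eq_sub_of_mem (n := n i - 1)]
          push_cast
          constructor <;> linarith [h3.1]
      rw [Function.comp_apply]
      refine image_eq_zero_of_notMem_tsupport fun hmem => hnot ⟨_, hmem, rfl⟩
    exact contDiffAt_const.congr_of_eventuallyEq heq

end Periodize

namespace Setting

variable {d : ℕ} {D : Setting d}

/-- This lets ordinary bump functions inside `Ω` serve as test functions in every setting; in the
periodic one they are extended periodically. -/
lemma exists_isTest_eqOn {χ : Space d → ℂ} (hχ : ContDiff ℝ ∞ χ) (hc : HasCompactSupport χ)
    (hs : tsupport χ ⊆ D.carrier) : ∃ ψ, D.IsTest ψ ∧ EqOn ψ χ D.carrier := by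
  cases D with
  | whole => exact ⟨χ, ⟨hχ, hc⟩, fun _ _ => rfl⟩
  | dirichlet U _ _ _ => exact ⟨χ, ⟨hχ, hc, hs⟩, fun _ _ => rfl⟩
  | periodic a b h =>
    refine ⟨χ ∘ wrapBox h, ⟨contDiff_comp_wrapBox h hχ hc hs, fun i x => ?_⟩, fun x hx => ?_⟩
    · exact congrArg χ (wrapBox_add_single h i x)
    · exact congrArg χ (wrapBox_of_mem h hx)

lemma eq_zero_of_integral_isTest (g : D.L2) (h : ∀ ψ, D.IsTest ψ → ∫ x, g x * ψ x ∂D.meas = 0) :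
    g = 0 := by
  have hloc : LocallyIntegrable g D.meas := (Lp.memLp g).locallyIntegrable (by norm_num)
  have := D.isOpen_carrier.ae_eq_zero_of_integral_contDiff_smul_eq_zero (μ := D.meas) (f := g)
    (hloc.locallyIntegrableOn _) fun χ hχ hc hs => by
      obtain ⟨ψ, hψ, heq⟩ := exists_isTest_eqOn (D := D) (χ := fun x => (χ x : ℂ))
        (Complex.ofRealCLM.contDiff.comp hχ) (hc.comp_left (g := fun r : ℝ => (r : ℂ)) (by simp))
        ((tsupport_comp_subset (g := fun r : ℝ => (r : ℂ)) (by simp) χ).trans hs)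
      rw [← h ψ hψ]
      refine setIntegral_congr_fun D.measurableSet_carrier fun x hx => ?_
      rw [heq hx, mul_comm]
      exact Complex.real_smul
  rw [Lp.eq_zero_iff_ae_eq_zero]
  filter_upwards [this, ae_restrict_mem D.measurableSet_carrier] with x h1 h2
  exact h1 h2

/-! ### The graph of the gradient -/

/-- The class of a test function in `L²`. -/
def testL2 {ψ : Space d → ℂ} (hψ : D.IsTest ψ) : D.L2 := (hψ.memLp 2).toLp ψ

lemma coeFn_testL2 {ψ : Space d → ℂ} (hψ : D.IsTest ψ) : testL2 hψ =ᵐ[D.meas] ψ :=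
  MemLp.coeFn_toLp _

lemma inner_testL2_conj {ψ : Space d → ℂ} (hψ : D.IsTest ψ) (u : D.L2) :
    inner ℂ (testL2 hψ.conj) u = ∫ x, u x * ψ x ∂D.meas := by
  rw [L2.inner_def]
  refine integral_congr_ae ?_
  filter_upwards [coeFn_testL2 hψ.conj] with x hx
  simp [hx]

lemma inner_testL2 {ψ : Space d → ℂ} (hψ : D.IsTest ψ) (u : D.L2) :
    inner ℂ (testL2 hψ) u = ∫ x, u x * starRingEnd ℂ (ψ x) ∂D.meas := by
  rw [L2.inner_def]
  refine integral_congr_ae ?_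
  filter_upwards [coeFn_testL2 hψ] with x hx
  simp [hx]

lemma partialDeriv_conj {ψ : Space d → ℂ} (hψ : Differentiable ℝ ψ) (j : Fin d) :
    partialDeriv j (fun x => starRingEnd ℂ (ψ x))
      = fun x => starRingEnd ℂ (partialDeriv j ψ x) := by
  funext x
  have := (Complex.conjCLE : ℂ →L[ℝ] ℂ).hasFDerivAt.comp x (hψ x).hasFDerivAt
  exact DFunLike.congr_fun this.fderiv _

lemma hasWeakDeriv_iff {j : Fin d} {u g : D.L2} : D.HasWeakDeriv j u g ↔
    ∀ ψ (hψ : D.IsTest ψ), inner ℂ (testL2 (hψ.partialDeriv j)) u = -inner ℂ (testL2 hψ) g := by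
  constructor
  · intro h ψ hψ
    rw [inner_testL2, inner_testL2, ← h _ hψ.conj, partialDeriv_conj hψ.differentiable]
  · intro h ψ hψ
    have := h _ hψ.conj
    rw [inner_testL2, inner_testL2, partialDeriv_conj hψ.differentiable] at this
    simpa using this

lemma eq_zero_of_inner_testL2 (g : D.L2) (h : ∀ ψ (hψ : D.IsTest ψ), inner ℂ (testL2 hψ) g = 0) :
    g = 0 :=
  eq_zero_of_integral_isTest g fun ψ hψ => by rw [← inner_testL2_conj hψ]; exact h _ _

lemma HasWeakDeriv.unique {j : Fin d} {u g g' : D.L2} (h : D.HasWeakDeriv j u g)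
    (h' : D.HasWeakDeriv j u g') : g = g' := by
  rw [← sub_eq_zero]
  refine eq_zero_of_inner_testL2 _ fun ψ hψ => ?_
  have h1 := hasWeakDeriv_iff.1 h ψ hψ
  have h2 := hasWeakDeriv_iff.1 h' ψ hψ
  rw [inner_sub_right, sub_eq_zero]
  exact neg_injective (h1.symm.trans h2)

lemma hasWeakDeriv_testL2 {ψ : Space d → ℂ} (hψ : D.IsTest ψ) (j : Fin d) :
    D.HasWeakDeriv j (testL2 hψ) (testL2 (hψ.partialDeriv j)) := by
  intro χ hχ
  have e1 : ∫ x, testL2 hψ x * partialDeriv j χ x ∂D.meas = ∫ x, ψ x * partialDeriv j χ x ∂D.meas :=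
    integral_congr_ae (by filter_upwards [coeFn_testL2 hψ] with x hx; rw [hx])
  have e2 : ∫ x, testL2 (hψ.partialDeriv j) x * χ x ∂D.meas
      = ∫ x, partialDeriv j ψ x * χ x ∂D.meas :=
    integral_congr_ae (by filter_upwards [coeFn_testL2 (hψ.partialDeriv j)] with x hx; rw [hx])
  rw [e1, e2, hψ.integral_mul_partialDeriv hχ]

/-- The Hilbert space of pairs (function, gradient). -/
abbrev Pairs (D : Setting d) : Type := WithLp 2 (D.L2 × PiLp 2 fun _ : Fin d => D.L2)

/-- A test function with its gradient. -/
def testPair {ψ : Space d → ℂ} (hψ : D.IsTest ψ) : D.Pairs :=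
  WithLp.toLp 2 (testL2 hψ, WithLp.toLp 2 fun j => testL2 (hψ.partialDeriv j))

variable (D) in
/-- The test functions with their gradients. -/
def testGraph : Submodule ℂ D.Pairs where
  carrier := {p | ∃ (ψ : Space d → ℂ) (hψ : D.IsTest ψ), p = testPair hψ}
  zero_mem' := by
    refine ⟨_, IsTest.zero D, ?_⟩
    have h0 : testL2 (IsTest.zero D) = 0 := by
      rw [Lp.eq_zero_iff_ae_eq_zero]; exact coeFn_testL2 _
    have h1 (j : Fin d) : testL2 ((IsTest.zero D).partialDeriv j) = 0 := by
      rw [Lp.eq_zero_iff_ae_eq_zero]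
      filter_upwards [coeFn_testL2 ((IsTest.zero D).partialDeriv j)] with x hx
      rw [hx]; simp [partialDeriv]
    simp only [testPair, h0, h1]
    rfl
  add_mem' := by
    rintro _ _ ⟨ψ, hψ, rfl⟩ ⟨χ, hχ, rfl⟩
    refine ⟨_, hψ.add hχ, ?_⟩
    have h0 : testL2 (hψ.add hχ) = testL2 hψ + testL2 hχ := rfl
    have h1 (j : Fin d) : testL2 ((hψ.add hχ).partialDeriv j)
        = testL2 (hψ.partialDeriv j) + testL2 (hχ.partialDeriv j) := by
      refine Lp.ext ?_
      filter_upwards [coeFn_testL2 ((hψ.add hχ).partialDeriv j), coeFn_testL2 (hψ.partialDeriv j),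
        coeFn_testL2 (hχ.partialDeriv j),
        Lp.coeFn_add (testL2 (hψ.partialDeriv j)) (testL2 (hχ.partialDeriv j))] with x e1 e2 e3 e4
      rw [e1, e4, Pi.add_apply, e2, e3]
      unfold partialDeriv
      rw [fderiv_fun_add (hψ.differentiable x) (hχ.differentiable x)]
      rfl
    simp only [testPair, h0, h1]
    rfl
  smul_mem' := by
    rintro c _ ⟨ψ, hψ, rfl⟩
    refine ⟨_, hψ.const_mul c, ?_⟩
    have h0 : testL2 (hψ.const_mul c) = c • testL2 hψ := rfl
    have h1 (j : Fin d) : testL2 ((hψ.const_mul c).partialDeriv j)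
        = c • testL2 (hψ.partialDeriv j) := by
      refine Lp.ext ?_
      filter_upwards [coeFn_testL2 ((hψ.const_mul c).partialDeriv j),
        coeFn_testL2 (hψ.partialDeriv j),
        Lp.coeFn_smul c (testL2 (hψ.partialDeriv j))] with x e1 e2 e3
      rw [e1, e3, Pi.smul_apply, e2]
      unfold partialDeriv
      rw [fderiv_const_mul (hψ.differentiable x)]
      rfl
    simp only [testPair, h0, h1]
    rfl

variable (D) in
/-- The graph of the gradient on the energy space. -/
def gradGraph : Submodule ℂ D.Pairs := D.testGraph.topologicalClosure

lemma isClosed_gradGraph : IsClosed (D.gradGraph : Set D.Pairs) :=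
  D.testGraph.isClosed_topologicalClosure

instance : CompleteSpace D.gradGraph := isClosed_gradGraph.completeSpace_coe

lemma testPair_mem {ψ : Space d → ℂ} (hψ : D.IsTest ψ) : testPair hψ ∈ D.gradGraph :=
  D.testGraph.le_topologicalClosure ⟨ψ, hψ, rfl⟩

/-- The energy space is a closure, so a closed condition on pairs need only be checked on test
functions, for which classical calculus is available. -/
lemma gradGraph_induction {P : D.Pairs → Prop} (hc : IsClosed {p | P p})
    (h : ∀ ψ (hψ : D.IsTest ψ), P (testPair hψ)) {p : D.Pairs} (hp : p ∈ D.gradGraph) : P p := by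
  refine (hc.closure_subset_iff (s := (D.testGraph : Set D.Pairs))).2 ?_ hp
  rintro _ ⟨ψ, hψ, rfl⟩
  exact h ψ hψ

lemma exists_testPair_tendsto {p : D.Pairs} (hp : p ∈ D.gradGraph) :
    ∃ (ψ : ℕ → Space d → ℂ) (hψ : ∀ n, D.IsTest (ψ n)),
      Filter.Tendsto (fun n => testPair (hψ n)) Filter.atTop (nhds p) := by
  obtain ⟨v, hv, hlim⟩ := mem_closure_iff_seq_limit.1 hp
  choose ψ hψ hv using hv
  exact ⟨ψ, hψ, by rwa [funext hv] at hlim⟩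

lemma hasWeakDeriv_of_mem_gradGraph {p : D.Pairs} (hp : p ∈ D.gradGraph) (j : Fin d) :
    D.HasWeakDeriv j p.fst (p.snd j) := by
  rw [hasWeakDeriv_iff]
  intro χ hχ
  refine gradGraph_induction (P := fun p : D.Pairs => inner ℂ (testL2 (hχ.partialDeriv j)) p.fst
    = -inner ℂ (testL2 hχ) (p.snd j)) (isClosed_eq (by fun_prop) (by fun_prop)) ?_ hp
  intro ψ hψ
  exact hasWeakDeriv_iff.1 (hasWeakDeriv_testL2 hψ j) χ hχ

lemma norm_sub_testL2_eq {ψ : Space d → ℂ} (hψ : D.IsTest ψ) (u : D.L2) :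
    ENNReal.ofReal ‖u - testL2 hψ‖ = eLpNorm (fun x => u x - ψ x) 2 D.meas := by
  rw [Lp.norm_def, ENNReal.ofReal_toReal (Lp.eLpNorm_ne_top _)]
  refine eLpNorm_congr_ae ?_
  filter_upwards [Lp.coeFn_sub u (testL2 hψ), coeFn_testL2 hψ] with x h1 h2
  rw [h1, Pi.sub_apply, h2]

lemma norm_pairs_le (p : D.Pairs) : ‖p‖ ≤ ‖p.fst‖ + ∑ j, ‖p.snd j‖ := by
  have h1 : ‖p.snd‖ ≤ ∑ j, ‖p.snd j‖ := by
    have : p.snd = ∑ j, WithLp.toLp 2 (Pi.single j (p.snd j)) := by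
      ext1 i
      simp [Finset.sum_apply, Pi.single_apply]
    conv_lhs => rw [this]
    refine (norm_sum_le _ _).trans (Finset.sum_le_sum fun j _ => ?_)
    exact (PiLp.norm_single 2 (fun _ : Fin d => D.L2) j (p.snd j)).le
  have h2 : ‖p‖ ^ 2 ≤ (‖p.fst‖ + ‖p.snd‖) ^ 2 := by
    rw [WithLp.prod_norm_sq_eq_of_L2]
    nlinarith [norm_nonneg p.fst, norm_nonneg p.snd]
  have h3 := (sq_le_sq₀ (norm_nonneg _) (by positivity)).1 h2
  linarith

lemma memEnergy_iff {u : D.L2} : D.MemEnergy u ↔ ∃ g, WithLp.toLp 2 (u, g) ∈ D.gradGraph := by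
  constructor
  · rintro ⟨g, -, h⟩
    refine ⟨WithLp.toLp 2 g, ?_⟩
    refine Metric.mem_closure_iff.2 fun ε hε => ?_
    -- The tolerance is shared among the function and its `d` derivatives.
    obtain ⟨ψ, hψ, h1, h2⟩ := h (ε / (d + 1)) (by positivity)
    refine ⟨testPair hψ, ⟨ψ, hψ, rfl⟩, ?_⟩
    rw [← norm_sub_testL2_eq hψ, ENNReal.ofReal_lt_ofReal_iff (by positivity)] at h1
    have h2' (j : Fin d) : ‖g j - testL2 (hψ.partialDeriv j)‖ < ε / (d + 1) := by
      have := h2 j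
      rwa [← norm_sub_testL2_eq (hψ.partialDeriv j), ENNReal.ofReal_lt_ofReal_iff (by positivity)]
        at this
    rw [dist_eq_norm]
    refine (norm_pairs_le _).trans_lt ?_
    change ‖u - testL2 hψ‖ + ∑ j, ‖g j - testL2 (hψ.partialDeriv j)‖ < ε
    calc _ < ε / (d + 1) + ∑ j : Fin d, ε / (d + 1) :=
          add_lt_add_of_lt_of_le h1 (Finset.sum_le_sum fun j _ => (h2' j).le)
      _ = ε := by simp; field_simp; ring
  · rintro ⟨g, hg⟩
    refine ⟨fun j => g j, fun j => hasWeakDeriv_of_mem_gradGraph hg j, fun δ hδ => ?_⟩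
    obtain ⟨_, ⟨ψ, hψ, rfl⟩, h⟩ := Metric.mem_closure_iff.1 hg δ hδ
    rw [dist_eq_norm] at h
    refine ⟨ψ, hψ, ?_, fun j => ?_⟩
    · rw [← norm_sub_testL2_eq hψ, ENNReal.ofReal_lt_ofReal_iff hδ]
      exact (WithLp.norm_fst_le _ (WithLp.toLp 2 (u, g) - testPair hψ)).trans_lt h
    · rw [← norm_sub_testL2_eq (hψ.partialDeriv j), ENNReal.ofReal_lt_ofReal_iff hδ]
      have h1 := WithLp.norm_snd_le _ (WithLp.toLp 2 (u, g) - testPair hψ)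
      exact ((PiLp.norm_apply_le (WithLp.toLp 2 (u, g) - testPair hψ).snd j).trans h1).trans_lt h

/-- Apply the definition of the weak derivative of `p.fst` with the test function `∂_j ψ`, and sum
over `j`. -/
lemma inner_testL2_laplacian {ψ : Space d → ℂ} (hψ : D.IsTest ψ) {p : D.Pairs}
    (hp : p ∈ D.gradGraph) :
    inner ℂ (testL2 hψ.laplacian) p.fst = -inner ℂ (testPair hψ).snd p.snd := by
  have h1 : testL2 hψ.laplacian = ∑ j, testL2 ((hψ.partialDeriv j).partialDeriv j) := by
    refine Lp.ext ?_
    have h2 := fun j => coeFn_testL2 ((hψ.partialDeriv j).partialDeriv j)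
    filter_upwards [coeFn_testL2 hψ.laplacian, Lp.coeFn_finsetSum (Finset.univ : Finset (Fin d))
      (fun j => testL2 ((hψ.partialDeriv j).partialDeriv j)), ae_all_iff.2 h2] with x e1 e2 e3
    rw [e1, e2, laplacian_eq_sum_partialDeriv hψ.contDiff, Finset.sum_apply]
    exact Finset.sum_congr rfl fun j _ => (e3 j).symm
  rw [h1, sum_inner, PiLp.inner_apply, ← Finset.sum_neg_distrib]
  exact Finset.sum_congr rfl fun j _ =>
    hasWeakDeriv_iff.1 (hasWeakDeriv_of_mem_gradGraph hp j) _ (hψ.partialDeriv j)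

lemma laplacian_conj (ψ : Space d → ℂ) :
    Δ (fun x => starRingEnd ℂ (ψ x)) = fun x => starRingEnd ℂ ((Δ ψ) x) := by
  funext x
  exact InnerProductSpace.laplacian_CLE_comp_left (l := Complex.conjCLE) (f := ψ) |> (congrFun · x)

/-- The distributional identity is the weak form `-⟨∇w, ∇ψ⟩ = ⟨f, ψ⟩` for test functions; density of
the test pairs in the graph extends it to the whole energy space. -/
lemma isLaplacian_iff {w f : D.L2} : D.IsLaplacian w f ↔ GraphLaplacian D.gradGraph w f := by
  have hconj : (∀ ψ, D.IsTest ψ → ∫ x, w x * (Δ ψ) x ∂D.meas = ∫ x, f x * ψ x ∂D.meas) ↔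
      ∀ (ψ) (hψ : D.IsTest ψ), inner ℂ (testL2 hψ.laplacian) w = inner ℂ (testL2 hψ) f := by
    constructor
    · intro h ψ hψ
      rw [inner_testL2, inner_testL2, ← h _ hψ.conj, laplacian_conj]
    · intro h ψ hψ
      have := h _ hψ.conj
      rw [inner_testL2, inner_testL2, laplacian_conj] at this
      simpa using this
  rw [IsLaplacian, memEnergy_iff, hconj]
  constructor
  · rintro ⟨⟨g, hg⟩, h⟩
    refine ⟨g, hg, fun p hp => ?_⟩
    refine gradGraph_induction (P := fun p : D.Pairs => inner ℂ g p.snd = -inner ℂ f p.fst)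
      (isClosed_eq (by fun_prop) (by fun_prop)) (fun ψ hψ => ?_) hp
    have h1 : inner ℂ (testL2 hψ.laplacian) w = -inner ℂ (WithLp.snd (testPair hψ)) g :=
      inner_testL2_laplacian hψ hg
    rw [h ψ hψ] at h1
    rw [← inner_conj_symm, ← inner_conj_symm f, ← map_neg, ← neg_eq_iff_eq_neg.2 h1]
    rfl
  · rintro ⟨g, hg, h⟩
    refine ⟨⟨g, hg⟩, fun ψ hψ => ?_⟩
    have h1 : inner ℂ (testL2 hψ.laplacian) w = -inner ℂ (WithLp.snd (testPair hψ)) g :=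
      inner_testL2_laplacian hψ hg
    rw [h1, ← inner_conj_symm, h _ (testPair_mem hψ), map_neg, inner_conj_symm, neg_neg]
    rfl

lemma isResolvent_gradGraph : IsResolvent (graphResolvent D.gradGraph) :=
  isResolvent_graphResolvent _ fun f hf => eq_zero_of_inner_testL2 f fun ψ hψ => by
    have := hf _ (testPair_mem hψ)
    rw [← inner_conj_symm, map_eq_zero]
    exact this

/-- The evolution operator of the free equation is the unitary group of the Laplacian. -/
lemma flowA_eq (t : ℝ) (v₀ : D.L2) : D.flowA t v₀ = graphGroup D.gradGraph t v₀ := by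
  have hR := isResolvent_gradGraph (D := D)
  have hex : ∃ v, D.IsFreeSolution v₀ v :=
    ⟨fun t => graphGroup D.gradGraph t v₀, hR.continuous_unitaryGroup v₀, hR.unitaryGroup_zero v₀,
      fun w f h t => hasDerivAt_inner_graphGroup hR (isLaplacian_iff.1 h) v₀ t⟩
  rw [flowA, dif_pos hex]
  -- Uniqueness of weak free solutions forces the chosen solution to agree with the group.
  obtain ⟨hc, h0, hd⟩ := hex.choose_spec
  rw [eq_graphGroup_of_weak hR hc (fun w f h t => hd w f (isLaplacian_iff.2 h) t) t, h0]

end Setting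

end

noncomputable section

/-! ### Boundedness of the domain of the Laplacian -/

section Truncation

/-- `β` is a smooth truncation: nondecreasing, nonexpansive, vanishing at `0`. -/
structure IsTruncation (β : ℝ → ℝ) : Prop where
  contDiff : ContDiff ℝ ∞ β
  monotone : Monotone β
  lipschitz : LipschitzWith 1 β
  zero : β 0 = 0

/-- The action of a truncation on the real part. -/
def reTrunc (β : ℝ → ℝ) (z : ℂ) : ℂ := (β z.re : ℂ)

namespace IsTruncation

variable {β : ℝ → ℝ}

lemma contDiff_reTrunc (h : IsTruncation β) : ContDiff ℝ ∞ (reTrunc β) :=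
  Complex.ofRealCLM.contDiff.comp (h.contDiff.comp Complex.reCLM.contDiff)

lemma reTrunc_zero (h : IsTruncation β) : reTrunc β 0 = 0 := by
  simp [reTrunc, h.zero]

lemma lipschitz_reTrunc (h : IsTruncation β) : LipschitzWith 1 (reTrunc β) := by
  refine LipschitzWith.of_dist_le_mul fun z w => ?_
  rw [NNReal.coe_one, one_mul, dist_eq_norm, reTrunc, reTrunc, ← Complex.ofReal_sub,
    Complex.norm_real, dist_eq_norm]
  have h1 := h.lipschitz.dist_le_mul z.re w.re
  rw [NNReal.coe_one, one_mul, dist_eq_norm, dist_eq_norm] at h1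
  refine h1.trans ?_
  rw [← Complex.sub_re]
  exact Complex.abs_re_le_norm _

/-- By monotonicity and nonexpansiveness, `β x` lies between `0` and `x`. -/
lemma sq_le (h : IsTruncation β) (x : ℝ) : β x ^ 2 ≤ x * β x := by
  have h1 := h.lipschitz.dist_le_mul x 0
  rw [NNReal.coe_one, one_mul, Real.dist_eq, Real.dist_eq, h.zero, sub_zero, sub_zero] at h1
  rcases le_total 0 x with hx | hx
  · have h2 := h.monotone hx
    rw [h.zero] at h2
    rw [abs_of_nonneg hx, abs_of_nonneg h2] at h1
    nlinarith
  · have h2 := h.monotone hx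
    rw [h.zero] at h2
    rw [abs_of_nonpos hx, abs_of_nonpos h2] at h1
    nlinarith

lemma norm_reTrunc_sq_le (h : IsTruncation β) (z : ℂ) :
    ‖reTrunc β z‖ ^ 2 ≤ RCLike.re (inner ℂ z (reTrunc β z)) := by
  have := h.sq_le z.re
  simpa [reTrunc, mul_comm] using this

lemma partialDeriv_reTrunc (h : IsTruncation β) {d : ℕ} {ψ : Space d → ℂ}
    (hψ : Differentiable ℝ ψ) (j : Fin d) (x : Space d) :
    partialDeriv j (reTrunc β ∘ ψ) x = ((deriv β (ψ x).re * (partialDeriv j ψ x).re : ℝ) : ℂ) := by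
  have h1 : HasFDerivAt (fun y => (ψ y).re) (Complex.reCLM.comp (fderiv ℝ ψ x)) x :=
    Complex.reCLM.hasFDerivAt.comp x (hψ x).hasFDerivAt
  have h2 : HasDerivAt β (deriv β (ψ x).re) (ψ x).re :=
    (h.contDiff.differentiable (by simp) _).hasDerivAt
  have h3 := Complex.ofRealCLM.hasFDerivAt.comp x (h2.comp_hasFDerivAt x h1)
  have h4 : fderiv ℝ (reTrunc β ∘ ψ) x = _ := h3.fderiv
  rw [partialDeriv, h4]
  simp [partialDeriv]

/-- Since `0 ≤ β' ≤ 1`, one has `β'² ≤ β'`. -/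
lemma norm_partialDeriv_sq_le (h : IsTruncation β) {d : ℕ} {ψ : Space d → ℂ}
    (hψ : Differentiable ℝ ψ) (j : Fin d) (x : Space d) :
    ‖partialDeriv j (reTrunc β ∘ ψ) x‖ ^ 2
      ≤ RCLike.re (inner ℂ (partialDeriv j ψ x) (partialDeriv j (reTrunc β ∘ ψ) x)) := by
  rw [h.partialDeriv_reTrunc hψ]
  have h0 : 0 ≤ deriv β (ψ x).re := h.monotone.deriv_nonneg
  have h1 : deriv β (ψ x).re ≤ 1 := by
    have := norm_deriv_le_of_lipschitz (x₀ := (ψ x).re) h.lipschitz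
    exact (le_abs_self _).trans (by simpa using this)
  have : (deriv β (ψ x).re * (partialDeriv j ψ x).re) ^ 2
      ≤ deriv β (ψ x).re * (partialDeriv j ψ x).re * (partialDeriv j ψ x).re := by
    have h2 := mul_nonneg (mul_nonneg h0 (sub_nonneg.2 h1)) (sq_nonneg (partialDeriv j ψ x).re)
    nlinarith
  rw [Complex.norm_real, Real.norm_eq_abs, sq_abs]
  simpa [mul_comm, mul_assoc, mul_left_comm] using this

end IsTruncation

/-- There are truncations that are supported in `(k, ∞)` and constant on `(k + δ, ∞)`, with a jump
comparable to `δ`. -/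
lemma exists_isTruncation : ∃ c : ℝ, 0 < c ∧ ∀ k δ : ℝ, 0 < k → 0 < δ → ∃ β : ℝ → ℝ,
    IsTruncation β ∧ (∀ x ≤ k, β x = 0) ∧ (∀ x, k + δ ≤ x → β x = c * δ) ∧
      ∀ x, |β x| ≤ c * δ := by
  have hS : ContDiff ℝ ∞ Real.smoothTransition := Real.smoothTransition.contDiff
  obtain ⟨B, hB⟩ := isCompact_Icc (a := (0 : ℝ)) (b := 1) |>.exists_bound_of_continuousOn
    (hS.continuous_deriv (by simp)).continuousOn
  have hB' : ∀ x, ‖deriv Real.smoothTransition x‖ ≤ max B 1 := fun x => by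
    by_cases hx : x ∈ Icc (0 : ℝ) 1
    · exact (hB x hx).trans (le_max_left _ _)
    · have h0 : deriv Real.smoothTransition x = 0 := by
        rw [mem_Icc, not_and_or, not_le, not_le] at hx
        rcases hx with hx | hx
        · have : Real.smoothTransition =ᶠ[nhds x] fun _ => 0 := by
            filter_upwards [gt_mem_nhds hx] with y hy
            exact Real.smoothTransition.zero_of_nonpos hy.le
          rw [this.deriv_eq, deriv_const]
        · have : Real.smoothTransition =ᶠ[nhds x] fun _ => 1 := by
            filter_upwards [lt_mem_nhds hx] with y hy
            exact Real.smoothTransition.one_of_one_le hy.le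
          rw [this.deriv_eq, deriv_const]
      rw [h0, norm_zero]
      positivity
  have hBpos : 0 < max B 1 := by positivity
  have hlip : ∀ x y, |Real.smoothTransition x - Real.smoothTransition y| ≤ max B 1 * |x - y| :=
    fun x y => Convex.norm_image_sub_le_of_norm_deriv_le (s := univ)
      (fun z _ => hS.differentiable (by simp) z) (fun z _ => hB' z) convex_univ (mem_univ _)
      (mem_univ _)
  -- Here `c` is the reciprocal of a Lipschitz constant of the smooth step; stretching the step to
  -- width `δ` and height `cδ` keeps the slope at most `1`.
  refine ⟨(max B 1)⁻¹, by positivity, fun k δ hk hδ => ⟨fun x =>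
    (max B 1)⁻¹ * δ * Real.smoothTransition ((x - k) / δ), ⟨?_, ?_, ?_, ?_⟩, ?_, ?_, ?_⟩⟩
  · exact contDiff_const.mul (hS.comp (by fun_prop))
  · intro x y hxy
    have : Real.smoothTransition ((x - k) / δ) ≤ Real.smoothTransition ((y - k) / δ) :=
      Real.smoothTransition.monotone (by gcongr)
    dsimp only
    gcongr
  · refine LipschitzWith.of_dist_le_mul fun x y => ?_
    rw [NNReal.coe_one, one_mul, Real.dist_eq, Real.dist_eq, ← mul_sub, abs_mul,
      abs_of_pos (by positivity)]
    calc _ ≤ (max B 1)⁻¹ * δ * (max B 1 * |(x - k) / δ - (y - k) / δ|) := by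
          gcongr; exact hlip _ _
      _ = |x - y| := by
        rw [← sub_div, abs_div, abs_of_pos hδ, sub_sub_sub_cancel_right]
        field_simp
  · rw [Real.smoothTransition.zero_of_nonpos, mul_zero]
    exact div_nonpos_of_nonpos_of_nonneg (by linarith) hδ.le
  · intro x hx
    simp only
    rw [Real.smoothTransition.zero_of_nonpos, mul_zero]
    exact div_nonpos_of_nonpos_of_nonneg (by linarith) hδ.le
  · intro x hx
    simp only
    rw [Real.smoothTransition.one_of_one_le, mul_one]
    rw [le_div_iff₀ hδ]; linarith
  · intro x
    rw [abs_of_nonneg (mul_nonneg (by positivity) (Real.smoothTransition.nonneg _))]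
    exact mul_le_of_le_one_right (by positivity) (Real.smoothTransition.le_one _)

end Truncation

/-! ### Energy estimates for truncations and the level set iteration -/

namespace Setting

open Filter Topology

variable {d : ℕ} {D : Setting d}

lemma exists_subseq_ae_tendsto {v : ℕ → D.L2} {u : D.L2} (h : Tendsto v atTop (𝓝 u)) :
    ∃ ns : ℕ → ℕ, StrictMono ns ∧
      ∀ᵐ x ∂D.meas, Tendsto (fun n => v (ns n) x) atTop (𝓝 (u x)) :=
  (tendstoInMeasure_of_tendsto_Lp h).exists_seq_tendsto_ae

/-- Composition of an `L²` function with a Lipschitz map fixing `0`. -/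
def lipComp {F : ℂ → ℂ} {K : NNReal} (hF : LipschitzWith K F) (h0 : F 0 = 0) (u : D.L2) : D.L2 :=
  hF.compLp h0 u

lemma coeFn_lipComp {F : ℂ → ℂ} {K : NNReal} (hF : LipschitzWith K F) (h0 : F 0 = 0) (u : D.L2) :
    lipComp hF h0 u =ᵐ[D.meas] F ∘ u := hF.coeFn_compLp h0 u

lemma continuous_lipComp {F : ℂ → ℂ} {K : NNReal} (hF : LipschitzWith K F) (h0 : F 0 = 0) :
    Continuous (lipComp (D := D) hF h0) := hF.continuous_compLp h0

lemma testL2_comp {F : ℂ → ℂ} {K : NNReal} (hF : LipschitzWith K F) (h0 : F 0 = 0)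
    (hF' : ContDiff ℝ ∞ F) {ψ : Space d → ℂ} (hψ : D.IsTest ψ) :
    testL2 (hψ.comp hF' h0) = lipComp hF h0 (testL2 hψ) := by
  refine Lp.ext ?_
  filter_upwards [coeFn_testL2 (hψ.comp hF' h0), coeFn_lipComp hF h0 (testL2 hψ),
    coeFn_testL2 hψ] with x h1 h2 h3
  rw [h1, h2, Function.comp_apply, Function.comp_apply, h3]

lemma norm_sq_le_re_inner {u v : D.L2}
    (h : ∀ᵐ x ∂D.meas, ‖v x‖ ^ 2 ≤ RCLike.re (inner ℂ (u x) (v x))) :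
    ‖v‖ ^ 2 ≤ RCLike.re (inner ℂ u v) := by
  rw [← sub_nonneg, ← inner_self_eq_norm_sq (𝕜 := ℂ), ← map_sub, ← inner_sub_left, L2.inner_def,
    ← integral_re (L2.integrable_inner _ _)]
  refine integral_nonneg_of_ae ?_
  filter_upwards [h, Lp.coeFn_sub u v] with x h1 h2
  rw [h2, Pi.sub_apply, inner_sub_left, map_sub, inner_self_eq_norm_sq]
  exact sub_nonneg.2 h1

/-- The Sobolev inequality `H¹ ⊆ L⁶` for test functions. -/
def Sobolev6 (D : Setting d) (C : NNReal) : Prop :=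
  ∀ (ψ) (hψ : D.IsTest ψ), eLpNorm ψ 6 D.meas ≤ C * ENNReal.ofReal ‖testPair hψ‖

/-- The pointwise bounds for the function and its gradient are integrated. This is what remains of
testing the equation with the truncation of its own solution. -/
lemma norm_testPair_reTrunc_sq_le {β : ℝ → ℝ} (hβ : IsTruncation β) {ψ : Space d → ℂ}
    (hψ : D.IsTest ψ) : ‖testPair (hψ.comp hβ.contDiff_reTrunc hβ.reTrunc_zero)‖ ^ 2
      ≤ RCLike.re (inner ℂ (testPair hψ)
        (testPair (hψ.comp hβ.contDiff_reTrunc hβ.reTrunc_zero))) := by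
  set χ := hψ.comp hβ.contDiff_reTrunc hβ.reTrunc_zero
  have h0 : ‖testL2 χ‖ ^ 2 ≤ RCLike.re (inner ℂ (testL2 hψ) (testL2 χ)) := by
    refine norm_sq_le_re_inner ?_
    filter_upwards [coeFn_testL2 hψ, coeFn_testL2 χ] with x h1 h2
    rw [h1, h2]
    exact hβ.norm_reTrunc_sq_le _
  have h1 (j : Fin d) : ‖testL2 (χ.partialDeriv j)‖ ^ 2
      ≤ RCLike.re (inner ℂ (testL2 (hψ.partialDeriv j)) (testL2 (χ.partialDeriv j))) := by
    refine norm_sq_le_re_inner ?_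
    filter_upwards [coeFn_testL2 (hψ.partialDeriv j), coeFn_testL2 (χ.partialDeriv j)] with x h1 h2
    rw [h1, h2]
    exact hβ.norm_partialDeriv_sq_le hψ.differentiable j x
  rw [WithLp.prod_norm_sq_eq_of_L2, WithLp.prod_inner_apply, map_add]
  refine add_le_add h0 ?_
  rw [PiLp.norm_sq_eq_of_L2, PiLp.inner_apply, map_sum]
  exact Finset.sum_le_sum fun j _ => h1 j

/-- The energy estimate for truncations. -/
lemma eLpNorm_reTrunc_le {C : NNReal} (hC : D.Sobolev6 C) {w f : D.L2}
    (h : GraphLaplacian D.gradGraph w f) {β : ℝ → ℝ} (hβ : IsTruncation β) :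
    eLpNorm (reTrunc β ∘ w) 6 D.meas ≤ C * ENNReal.ofReal (Real.sqrt
      (‖w - f‖ * ‖lipComp hβ.lipschitz_reTrunc hβ.reTrunc_zero w‖)) := by
  obtain ⟨g, hg, hw⟩ := h
  obtain ⟨ψ, hψ, hlim⟩ := exists_testPair_tendsto hg
  set χ := fun n => (hψ n).comp hβ.contDiff_reTrunc hβ.reTrunc_zero with hχ
  set T := lipComp (D := D) hβ.lipschitz_reTrunc hβ.reTrunc_zero with hT
  have hTχ (n : ℕ) : testL2 (χ n) = T (testL2 (hψ n)) := testL2_comp _ _ hβ.contDiff_reTrunc _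
  set P := WithLp.toLp 2 (w, g) with hP
  have hlim1 : Tendsto (fun n => testL2 (hψ n)) atTop (𝓝 w) :=
    ((WithLp.fstL 2 ℂ D.L2 (PiLp 2 fun _ : Fin d => D.L2)).continuous.tendsto P).comp hlim
  have hlimT : Tendsto (fun n => T (testL2 (hψ n))) atTop (𝓝 (T w)) :=
    ((continuous_lipComp _ _).tendsto w).comp hlim1
  set b : ℕ → ℝ := fun n => ‖testPair (hψ n) - P‖ * ‖testPair (hψ n)‖
    + ‖w - f‖ * ‖T (testL2 (hψ n))‖ with hb
  have hblim : Tendsto b atTop (𝓝 (‖w - f‖ * ‖T w‖)) := by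
    have h1 := (tendsto_iff_norm_sub_tendsto_zero.1 hlim).mul hlim.norm
    have h2 := (tendsto_const_nhds (x := ‖w - f‖)).mul hlimT.norm
    simpa using h1.add h2
  have hsq (n : ℕ) : ‖testPair (χ n)‖ ≤ Real.sqrt (b n) := by
    refine Real.le_sqrt_of_sq_le ?_
    have h1 := norm_testPair_reTrunc_sq_le hβ (hψ n)
    have h2 : ‖testPair (χ n)‖ ≤ ‖testPair (hψ n)‖ := by
      have h3 : ‖testPair (χ n)‖ ^ 2 ≤ ‖testPair (hψ n)‖ * ‖testPair (χ n)‖ :=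
        h1.trans (re_inner_le_norm _ _)
      rcases (norm_nonneg (testPair (χ n))).eq_or_lt with h0 | h0
      · rw [← h0]; exact norm_nonneg _
      · exact le_of_mul_le_mul_right (by rwa [← sq]) h0
    -- This is the weak form of `(1 - Δ)w = w - f` tested with the truncated approximation, itself a
    -- test function.
    have h4 : inner ℂ P (testPair (χ n)) = inner ℂ (w - f) (T (testL2 (hψ n))) := by
      have h5 := hw _ (testPair_mem (χ n))
      rw [WithLp.prod_inner_apply, inner_sub_left, ← hTχ]
      change inner ℂ w (testL2 (χ n)) + inner ℂ g (testPair (χ n)).snd = _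
      rw [h5, sub_eq_add_neg]
      rfl
    have h6 : inner ℂ (testPair (hψ n)) (testPair (χ n))
        = inner ℂ (testPair (hψ n) - P) (testPair (χ n))
          + inner ℂ (w - f) (T (testL2 (hψ n))) := by
      rw [← h4, ← inner_add_left, sub_add_cancel]
    calc _ ≤ _ := h1
      _ ≤ ‖testPair (hψ n) - P‖ * ‖testPair (χ n)‖ + ‖w - f‖ * ‖T (testL2 (hψ n))‖ := by
        rw [h6, map_add]
        exact add_le_add (re_inner_le_norm _ _) (re_inner_le_norm _ _)
      _ ≤ b n := by simp only [hb]; gcongr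
  obtain ⟨ns, hns, hae⟩ := exists_subseq_ae_tendsto hlimT
  -- The truncated test functions are only known to converge in `L²`, so the `L⁶` bound passes to
  -- the limit by lower semicontinuity along an a.e. convergent subsequence.
  have hfatou := Lp.eLpNorm_lim_le_liminf_eLpNorm (p := 6) (μ := D.meas)
    (f := fun n => (T (testL2 (hψ (ns n))) : Space d → ℂ))
    (fun n => Lp.aestronglyMeasurable _) (T w) hae
  calc eLpNorm (reTrunc β ∘ w) 6 D.meas = eLpNorm (T w) 6 D.meas :=
        eLpNorm_congr_ae (coeFn_lipComp _ _ w).symm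
    _ ≤ _ := hfatou
    _ ≤ liminf (fun n => C * ENNReal.ofReal (Real.sqrt (b (ns n)))) atTop := by
      refine liminf_le_liminf (Eventually.of_forall fun n => ?_)
      rw [← hTχ, eLpNorm_congr_ae (coeFn_testL2 (χ (ns n)))]
      refine (hC _ (χ (ns n))).trans ?_
      gcongr
      exact hsq _
    _ = C * ENNReal.ofReal (Real.sqrt (‖w - f‖ * ‖T w‖)) := by
      refine Tendsto.liminf_eq (ENNReal.Tendsto.const_mul ?_ (Or.inr (by simp)))
      exact ENNReal.tendsto_ofReal ((Real.continuous_sqrt.tendsto _).comp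
        (hblim.comp hns.tendsto_atTop))

/-- One step of the level set iteration. -/
lemma measureReal_level_le {C : NNReal} (hC : D.Sobolev6 C) {c : ℝ} (hc : 0 < c)
    (hβ : ∀ k δ : ℝ, 0 < k → 0 < δ → ∃ β : ℝ → ℝ,
      IsTruncation β ∧ (∀ x ≤ k, β x = 0) ∧ (∀ x, k + δ ≤ x → β x = c * δ) ∧
      ∀ x, |β x| ≤ c * δ) {w f : D.L2} (h : GraphLaplacian D.gradGraph w f) {k δ : ℝ}
    (hk : 0 < k) (hδ : 0 < δ) (hfin : D.meas {x | k < (w x).re} ≠ ⊤) :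
    D.meas.real {x | k + δ < (w x).re}
      ≤ (C ^ 2 * ‖w - f‖ / c / δ) ^ 3 * Real.sqrt (D.meas.real {x | k < (w x).re}) ^ 3 := by
  obtain ⟨β, hβt, hβ0, hβ1, hβb⟩ := hβ k δ hk hδ
  have hcδ : 0 < c * δ := by positivity
  have hmeas : Measurable fun x => (w x).re :=
    Complex.measurable_re.comp (Lp.stronglyMeasurable w).measurable
  set T := lipComp hβt.lipschitz_reTrunc hβt.reTrunc_zero w with hT
  have hTn : ‖T‖ ≤ c * δ * Real.sqrt (D.meas.real {x | k < (w x).re}) := by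
    have h1 : eLpNorm (reTrunc β ∘ w) 2 D.meas
        ≤ eLpNorm ({x | k < (w x).re}.indicator fun _ => c * δ) 2 D.meas := by
      refine eLpNorm_mono fun x => ?_
      by_cases hx : k < (w x).re
      · rw [indicator_of_mem (show x ∈ {x | k < (w x).re} from hx), Function.comp_apply, reTrunc,
          Complex.norm_real, Real.norm_of_nonneg hcδ.le]
        exact hβb _
      · rw [Function.comp_apply, reTrunc, hβ0 _ (not_lt.1 hx)]
        simp
    rw [eLpNorm_indicator_const (measurableSet_lt measurable_const hmeas) (by simp) (by simp)] at h1
    rw [Lp.norm_def, eLpNorm_congr_ae (coeFn_lipComp _ _ w)]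
    refine ENNReal.toReal_le_of_le_ofReal (by positivity) (h1.trans (le_of_eq ?_))
    rw [ENNReal.ofReal_mul hcδ.le, Real.enorm_of_nonneg hcδ.le, Real.sqrt_eq_rpow,
      ← ENNReal.ofReal_rpow_of_nonneg measureReal_nonneg (by norm_num),
      ofReal_measureReal hfin]
    norm_num
  have h6 := eLpNorm_reTrunc_le hC h hβt
  -- Chebyshev in `L⁶` on the set where the truncation equals `cδ`. The `L²` norm of the truncation
  -- contributes the measure of the lower level set to the power `3/2 > 1`, and this superlinear
  -- gain drives the iteration.
  have hcheb := mul_meas_ge_le_pow_eLpNorm' D.meas (p := 6) (by simp) (by simp)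
    (hβt.contDiff_reTrunc.continuous.comp_aestronglyMeasurable (Lp.aestronglyMeasurable w))
    (ENNReal.ofReal (c * δ))
  have hsub : {x | k + δ < (w x).re} ⊆ {x | ENNReal.ofReal (c * δ) ≤ ‖reTrunc β (w x)‖ₑ} := by
    intro x hx
    have hx' : k + δ < (w x).re := hx
    simp only [mem_ofPred_eq]
    rw [reTrunc, hβ1 _ hx'.le, ← ofReal_norm, Complex.norm_real, Real.norm_of_nonneg hcδ.le]
  have h7 : ENNReal.ofReal (c * δ) ^ (6 : ℕ) * D.meas {x | k + δ < (w x).re}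
      ≤ ENNReal.ofReal (C * Real.sqrt (‖w - f‖ * ‖T‖)) ^ (6 : ℕ) := by
    have e : (6 : ℝ≥0∞).toReal = (6 : ℕ) := by simp
    rw [e, ENNReal.rpow_natCast, ENNReal.rpow_natCast] at hcheb
    refine (mul_le_mul_right (measure_mono hsub) _).trans (hcheb.trans ?_)
    gcongr
    rw [ENNReal.ofReal_mul C.coe_nonneg, ENNReal.ofReal_coe_nnreal]
    exact h6
  have h8 : (c * δ) ^ 6 * D.meas.real {x | k + δ < (w x).re}
      ≤ C ^ 6 * (‖w - f‖ * ‖T‖) ^ 3 := by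
    have := ENNReal.toReal_mono (by finiteness) h7
    rw [ENNReal.toReal_mul, ENNReal.toReal_pow, ENNReal.toReal_pow,
      ENNReal.toReal_ofReal hcδ.le, ENNReal.toReal_ofReal (by positivity), mul_pow (C : ℝ)] at this
    refine this.trans (le_of_eq ?_)
    congr 1
    rw [show 6 = 2 * 3 from rfl, pow_mul, Real.sq_sqrt (by positivity)]
  set s := Real.sqrt (D.meas.real {x | k < (w x).re})
  have h9 : (c * δ) ^ 6 * D.meas.real {x | k + δ < (w x).re}
      ≤ C ^ 6 * (‖w - f‖ * (c * δ * s)) ^ 3 := h8.trans (by gcongr)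
  rw [← mul_le_mul_iff_right₀ (show 0 < (c * δ) ^ 6 by positivity)]
  refine h9.trans (le_of_eq ?_)
  field_simp

/-- The domain of the Laplacian consists of bounded functions: one-sided bound. -/
lemma ae_re_le {C : NNReal} (hC : D.Sobolev6 C) : ∃ B : ℝ, 0 ≤ B ∧
    ∀ w f : D.L2, GraphLaplacian D.gradGraph w f →
      ∀ᵐ x ∂D.meas, (w x).re ≤ ‖w‖ + B * ‖w - f‖ + 2 := by
  obtain ⟨c, hc, hβ⟩ := exists_isTruncation
  refine ⟨8 * (C ^ 2 / c), by positivity, fun w f h => ?_⟩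
  set A := C ^ 2 * ‖w - f‖ / c with hA
  have hA0 : 0 ≤ A := by positivity
  -- Above this level Chebyshev in `L²` bounds the measure by `1`, which starts the iteration.
  set k₀ := ‖w‖ + 1 with hk0
  have hk0pos : 0 < k₀ := by positivity
  have hlev (k : ℝ) (hk : k₀ ≤ k) : D.meas {x | k < (w x).re} ≤ 1 := by
    have hcheb := mul_meas_ge_le_pow_eLpNorm' D.meas (p := 2) (by simp) (by simp)
      (Lp.aestronglyMeasurable w) (ENNReal.ofReal k₀)
    rw [← Lp.enorm_def, ← ofReal_norm] at hcheb
    have hsub : {x | k < (w x).re} ⊆ {x | ENNReal.ofReal k₀ ≤ ‖w x‖ₑ} := by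
      intro x hx
      have hx' : k < (w x).re := hx
      simp only [mem_ofPred_eq]
      rw [← ofReal_norm]
      exact ENNReal.ofReal_le_ofReal (hk.trans (hx'.le.trans (Complex.re_le_norm _)))
    have h1 : ENNReal.ofReal k₀ ^ (2 : ℝ≥0∞).toReal * D.meas {x | k < (w x).re}
        ≤ ENNReal.ofReal k₀ ^ (2 : ℝ≥0∞).toReal * 1 := by
      refine (mul_le_mul_right (measure_mono hsub) _).trans (hcheb.trans ?_)
      rw [mul_one]
      gcongr
      linarith
    refine (ENNReal.mul_le_mul_iff_right ?_ ?_).1 h1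
    · simpa using hk0pos
    · finiteness
  -- The total height of the levels `k n`, with increments `Δ' 2^{-(n+1)}`. It is chosen so that `A
  -- / Δ' ≤ 1/8`, which makes the bound `8^{-n}` reproduce itself: `(2^{n+1}/8)³ · 8^{-3n} =
  -- 8^{-2(n+1)}`.
  set Δ' := 8 * A + 1 with hΔ
  set k : ℕ → ℝ := fun n => k₀ + Δ' * (1 - (1 / 2) ^ n) with hkdef
  have hkge (n : ℕ) : k₀ ≤ k n := by
    have : (1 / 2 : ℝ) ^ n ≤ 1 := pow_le_one₀ (by norm_num) (by norm_num)
    have := mul_nonneg (by positivity : 0 ≤ Δ') (sub_nonneg.2 this)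
    simp only [hkdef]; linarith
  have hs (n : ℕ) : Real.sqrt (D.meas.real {x | k n < (w x).re}) ≤ (1 / 8) ^ n := by
    induction n with
    | zero =>
      refine Real.sqrt_le_iff.2 ⟨by positivity, ?_⟩
      rw [pow_zero, one_pow]
      exact ENNReal.toReal_mono (by simp) (hlev _ (hkge 0))
    | succ n ih =>
      have hstep := measureReal_level_le hC hc hβ h (k := k n) (δ := Δ' * (1 / 2) ^ (n + 1))
        (hk0pos.trans_le (hkge n)) (by positivity)
        (((hlev _ (hkge n)).trans_lt (by simp)).ne)
      have e : k n + Δ' * (1 / 2) ^ (n + 1) = k (n + 1) := by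
        simp only [hkdef]; rw [pow_succ]; ring
      rw [e, ← hA] at hstep
      refine Real.sqrt_le_iff.2 ⟨by positivity, hstep.trans ?_⟩
      have h1 : A / (Δ' * (1 / 2) ^ (n + 1)) ≤ 1 / 8 * 2 ^ (n + 1) := by
        rw [div_le_iff₀ (by positivity)]
        have : (1 / 8 * 2 ^ (n + 1) * (Δ' * (1 / 2) ^ (n + 1)) : ℝ) = 1 / 8 * Δ' := by
          rw [one_div_pow]; field_simp
        rw [this]; linarith
      calc _ ≤ (1 / 8 * 2 ^ (n + 1) : ℝ) ^ 3 * ((1 / 8) ^ n) ^ 3 := by gcongr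
        _ = ((1 / 8) ^ (n + 1)) ^ 2 := by
          have : ((2 : ℝ) ^ n) ^ 3 * (1 / 8) ^ n = 1 := by
            rw [← pow_mul, mul_comm n, pow_mul, ← mul_pow]; norm_num
          rw [pow_succ, pow_succ]
          linear_combination (1 / 64 * ((1 / 8 : ℝ) ^ n) ^ 2) * this
  have hzero : D.meas {x | k₀ + Δ' < (w x).re} = 0 := by
    have hle (n : ℕ) : D.meas {x | k₀ + Δ' < (w x).re} ≤ ENNReal.ofReal ((1 / 64) ^ n) := by
      have hsub : {x | k₀ + Δ' < (w x).re} ⊆ {x | k n < (w x).re} := fun x hx => by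
        have hx' : k₀ + Δ' < (w x).re := hx
        have : 0 ≤ Δ' * (1 / 2) ^ n := by positivity
        change k₀ + Δ' * (1 - (1 / 2) ^ n) < (w x).re
        linarith
      refine (measure_mono hsub).trans ?_
      rw [← ofReal_measureReal ((hlev _ (hkge n)).trans_lt (by simp)).ne]
      refine ENNReal.ofReal_le_ofReal ?_
      have := (Real.sqrt_le_left (by positivity)).1 (hs n)
      refine this.trans (le_of_eq ?_)
      rw [← pow_mul, mul_comm, pow_mul]; norm_num
    have hlim : Tendsto (fun n : ℕ => ENNReal.ofReal ((1 / 64) ^ n)) atTop (𝓝 0) := by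
      have := ENNReal.tendsto_ofReal
        (tendsto_pow_atTop_nhds_zero_of_lt_one (r := (1 / 64 : ℝ)) (by norm_num) (by norm_num))
      simpa using this
    exact le_antisymm (ge_of_tendsto' hlim hle) zero_le
  have hae : ∀ᵐ x ∂D.meas, ¬ (k₀ + Δ' < (w x).re) := by rw [ae_iff]; simpa using hzero
  filter_upwards [hae] with x hx
  refine (not_lt.1 hx).trans (le_of_eq ?_)
  simp only [hk0, hΔ, hA]; ring

lemma GraphLaplacian_smul {w f : D.L2} (h : GraphLaplacian D.gradGraph w f) (c : ℂ) :
    GraphLaplacian D.gradGraph (c • w) (c • f) := by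
  rw [graphLaplacian_iff] at *
  rw [← smul_sub, map_smul, ← h]

/-- The domain of the Laplacian consists of bounded functions. -/
lemma ae_norm_le_of_graphLaplacian {C : NNReal} (hC : D.Sobolev6 C) : ∃ B : ℝ, 0 ≤ B ∧
    ∀ w f : D.L2, GraphLaplacian D.gradGraph w f →
      ∀ᵐ x ∂D.meas, ‖w x‖ ≤ 2 * (‖w‖ + B * ‖w - f‖ + 2) := by
  obtain ⟨B, hB, hw⟩ := ae_re_le hC
  refine ⟨B, hB, fun w f h => ?_⟩
  -- Rotating `w` by `±1` and `±i` turns the one-sided bound on real parts into bounds on `|Re w|`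
  -- and `|Im w|`.
  have key (c : ℂ) (hc : ‖c‖ = 1) : ∀ᵐ x ∂D.meas, (c * w x).re ≤ ‖w‖ + B * ‖w - f‖ + 2 := by
    have := hw _ _ (GraphLaplacian_smul h c)
    rw [← smul_sub, norm_smul, norm_smul, hc, one_mul, one_mul] at this
    filter_upwards [this, Lp.coeFn_smul c w] with x h1 h2
    rwa [h2, Pi.smul_apply, smul_eq_mul] at h1
  filter_upwards [key 1 (by simp), key (-1) (by simp), key Complex.I (by simp),
    key (-Complex.I) (by simp)] with x h1 h2 h3 h4
  simp only [one_mul, neg_mul, Complex.neg_re, Complex.I_mul_re, neg_neg] at h1 h2 h3 h4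
  have e1 := abs_le.2 ⟨neg_le.1 h2, h1⟩
  have e2 := abs_le.2 ⟨neg_le.1 h3, h4⟩
  linarith [Complex.norm_le_abs_re_add_abs_im (w x)]

end Setting

end

noncomputable section

/-! ### The Sobolev inequality for test functions -/

section Sobolev

variable {d : ℕ}

lemma eLpNorm_pow_complex {α : Type*} [MeasurableSpace α] {μ : Measure α} (f : α → ℂ) (n : ℕ)
    (hn : 0 < n) (p : ℝ≥0∞) :
    eLpNorm (fun x => f x ^ n) p μ = eLpNorm f (p * n) μ ^ n := by
  have h := eLpNorm_norm_rpow (p := p) (μ := μ) f (q := n) (by exact_mod_cast hn)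
  rw [ENNReal.rpow_natCast, ENNReal.ofReal_natCast] at h
  rw [← h]
  exact eLpNorm_congr_norm_ae (Filter.Eventually.of_forall fun x => by simp)

/-- For `d = 3` this is the Sobolev inequality with exponents `2` and `6`. For `d = 2` the exponent
`2` is critical, so `W^{1,1} ⊆ L²` is applied to `ψ²` and `ψ³`: `‖ψ‖₆³ ≤ 3c ‖ψ²‖₂ ‖∇ψ‖₂ ≤ 6c² ‖ψ‖₂
‖∇ψ‖₂²`. -/
lemma exists_eLpNorm_six_le (hd : d = 2 ∨ d = 3) : ∃ C : NNReal, ∀ ψ : Space d → ℂ,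
    ContDiff ℝ ∞ ψ → HasCompactSupport ψ → eLpNorm ψ 6 volume
      ≤ C * (eLpNorm ψ 2 volume + eLpNorm (fderiv ℝ ψ) 2 volume) := by
  rcases hd with rfl | rfl
  · set c := eLpNormLESNormFDerivOneConst (volume : Measure (Space 2)) 2 with hc
    have hGN : ∀ v : Space 2 → ℂ, ContDiff ℝ ∞ v → HasCompactSupport v →
        eLpNorm v 2 volume ≤ c * eLpNorm (fderiv ℝ v) 1 volume := fun v hv hs => by
      have := eLpNorm_le_eLpNorm_fderiv_one (volume : Measure (Space 2)) (u := v) (p := 2)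
        (hv.of_le (by simp)) hs (by
          simp only [finrank_euclideanSpace, Fintype.card_fin]
          exact ⟨by norm_num, by norm_num, by norm_num⟩)
      simpa [hc] using this
    refine ⟨6 * c ^ 2 + 1, fun ψ hψ hs => ?_⟩
    have hpow (n : ℕ) : eLpNorm (fun x => ψ x ^ (n + 1)) 2 volume
        ≤ c * ((n + 1 : ℕ) * eLpNorm (fun x => ψ x ^ n) 2 volume
          * eLpNorm (fderiv ℝ ψ) 2 volume) := by
      have hcs : HasCompactSupport fun x => ψ x ^ (n + 1) :=
        hs.comp_left (g := fun z => z ^ (n + 1)) (by simp)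
      refine (hGN _ (hψ.pow _) hcs).trans ?_
      have hfd : fderiv ℝ (fun x => ψ x ^ (n + 1))
          = (fun x => ((n + 1 : ℕ) : ℂ) * ψ x ^ n) • fderiv ℝ ψ := by
        funext x
        have := ((hψ.differentiable (by simp) x).hasFDerivAt).pow (n + 1)
        rw [this.fderiv, Pi.smul_apply']
        ext v
        simp
      gcongr
      rw [hfd]
      refine (eLpNorm_smul_le_mul_eLpNorm (p := 2) (q := 2) (r := 1)
        ((hψ.continuous_fderiv (by simp)).aestronglyMeasurable)
        (by have := hψ.continuous; fun_prop)).trans ?_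
      gcongr
      have := eLpNorm_const_smul_le (c := ((n + 1 : ℕ) : ℂ)) (f := fun x => ψ x ^ n) (p := 2)
        (μ := volume)
      refine this.trans (le_of_eq ?_)
      rw [← ofReal_norm, Complex.norm_natCast, ENNReal.ofReal_natCast]
    set a := eLpNorm ψ 2 volume with ha
    set b := eLpNorm (fderiv ℝ ψ) 2 volume with hb
    have h1 := hpow 1
    have h2 := hpow 2
    simp only [pow_one] at h1
    rw [eLpNorm_pow_complex ψ _ (by norm_num)] at h2
    norm_num at h1 h2
    have h3 : eLpNorm ψ 6 volume ^ 3 ≤ ((6 * c ^ 2 + 1 : NNReal) * (a + b)) ^ 3 := by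
      calc eLpNorm ψ 6 volume ^ 3 ≤ _ := h2
        _ ≤ c * (3 * (c * (2 * a * b)) * b) := by gcongr
        _ = (6 * c ^ 2 : NNReal) * (a * b * b) := by push_cast; ring
        -- The `+ 1` makes the constant at least `1`, hence at most its cube, so that the cube root
        -- can be taken without computing it.
        _ ≤ (6 * c ^ 2 + 1 : NNReal) ^ 3 * ((a + b) * (a + b) * (a + b)) := by
          have hx : (6 * c ^ 2 : NNReal) ≤ (6 * c ^ 2 + 1) ^ 3 := by
            calc 6 * c ^ 2 ≤ (6 * c ^ 2 + 1) ^ 1 := by simp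
              _ ≤ _ := pow_le_pow_right₀ (by simp) (by norm_num)
          gcongr
          · exact_mod_cast hx
          · exact le_self_add
          · exact le_add_self
          · exact le_add_self
        _ = _ := by rw [mul_pow]; ring
    exact (ENNReal.pow_le_pow_left_iff (by norm_num)).1 h3
  · refine ⟨SNormLESNormFDerivOfEqConst ℂ (volume : Measure (Space 3)) 2, fun ψ hψ hs => ?_⟩
    have := eLpNorm_le_eLpNorm_fderiv_of_eq (volume : Measure (Space 3)) (u := ψ) (p := 2) (p' := 6)
      (hψ.of_le (by simp)) hs (by norm_num) (by simp) (by simp; norm_num)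
    refine (by exact_mod_cast this : eLpNorm ψ 6 volume ≤ _ * eLpNorm (fderiv ℝ ψ) 2 volume).trans ?_
    gcongr
    exact le_add_self

end Sobolev

/-! ### Covering balls by translates of a period box -/

section Cover

variable {d : ℕ} {a b : Fin d → ℝ}

lemma volume_coordinate_eq (i : Fin d) (c : ℝ) : volume {x : Space d | x i = c} = 0 := by
  have h := (PiLp.volume_preserving_toLp (Fin d)).measure_preimage_equiv
    (f := MeasurableEquiv.toLp 2 (Fin d → ℝ)) {x : Space d | x i = c}
  rw [← h]
  exact Measure.pi_hyperplane (fun _ : Fin d => (volume : Measure ℝ)) i c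

/-- A lattice vector. -/
def latticeVec (a b : Fin d → ℝ) (k : Fin d → ℤ) : Space d :=
  ∑ i, k i • EuclideanSpace.single i (b i - a i)

lemma latticeVec_apply (a b : Fin d → ℝ) (k : Fin d → ℤ) (i : Fin d) :
    latticeVec a b k i = k i * (b i - a i) := by
  simp [latticeVec, Pi.single_apply]

lemma periodic_latticeVec {α : Type*} {g : Space d → α}
    (hg : ∀ (i : Fin d) x, g (x + EuclideanSpace.single i (b i - a i)) = g x) (k : Fin d → ℤ) :
    Function.Periodic g (latticeVec a b k) := by
  have h : ∀ s : Finset (Fin d),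
      Function.Periodic g (∑ i ∈ s, k i • EuclideanSpace.single i (b i - a i)) := fun s => by
    classical
    induction s using Finset.induction_on with
    | empty => simp [Function.Periodic]
    | insert i s hi ih =>
      rw [Finset.sum_insert hi]
      exact Function.Periodic.add_period (Function.Periodic.zsmul (hg i) (k i)) ih
  exact h _

/-- The integral of a periodic function over a ball is controlled by the integral over a period. -/
lemma exists_lintegral_ball_le (h : ∀ i, a i < b i) (R : ℝ) : ∃ N : ℕ, ∀ g : Space d → ℝ≥0∞,
    (∀ (i : Fin d) x, g (x + EuclideanSpace.single i (b i - a i)) = g x) →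
    ∫⁻ x in Metric.closedBall 0 R, g x
      ≤ N * ∫⁻ x in {x : Space d | ∀ i, a i < x i ∧ x i < b i}, g x := by
  -- The number `N` below bounds, in every direction, the index of a translate needed to reach the
  -- ball.
  set Q := {x : Space d | ∀ i, a i < x i ∧ x i < b i} with hQ
  obtain ⟨N, hN⟩ : ∃ N : ℕ, ∀ i, (R + |a i|) / (b i - a i) + 1 ≤ N := by
    obtain ⟨M, hM⟩ := (finite_range fun i => (R + |a i|) / (b i - a i) + 1).bddAbove
    obtain ⟨N, hN⟩ := exists_nat_ge M
    exact ⟨N, fun i => (hM ⟨i, rfl⟩).trans hN⟩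
  set S : Finset (Fin d → ℤ) := Fintype.piFinset fun _ => Finset.Icc (-N : ℤ) N with hS
  refine ⟨S.card, fun g hg => ?_⟩
  -- The open translates of `Q` miss the lattice hyperplanes, so the covering holds only almost
  -- everywhere.
  have hnull : volume {x : Space d | ∃ i, ∃ n : ℤ, x i = a i + n * (b i - a i)} = 0 := by
    have : {x : Space d | ∃ i, ∃ n : ℤ, x i = a i + n * (b i - a i)}
        = ⋃ i, ⋃ n : ℤ, {x : Space d | x i = a i + n * (b i - a i)} := by
      ext x; simp
    rw [this, measure_iUnion_null_iff]
    intro i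
    rw [measure_iUnion_null_iff]
    exact fun n => volume_coordinate_eq i _
  have hcover : (Metric.closedBall 0 R : Set (Space d)) ≤ᵐ[volume]
      ⋃ k : S, (fun x => x + latticeVec a b (-k.1)) ⁻¹' Q := by
    have hae : ∀ᵐ x : Space d, ¬ ∃ i, ∃ n : ℤ, x i = a i + n * (b i - a i) := by
      rw [ae_iff]; simpa using hnull
    filter_upwards [hae] with x hx hxR
    push Not at hx
    have hxR' : ‖x‖ ≤ R := by
      have h0 : x ∈ Metric.closedBall 0 R := hxR
      simpa using h0
    have hp (i : Fin d) : 0 < b i - a i := sub_pos.2 (h i)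
    set k : Fin d → ℤ := fun i => toIcoDiv (hp i) (a i) (x i) with hk
    have hkS : k ∈ S := by
      rw [hS, Fintype.mem_piFinset]
      intro i
      have hxi : |x i| ≤ R := (PiLp.norm_apply_le x i).trans hxR'
      have h1 : |(x i - a i) / (b i - a i)| ≤ N - 1 := by
        rw [abs_div, abs_of_pos (hp i)]
        have h2 : |x i - a i| ≤ R + |a i| := (abs_sub _ _).trans (by gcongr)
        have h3 : |x i - a i| / (b i - a i) ≤ (R + |a i|) / (b i - a i) := by
          have := (hp i).le
          gcongr
        linarith [hN i]
      rw [abs_le] at h1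
      rw [Finset.mem_Icc]
      simp only [hk, toIcoDiv_eq_floor]
      constructor
      · rw [Int.le_floor]; push_cast; linarith
      · have := Int.floor_le ((x i - a i) / (b i - a i))
        have h4 : ((⌊(x i - a i) / (b i - a i)⌋ : ℤ) : ℝ) ≤ ((N : ℤ) : ℝ) := by
          push_cast; linarith
        exact_mod_cast h4
    change x ∈ ⋃ k : S, (fun x => x + latticeVec a b (-k.1)) ⁻¹' Q
    rw [mem_iUnion]
    refine ⟨⟨k, hkS⟩, fun i => ?_⟩
    have h5 := toIcoMod_mem_Ico (hp i) (a i) (x i)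
    have h6 : (x + latticeVec a b (-k)) i = toIcoMod (hp i) (a i) (x i) := by
      rw [PiLp.add_apply, latticeVec_apply, toIcoMod, zsmul_eq_mul]
      simp only [hk, Pi.neg_apply, Int.cast_neg]; ring
    have h7 : toIcoMod (hp i) (a i) (x i) ≠ a i := fun he => hx i (k i) (by
      have := toIcoMod_add_toIcoDiv_zsmul (hp i) (a i) (x i)
      rw [he, zsmul_eq_mul] at this
      exact this.symm)
    simp only
    rw [h6]
    exact ⟨lt_of_le_of_ne h5.1 h7.symm, by linarith [h5.2]⟩
  calc ∫⁻ x in Metric.closedBall 0 R, g x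
      ≤ ∫⁻ x in ⋃ k : S, (fun x => x + latticeVec a b (-k.1)) ⁻¹' Q, g x :=
        lintegral_mono' (Measure.restrict_mono_ae hcover) le_rfl
    _ ≤ ∑' k : S, ∫⁻ x in (fun x => x + latticeVec a b (-k.1)) ⁻¹' Q, g x := lintegral_iUnion_le _ _
    _ = ∑' _ : S, ∫⁻ x in Q, g x := by
      congr 1
      funext k
      have hper := periodic_latticeVec hg (-k.1)
      have hmp := measurePreserving_add_right (volume : Measure (Space d)) (latticeVec a b (-k.1))
      exact (lintegral_congr fun x => (hper x).symm).trans (hmp.setLIntegral_comp_preimage_emb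
        (MeasurableEquiv.addRight (latticeVec a b (-k.1))).measurableEmbedding g Q)
    _ = S.card * ∫⁻ x in Q, g x := by
      rw [tsum_fintype, Finset.sum_const, nsmul_eq_mul]; simp

end Cover

namespace Setting

variable {d : ℕ} {D : Setting d}

lemma eLpNorm_two_eq {ψ : Space d → ℂ} (hψ : D.IsTest ψ) :
    eLpNorm ψ 2 D.meas = ENNReal.ofReal ‖testL2 hψ‖ := by
  rw [Lp.norm_def, ENNReal.ofReal_toReal (Lp.eLpNorm_ne_top _)]
  exact (eLpNorm_congr_ae (coeFn_testL2 hψ)).symm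

lemma norm_testL2_le {ψ : Space d → ℂ} (hψ : D.IsTest ψ) : ‖testL2 hψ‖ ≤ ‖testPair hψ‖ :=
  WithLp.norm_fst_le _ (testPair hψ)

lemma norm_testL2_partialDeriv_le {ψ : Space d → ℂ} (hψ : D.IsTest ψ) (j : Fin d) :
    ‖testL2 (hψ.partialDeriv j)‖ ≤ ‖testPair hψ‖ :=
  (PiLp.norm_apply_le (testPair hψ).snd j).trans (WithLp.norm_snd_le _ (testPair hψ))

lemma eLpNorm_two_le {ψ : Space d → ℂ} (hψ : D.IsTest ψ) :
    eLpNorm ψ 2 D.meas ≤ ENNReal.ofReal ‖testPair hψ‖ := by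
  rw [eLpNorm_two_eq hψ]
  exact ENNReal.ofReal_le_ofReal (norm_testL2_le hψ)

lemma eLpNorm_fderiv_le {ψ : Space d → ℂ} (hψ : D.IsTest ψ) :
    eLpNorm (fderiv ℝ ψ) 2 D.meas ≤ d * ENNReal.ofReal ‖testPair hψ‖ := by
  calc eLpNorm (fderiv ℝ ψ) 2 D.meas
      ≤ eLpNorm (∑ j : Fin d, fun x => ‖partialDeriv j ψ x‖) 2 D.meas := by
        refine eLpNorm_mono_real fun x => ?_
        rw [Finset.sum_apply]
        exact norm_fderiv_le_sum_partialDeriv ψ x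
    _ ≤ ∑ j : Fin d, eLpNorm (fun x => ‖partialDeriv j ψ x‖) 2 D.meas :=
        eLpNorm_sum_le (fun j _ => (hψ.partialDeriv j).continuous.norm.aestronglyMeasurable)
          (by norm_num)
    _ ≤ ∑ j : Fin d, ENNReal.ofReal ‖testPair hψ‖ := by
        refine Finset.sum_le_sum fun j _ => ?_
        rw [eLpNorm_norm, eLpNorm_two_eq (hψ.partialDeriv j)]
        exact ENNReal.ofReal_le_ofReal (norm_testL2_partialDeriv_le hψ j)
    _ = _ := by simp

lemma sobolev6_of_support {C : NNReal} (hC : ∀ ψ : Space d → ℂ,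
    ContDiff ℝ ∞ ψ → HasCompactSupport ψ → eLpNorm ψ 6 volume
      ≤ C * (eLpNorm ψ 2 volume + eLpNorm (fderiv ℝ ψ) 2 volume))
    (hD : ∀ ψ, D.IsTest ψ → HasCompactSupport ψ ∧ tsupport ψ ⊆ D.carrier) :
    D.Sobolev6 (C * (1 + d)) := by
  intro ψ hψ
  obtain ⟨hs, hsub⟩ := hD ψ hψ
  have h1 := hC ψ hψ.contDiff hs
  rw [← eLpNorm_restrict_eq_of_support_subset (p := 6) ((subset_tsupport ψ).trans hsub),
    ← eLpNorm_restrict_eq_of_support_subset (p := 2) ((subset_tsupport ψ).trans hsub),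
    ← eLpNorm_restrict_eq_of_support_subset (f := fderiv ℝ ψ)
      (((subset_tsupport _).trans (tsupport_fderiv_subset ℝ)).trans hsub)] at h1
  refine h1.trans ?_
  calc _ ≤ C * (ENNReal.ofReal ‖testPair hψ‖ + d * ENNReal.ofReal ‖testPair hψ‖) := by
        gcongr
        · exact eLpNorm_two_le hψ
        · exact eLpNorm_fderiv_le hψ
    _ = _ := by push_cast; ring

lemma eLpNorm_ball_le {F : Type*} [NormedAddCommGroup F] {a b : Fin d → ℝ} {h : ∀ i, a i < b i}
    {R : ℝ} {N : ℕ} (hN : ∀ g : Space d → ℝ≥0∞,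
      (∀ (i : Fin d) x, g (x + EuclideanSpace.single i (b i - a i)) = g x) →
      ∫⁻ x in Metric.closedBall 0 R, g x
        ≤ N * ∫⁻ x in {x : Space d | ∀ i, a i < x i ∧ x i < b i}, g x)
    {f : Space d → F}
    (hf : ∀ (i : Fin d) x, f (x + EuclideanSpace.single i (b i - a i)) = f x) :
    eLpNorm f 2 (volume.restrict (Metric.closedBall 0 R))
      ≤ (N + 1 : ℕ) * eLpNorm f 2 (periodic a b h).meas := by
  rw [eLpNorm_eq_lintegral_rpow_enorm_toReal (by simp) (by simp),
    eLpNorm_eq_lintegral_rpow_enorm_toReal (by simp) (by simp)]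
  calc _ ≤ (N * ∫⁻ x, ‖f x‖ₑ ^ (2 : ℝ≥0∞).toReal ∂(periodic a b h).meas)
          ^ (1 / (2 : ℝ≥0∞).toReal) := by
        gcongr
        exact hN _ fun i x => by rw [hf i x]
    _ = (N : ℝ≥0∞) ^ (1 / (2 : ℝ≥0∞).toReal) * _ := ENNReal.mul_rpow_of_nonneg _ _ (by simp)
    _ ≤ _ := by
      gcongr
      -- Passing to `N + 1 ≥ 1` allows the exponent `1/2` to be raised to `1`.
      calc (N : ℝ≥0∞) ^ (1 / (2 : ℝ≥0∞).toReal) ≤ ((N + 1 : ℕ) : ℝ≥0∞) ^ (1 / (2 : ℝ≥0∞).toReal) := by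
            gcongr; simp
        _ ≤ ((N + 1 : ℕ) : ℝ≥0∞) ^ (1 : ℝ) :=
          ENNReal.rpow_le_rpow_of_exponent_le (by norm_cast; omega) (by norm_num)
        _ = _ := ENNReal.rpow_one _

/-- The Sobolev inequality `H¹ ⊆ L⁶` in dimensions two and three. -/
lemma exists_sobolev6 (hd : d = 2 ∨ d = 3) (D : Setting d) : ∃ C, D.Sobolev6 C := by
  obtain ⟨C, hC⟩ := exists_eLpNorm_six_le hd
  cases D with
  | whole => exact ⟨_, sobolev6_of_support hC fun ψ hψ => ⟨hψ.2, subset_univ _⟩⟩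
  | dirichlet U _ _ _ => exact ⟨_, sobolev6_of_support hC fun ψ hψ => hψ.2⟩
  | periodic a b h =>
    obtain ⟨R, hR, hsub⟩ := (isCompact_closedBox a b).isBounded.subset_closedBall_lt 0 0
    obtain ⟨N, hN⟩ := exists_lintegral_ball_le h (R + 1)
    -- A cutoff equal to `1` on the box: the whole-space inequality is applied to `ηψ`, and the
    -- norms over the larger ball are counted back to one period.
    set η : ContDiffBump (0 : Space d) := ⟨R, R + 1, hR, by linarith⟩ with hη
    have hηc : HasCompactSupport η := η.hasCompactSupport
    have hηd : ContDiff ℝ ∞ η := η.contDiff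
    obtain ⟨K, hK⟩ := (hηd.continuous_fderiv (by simp)).bounded_above_of_compact_support
      (hηc.fderiv ℝ)
    have hK0 : 0 ≤ K := (norm_nonneg _).trans (hK 0)
    set B := volume.restrict (Metric.closedBall (0 : Space d) (R + 1)) with hB
    refine ⟨C * ((N + 1 : ℕ) + (N + 1 : ℕ) * d + K.toNNReal * (N + 1 : ℕ)), fun ψ hψ => ?_⟩
    set χ : Space d → ℂ := fun x => η x • ψ x with hχ
    have hχd : ContDiff ℝ ∞ χ := hηd.smul hψ.contDiff
    have hsupp : tsupport χ ⊆ Metric.closedBall 0 (R + 1) := by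
      refine (tsupport_smul_subset_left η ψ).trans ?_
      exact (η.tsupport_eq).le
    have hχc : HasCompactSupport χ := hηc.smul_right
    have e1 : eLpNorm ψ 6 (periodic a b h).meas ≤ eLpNorm χ 6 volume := by
      refine le_trans (le_of_eq ?_) (eLpNorm_mono_measure χ
        (Measure.restrict_le_self (s := (periodic a b h).carrier)))
      refine eLpNorm_congr_ae ?_
      filter_upwards [ae_restrict_mem (measurableSet_carrier _)] with x hx
      have : η x = 1 := η.one_of_mem_closedBall (hsub (periodic_carrier_subset a b h hx))
      simp [hχ, this]
    have e2 := hC χ hχd hχc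
    have e3 : eLpNorm χ 2 volume ≤ eLpNorm ψ 2 B := by
      rw [← eLpNorm_restrict_eq_of_support_subset ((subset_tsupport χ).trans hsupp)]
      refine eLpNorm_mono fun x => ?_
      rw [hχ, norm_smul, Real.norm_of_nonneg η.nonneg]
      exact mul_le_of_le_one_left (norm_nonneg _) η.le_one
    have e4 : eLpNorm (fderiv ℝ χ) 2 volume
        ≤ eLpNorm (fderiv ℝ ψ) 2 B + K.toNNReal * eLpNorm ψ 2 B := by
      rw [← eLpNorm_restrict_eq_of_support_subset (f := fderiv ℝ χ)
        (((subset_tsupport _).trans (tsupport_fderiv_subset ℝ)).trans hsupp)]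
      calc _ ≤ eLpNorm ((fun x => ‖fderiv ℝ ψ x‖) + K • fun x => ‖ψ x‖) 2 B := by
            refine eLpNorm_mono_real fun x => ?_
            have hd1 := hηd.differentiable (by simp) x
            rw [hχ, fderiv_fun_smul hd1 (hψ.differentiable x)]
            refine (norm_add_le _ _).trans (add_le_add ?_ ?_)
            · rw [norm_smul, Real.norm_of_nonneg η.nonneg]
              exact mul_le_of_le_one_left (norm_nonneg _) η.le_one
            · rw [ContinuousLinearMap.norm_smulRight_apply]
              exact mul_le_mul_of_nonneg_right (hK x) (norm_nonneg _)
        _ ≤ eLpNorm (fun x => ‖fderiv ℝ ψ x‖) 2 B + eLpNorm (K • fun x => ‖ψ x‖) 2 B :=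
            eLpNorm_add_le ((hψ.contDiff.continuous_fderiv (by simp)).norm.aestronglyMeasurable)
              (hψ.continuous.norm.aestronglyMeasurable.const_smul K) (by norm_num)
        _ = _ := by
          rw [eLpNorm_norm, eLpNorm_const_smul, eLpNorm_norm, Real.enorm_of_nonneg hK0]
          rfl
    have e5 : eLpNorm ψ 2 B ≤ (N + 1 : ℕ) * eLpNorm ψ 2 (periodic a b h).meas :=
      eLpNorm_ball_le hN hψ.2
    have e6 : eLpNorm (fderiv ℝ ψ) 2 B
        ≤ (N + 1 : ℕ) * eLpNorm (fderiv ℝ ψ) 2 (periodic a b h).meas := by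
      refine eLpNorm_ball_le hN fun i x => ?_
      rw [← fderiv_comp_add_right]
      simp_rw [hψ.2 i]
    set P := ENNReal.ofReal ‖testPair hψ‖ with hP
    calc _ ≤ C * (eLpNorm ψ 2 B + (eLpNorm (fderiv ℝ ψ) 2 B + K.toNNReal * eLpNorm ψ 2 B)) :=
          e1.trans (e2.trans (by gcongr))
      _ ≤ C * ((N + 1 : ℕ) * P + ((N + 1 : ℕ) * (d * P) + K.toNNReal * ((N + 1 : ℕ) * P))) := by
          have h7 := eLpNorm_two_le hψ
          have h8 := eLpNorm_fderiv_le hψ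
          gcongr
          · exact e5.trans (by gcongr)
          · exact e6.trans (by gcongr)
          · exact e5.trans (by gcongr)
      _ = _ := by push_cast; ring

end Setting

end

noncomputable section

/-! ### Boundedness of the energy space in dimension one -/

section OneDim

/-- The identification of `ℝ` with the one-dimensional Euclidean space. -/
def lineMap (t : ℝ) : Space 1 := WithLp.toLp 2 fun _ => t

lemma lineMap_eq_smul (t : ℝ) : lineMap t = t • EuclideanSpace.single 0 1 := by
  ext i
  fin_cases i
  simp [lineMap]

lemma lineMap_apply_zero (x : Space 1) : lineMap (x 0) = x := by
  ext i
  fin_cases i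
  simp [lineMap]

lemma measurePreserving_lineMap : MeasurePreserving lineMap :=
  (PiLp.volume_preserving_toLp (Fin 1)).comp (volume_preserving_funUnique (Fin 1) ℝ).symm

lemma measurableEmbedding_lineMap : MeasurableEmbedding lineMap :=
  (MeasurableEquiv.toLp 2 (Fin 1 → ℝ)).measurableEmbedding.comp
    (MeasurableEquiv.funUnique (Fin 1) ℝ).symm.measurableEmbedding

lemma hasDerivAt_comp_lineMap {ψ : Space 1 → ℂ} (hψ : Differentiable ℝ ψ) (t : ℝ) :
    HasDerivAt (fun s => ψ (lineMap s)) (partialDeriv 0 ψ (lineMap t)) t := by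
  have h1 : HasDerivAt lineMap (EuclideanSpace.single 0 1) t := by
    have := (hasDerivAt_id t).smul_const (EuclideanSpace.single (0 : Fin 1) (1 : ℝ))
    rw [one_smul] at this
    exact this.congr_of_eventuallyEq (Filter.Eventually.of_forall lineMap_eq_smul)
  exact (hψ (lineMap t)).hasFDerivAt.comp_hasDerivAt t h1

/-- A nonhomogeneous form of the embedding `H¹ ⊆ L^∞` on an interval. -/
lemma norm_le_add_integral_sq {φ φ' : ℝ → ℂ} (hd : ∀ t, HasDerivAt φ (φ' t) t)
    (hc : Continuous φ') {p q t : ℝ} (hpq : p < q) (ht : t ∈ Icc p q) :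
    ‖φ t‖ ≤ 1 + (q - p) + (q - p)⁻¹ * (∫ s in p..q, ‖φ s‖ ^ 2) + ∫ s in p..q, ‖φ' s‖ ^ 2 := by
  have hφ : Continuous φ := continuous_iff_continuousAt.2 fun t => (hd t).continuousAt
  have hl : 0 < q - p := sub_pos.2 hpq
  -- This elementary bound replaces Cauchy–Schwarz and makes the estimate nonhomogeneous, which is
  -- harmless: only some bound depending on `M` is wanted.
  have hle1 (z : ℂ) : ‖z‖ ≤ 1 + ‖z‖ ^ 2 := by nlinarith [sq_nonneg (‖z‖ - 1), norm_nonneg z]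
  have hint (f : ℝ → ℂ) (hf : Continuous f) :
      ∫ s in p..q, ‖f s‖ ≤ (q - p) + ∫ s in p..q, ‖f s‖ ^ 2 := by
    have hf2 : Continuous fun s => ‖f s‖ ^ 2 := by fun_prop
    have : ∫ s in p..q, (1 + ‖f s‖ ^ 2) = (q - p) + ∫ s in p..q, ‖f s‖ ^ 2 := by
      rw [intervalIntegral.integral_add intervalIntegrable_const
        (hf2.intervalIntegrable _ _)]
      simp
    rw [← this]
    exact intervalIntegral.integral_mono_on hpq.le (hf.norm.intervalIntegrable _ _)
      ((continuous_const.add hf2).intervalIntegrable _ _) fun s _ => hle1 _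
  have hs : ∀ s ∈ Icc p q, ‖φ t‖ - ∫ r in p..q, ‖φ' r‖ ≤ ‖φ s‖ := fun s hs => by
    have h1 : ∫ r in s..t, φ' r = φ t - φ s :=
      intervalIntegral.integral_eq_sub_of_hasDerivAt (fun x _ => hd x) (hc.intervalIntegrable _ _)
    have h2 : ‖∫ r in s..t, φ' r‖ ≤ ∫ r in p..q, ‖φ' r‖ := by
      refine (intervalIntegral.norm_integral_le_integral_norm_uIoc).trans ?_
      rw [intervalIntegral.integral_of_le hpq.le]
      refine setIntegral_mono_set (hc.norm.integrableOn_Ioc)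
        (Filter.Eventually.of_forall fun _ => norm_nonneg _) (LE.le.eventuallyLE ?_)
      exact Ioc_subset_Ioc (le_min hs.1 ht.1) (max_le hs.2 ht.2)
    have h3 : φ t = φ s + ∫ r in s..t, φ' r := by rw [h1]; ring
    have h4 : ‖φ t‖ ≤ ‖φ s‖ + ‖∫ r in s..t, φ' r‖ := by
      conv_lhs => rw [h3]
      exact norm_add_le _ _
    linarith
  -- The lower bound for `‖φ s‖` is averaged over the interval.
  have hmean : (q - p) * (‖φ t‖ - ∫ r in p..q, ‖φ' r‖) ≤ ∫ s in p..q, ‖φ s‖ := by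
    have := intervalIntegral.integral_mono_on (μ := volume)
      (f := fun _ => ‖φ t‖ - ∫ r in p..q, ‖φ' r‖) (g := fun s => ‖φ s‖) hpq.le
      intervalIntegrable_const (hφ.norm.intervalIntegrable _ _) hs
    rwa [intervalIntegral.integral_const, smul_eq_mul] at this
  have h5 := hint φ hφ
  have h6 := hint φ' hc
  have h7 : ‖φ t‖ - ∫ r in p..q, ‖φ' r‖ ≤ (q - p)⁻¹ * ((q - p) + ∫ s in p..q, ‖φ s‖ ^ 2) := by
    rw [inv_mul_eq_div, le_div_iff₀ hl]; linarith
  rw [mul_add, inv_mul_cancel₀ hl.ne'] at h7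
  linarith

end OneDim

namespace Setting

open Filter Topology

lemma norm_testL2_sq {d : ℕ} {D : Setting d} {ψ : Space d → ℂ} (hψ : D.IsTest ψ) :
    ‖testL2 hψ‖ ^ 2 = ∫ x, ‖ψ x‖ ^ 2 ∂D.meas := by
  have h1 : ((‖testL2 hψ‖ ^ 2 : ℝ) : ℂ) = ∫ x, ((‖ψ x‖ ^ 2 : ℝ) : ℂ) ∂D.meas := by
    push_cast
    rw [← Complex.coe_algebraMap, ← inner_self_eq_norm_sq_to_K (𝕜 := ℂ), L2.inner_def]
    refine integral_congr_ae ?_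
    filter_upwards [coeFn_testL2 hψ] with x hx
    rw [hx]
    exact inner_self_eq_norm_sq_to_K _
  rw [integral_complex_ofReal] at h1
  exact_mod_cast h1

variable {D : Setting 1}

lemma norm_testL2_sq_eq_lineMap {ψ : Space 1 → ℂ} (hψ : D.IsTest ψ) :
    ‖testL2 hψ‖ ^ 2 = ∫ s in lineMap ⁻¹' D.carrier, ‖ψ (lineMap s)‖ ^ 2 := by
  rw [norm_testL2_sq, ← measurePreserving_lineMap.setIntegral_preimage_emb
    measurableEmbedding_lineMap]

/-- Intervals on which the integrals of test functions are controlled by their norms. -/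
def IsInterval (D : Setting 1) (p q : ℝ) : Prop :=
  p < q ∧ ∀ ψ (hψ : D.IsTest ψ), ∫ s in p..q, ‖ψ (lineMap s)‖ ^ 2 ≤ ‖testL2 hψ‖ ^ 2

lemma isInterval_of_support (hD : ∀ ψ, D.IsTest ψ → HasCompactSupport ψ ∧ tsupport ψ ⊆ D.carrier)
    {p q : ℝ} (hpq : p < q) : D.IsInterval p q := by
  refine ⟨hpq, fun ψ hψ => ?_⟩
  obtain ⟨hs, hsub⟩ := hD ψ hψ
  have h0 : ∫ x, ‖ψ x‖ ^ 2 ∂D.meas = ∫ x, ‖ψ x‖ ^ 2 :=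
    setIntegral_eq_integral_of_forall_compl_eq_zero fun x hx => by
      rw [image_eq_zero_of_notMem_tsupport fun h => hx (hsub h)]; simp
  have hcont : Continuous fun x => ‖ψ x‖ ^ 2 := by
    have := hψ.continuous
    fun_prop
  have hcomp : HasCompactSupport fun x => ‖ψ x‖ ^ 2 := by
    refine HasCompactSupport.intro hs.isCompact fun x hx => ?_
    rw [image_eq_zero_of_notMem_tsupport hx, norm_zero, sq, mul_zero]
  have hi : Integrable fun x => ‖ψ x‖ ^ 2 := hcont.integrable_of_hasCompactSupport hcomp
  have hi' : Integrable fun s => ‖ψ (lineMap s)‖ ^ 2 :=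
    (measurePreserving_lineMap.integrable_comp_emb measurableEmbedding_lineMap).2 hi
  rw [norm_testL2_sq, h0, ← measurePreserving_lineMap.integral_comp measurableEmbedding_lineMap,
    intervalIntegral.integral_of_le hpq.le]
  exact setIntegral_le_integral hi' (Filter.Eventually.of_forall fun _ => sq_nonneg _)

/-- The length must not depend on the point. Test functions of compact support vanish outside `Ω`,
so a unit interval leaving `Ω` does no harm; in the periodic case the whole period is taken. -/
lemma exists_isInterval (D : Setting 1) : ∃ l : ℝ, 0 < l ∧ ∀ x ∈ D.carrier, ∃ p,
    x 0 ∈ Icc p (p + l) ∧ D.IsInterval p (p + l) := by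
  cases D with
  | whole =>
    exact ⟨1, one_pos, fun x _ => ⟨x 0, ⟨le_rfl, by linarith⟩,
      isInterval_of_support (D := whole) (fun ψ hψ => ⟨hψ.2, subset_univ _⟩) (by linarith)⟩⟩
  | dirichlet U h1 h2 h3 =>
    exact ⟨1, one_pos, fun x _ => ⟨x 0, ⟨le_rfl, by linarith⟩,
      isInterval_of_support (D := dirichlet U h1 h2 h3) (fun ψ hψ => hψ.2) (by linarith)⟩⟩
  | periodic a b h =>
    refine ⟨b 0 - a 0, sub_pos.2 (h 0), fun x hx => ⟨a 0, ⟨(hx 0).1.le, by linarith [(hx 0).2]⟩,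
      by linarith [h 0], fun ψ hψ => ?_⟩⟩
    rw [norm_testL2_sq_eq_lineMap, add_sub_cancel, intervalIntegral.integral_of_le (h 0).le,
      integral_Ioc_eq_integral_Ioo]
    have : lineMap ⁻¹' (periodic a b h).carrier = Ioo (a 0) (b 0) := by
      ext t
      simp [carrier, lineMap]
    rw [this]

lemma exists_norm_test_le (D : Setting 1) : ∃ A B : ℝ, 0 ≤ A ∧ 0 ≤ B ∧
    ∀ ψ (hψ : D.IsTest ψ), ∀ x ∈ D.carrier, ‖ψ x‖ ≤ A + B * ‖testPair hψ‖ ^ 2 := by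
  obtain ⟨l, hl, h⟩ := exists_isInterval D
  refine ⟨1 + l, l⁻¹ + 1, by positivity, by positivity, fun ψ hψ x hx => ?_⟩
  obtain ⟨p, hp, hI⟩ := h x hx
  have hc : Continuous lineMap := by
    have : lineMap = fun t : ℝ => t • EuclideanSpace.single (0 : Fin 1) (1 : ℝ) :=
      funext lineMap_eq_smul
    rw [this]; fun_prop
  have h1 := norm_le_add_integral_sq (hasDerivAt_comp_lineMap hψ.differentiable)
    ((hψ.partialDeriv 0).continuous.comp hc) hI.1 hp
  rw [lineMap_apply_zero, add_sub_cancel_left] at h1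
  have h2 : ∫ s in p..(p + l), ‖ψ (lineMap s)‖ ^ 2 ≤ ‖testPair hψ‖ ^ 2 :=
    (hI.2 ψ hψ).trans (by gcongr; exact norm_testL2_le hψ)
  have h3 : ∫ s in p..(p + l), ‖partialDeriv 0 ψ (lineMap s)‖ ^ 2 ≤ ‖testPair hψ‖ ^ 2 :=
    (hI.2 _ (hψ.partialDeriv 0)).trans (by gcongr; exact norm_testL2_partialDeriv_le hψ 0)
  have h4 : l⁻¹ * (∫ s in p..(p + l), ‖ψ (lineMap s)‖ ^ 2) ≤ l⁻¹ * ‖testPair hψ‖ ^ 2 := by gcongr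
  calc _ ≤ _ := h1
    _ ≤ 1 + l + l⁻¹ * ‖testPair hψ‖ ^ 2 + ‖testPair hψ‖ ^ 2 := by
      exact add_le_add (add_le_add le_rfl h4) h3
    _ = _ := by ring

/-- In dimension one the energy space consists of bounded functions. -/
lemma exists_ae_norm_le_one_dim (D : Setting 1) : ∃ A B : ℝ, 0 ≤ A ∧ 0 ≤ B ∧
    ∀ p ∈ D.gradGraph, ∀ᵐ x ∂D.meas, ‖p.fst x‖ ≤ A + B * ‖p‖ ^ 2 := by
  obtain ⟨A, B, hA, hB, h⟩ := exists_norm_test_le D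
  refine ⟨A, B, hA, hB, fun p hp => ?_⟩
  obtain ⟨ψ, hψ, hlim⟩ := exists_testPair_tendsto hp
  have hlim1 : Tendsto (fun n => testL2 (hψ n)) atTop (𝓝 p.fst) :=
    ((WithLp.fstL 2 ℂ D.L2 (PiLp 2 fun _ : Fin 1 => D.L2)).continuous.tendsto p).comp hlim
  obtain ⟨ns, hns, hae⟩ := exists_subseq_ae_tendsto hlim1
  have hcoe : ∀ᵐ x ∂D.meas, ∀ n, testL2 (hψ n) x = ψ n x := ae_all_iff.2 fun n => coeFn_testL2 _
  filter_upwards [hae, hcoe, ae_restrict_mem D.measurableSet_carrier] with x h1 h2 hx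
  have h3 : Tendsto (fun n => A + B * ‖testPair (hψ (ns n))‖ ^ 2) atTop
      (𝓝 (A + B * ‖p‖ ^ 2)) :=
    (((hlim.norm.pow 2).const_mul B).const_add A).comp hns.tendsto_atTop
  refine le_of_tendsto_of_tendsto' h1.norm h3 fun n => ?_
  rw [h2]
  exact h _ (hψ (ns n)) x hx

end Setting

end

noncomputable section

/-! ### The regularized nonlinearity -/

section Nonlinearity

/-- The nonlinearity with a smooth modulus: `z ↦ 2 z ln (ε + √(|z|² + δ²))`. -/
def smoothNonlin (ε δ : ℝ) (z : ℂ) : ℂ :=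
  z * ((2 * Real.log (ε + Real.sqrt (‖z‖ ^ 2 + δ ^ 2)) : ℝ) : ℂ)

variable {ε δ : ℝ}

lemma logPhase_eq (ε : ℝ) (z : ℂ) : logPhase ε z = 2 * Real.log (ε + ‖z‖) := by
  rw [logPhase, Real.log_pow]; norm_num

lemma smoothNonlin_zero_right (ε : ℝ) (z : ℂ) : smoothNonlin ε 0 z = regNonlin ε z := by
  rw [smoothNonlin, regNonlin, logPhase_eq, zero_pow two_ne_zero, add_zero,
    Real.sqrt_sq (norm_nonneg z)]

lemma smoothNonlin_apply_zero (ε δ : ℝ) : smoothNonlin ε δ 0 = 0 := by simp [smoothNonlin]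

lemma contDiff_smoothNonlin (hε : 0 < ε) (hδ : 0 < δ) : ContDiff ℝ ∞ (smoothNonlin ε δ) := by
  have h1 : ContDiff ℝ ∞ fun z : ℂ => ‖z‖ ^ 2 + δ ^ 2 := (contDiff_norm_sq ℝ).add contDiff_const
  have h2 : ContDiff ℝ ∞ fun z : ℂ => ε + Real.sqrt (‖z‖ ^ 2 + δ ^ 2) :=
    contDiff_const.add (h1.sqrt fun z => by positivity)
  have h3 : ContDiff ℝ ∞ fun z : ℂ => 2 * Real.log (ε + Real.sqrt (‖z‖ ^ 2 + δ ^ 2)) :=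
    contDiff_const.mul (h2.log fun z => by positivity)
  exact contDiff_id.mul (Complex.ofRealCLM.contDiff.comp h3)

lemma abs_log_le_of_mem {a : ℝ} (hε : 0 < ε) (h1 : ε ≤ a) (h2 : a ≤ ε⁻¹) :
    |Real.log a| ≤ Real.log ε⁻¹ := by
  rw [abs_le]
  constructor
  · rw [Real.log_inv, neg_neg]; exact Real.log_le_log hε h1
  · exact Real.log_le_log (hε.trans_le h1) h2

lemma log_sub_log_le {a b : ℝ} (ha : 0 < a) (hab : a ≤ b) :
    |Real.log b - Real.log a| * a ≤ b - a := by
  have hb := ha.trans_le hab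
  rw [abs_of_nonneg (sub_nonneg.2 (Real.log_le_log ha hab)), ← Real.log_div hb.ne' ha.ne']
  have := Real.log_le_sub_one_of_pos (div_pos hb ha)
  calc _ ≤ (b / a - 1) * a := by gcongr
    _ = b - a := by field_simp

lemma sqrt_sub_sqrt_le {x y : ℝ} (hx : 0 ≤ x) (hxy : x ≤ y) :
    Real.sqrt (y ^ 2 + δ ^ 2) - Real.sqrt (x ^ 2 + δ ^ 2) ≤ y - x := by
  have h1 : x ≤ Real.sqrt (x ^ 2 + δ ^ 2) := Real.le_sqrt_of_sq_le (by nlinarith)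
  rw [sub_le_iff_le_add, Real.sqrt_le_left]
  · have := Real.sq_sqrt (by positivity : 0 ≤ x ^ 2 + δ ^ 2)
    nlinarith [mul_nonneg (sub_nonneg.2 hxy) (sub_nonneg.2 h1)]
  · linarith [Real.sqrt_nonneg (x ^ 2 + δ ^ 2)]

/-- Split into `(z - w)` times a logarithm bounded by `ln(1/ε)`, and the smaller modulus times a
difference of logarithms, which is at most `‖z - w‖`. The total `2 ln(1/ε) + 2` is at most `4
ln(1/ε)`, independently of `δ` and `K`. -/
lemma norm_smoothNonlin_sub_le (hε : 0 < ε) (hL : 1 ≤ Real.log ε⁻¹) (hδ : 0 ≤ δ) {K : ℝ}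
    (hK : ε + K + δ ≤ ε⁻¹) {z w : ℂ} (hz : ‖z‖ ≤ K) (hw : ‖w‖ ≤ K) :
    ‖smoothNonlin ε δ z - smoothNonlin ε δ w‖ ≤ 4 * Real.log ε⁻¹ * ‖z - w‖ := by
  wlog hle : ‖w‖ ≤ ‖z‖ generalizing z w
  · rw [norm_sub_rev, norm_sub_rev z]
    exact this hw hz (not_le.1 hle).le
  set a := fun z : ℂ => ε + Real.sqrt (‖z‖ ^ 2 + δ ^ 2) with ha
  have e : smoothNonlin ε δ z - smoothNonlin ε δ w = (z - w) * ((2 * Real.log (a z) : ℝ) : ℂ)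
      + w * ((2 * (Real.log (a z) - Real.log (a w)) : ℝ) : ℂ) := by
    simp only [smoothNonlin, ha]; push_cast; ring
  have hwa : ‖w‖ ≤ a w := by
    have : ‖w‖ ≤ Real.sqrt (‖w‖ ^ 2 + δ ^ 2) := Real.le_sqrt_of_sq_le (by nlinarith)
    simp only [ha]; linarith
  have haw : 0 < a w := by simp only [ha]; positivity
  have hmono : a w ≤ a z := by simp only [ha]; gcongr
  have h1 : |Real.log (a z)| ≤ Real.log ε⁻¹ := by
    refine abs_log_le_of_mem hε (by simp only [ha]; linarith [Real.sqrt_nonneg (‖z‖ ^ 2 + δ ^ 2)])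
      (le_trans ?_ hK)
    have : Real.sqrt (‖z‖ ^ 2 + δ ^ 2) ≤ ‖z‖ + δ := by
      rw [Real.sqrt_le_left (by positivity)]
      nlinarith [mul_nonneg (norm_nonneg z) hδ]
    simp only [ha]; linarith
  have h2 : |Real.log (a z) - Real.log (a w)| * ‖w‖ ≤ ‖z - w‖ := by
    calc _ ≤ |Real.log (a z) - Real.log (a w)| * a w := by gcongr
      _ ≤ a z - a w := log_sub_log_le haw hmono
      _ ≤ ‖z‖ - ‖w‖ := by
        have := sqrt_sub_sqrt_le (δ := δ) (norm_nonneg w) hle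
        simp only [ha]; linarith
      _ ≤ ‖z - w‖ := norm_sub_norm_le z w
  rw [e]
  refine (norm_add_le _ _).trans ?_
  rw [norm_mul, norm_mul, Complex.norm_real, Complex.norm_real, Real.norm_eq_abs, Real.norm_eq_abs,
    abs_mul, abs_mul, abs_two]
  have h3 := mul_le_mul_of_nonneg_right h1 (norm_nonneg (z - w))
  have h4 := mul_le_mul_of_nonneg_right hL (norm_nonneg (z - w))
  nlinarith

/-- The error is proportional to `‖z‖`, hence small in `L²` also on domains of infinite measure. The
loss `1/ε` disappears as `δ → 0`. -/
lemma norm_smoothNonlin_sub_regNonlin_le (hε : 0 < ε) (hδ : 0 ≤ δ) (z : ℂ) :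
    ‖smoothNonlin ε δ z - smoothNonlin ε 0 z‖ ≤ 2 * δ / ε * ‖z‖ := by
  have h0 : ‖z‖ ≤ Real.sqrt (‖z‖ ^ 2 + δ ^ 2) := Real.le_sqrt_of_sq_le (by nlinarith)
  have h1 : Real.sqrt (‖z‖ ^ 2 + δ ^ 2) ≤ ‖z‖ + δ := by
    rw [Real.sqrt_le_left (by positivity)]
    nlinarith [mul_nonneg (norm_nonneg z) hδ]
  have h2 := log_sub_log_le (a := ε + ‖z‖) (b := ε + Real.sqrt (‖z‖ ^ 2 + δ ^ 2)) (by positivity)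
    (by linarith)
  have h3 : |Real.log (ε + Real.sqrt (‖z‖ ^ 2 + δ ^ 2)) - Real.log (ε + ‖z‖)| * ε ≤ δ := by
    refine le_trans ?_ (h2.trans (by linarith))
    gcongr
    linarith [norm_nonneg z]
  have e : smoothNonlin ε δ z - smoothNonlin ε 0 z = z * ((2 * (Real.log
      (ε + Real.sqrt (‖z‖ ^ 2 + δ ^ 2)) - Real.log (ε + ‖z‖)) : ℝ) : ℂ) := by
    rw [smoothNonlin_zero_right, regNonlin, logPhase_eq, smoothNonlin]; push_cast; ring
  rw [e, norm_mul, Complex.norm_real, Real.norm_eq_abs, abs_mul, abs_two, mul_comm]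
  gcongr
  rw [le_div_iff₀ hε]
  linarith

lemma norm_exp_mul_I_sub_exp_mul_I_le (s t : ℝ) :
    ‖Complex.exp (s * Complex.I) - Complex.exp (t * Complex.I)‖ ≤ |s - t| := by
  have e : Complex.exp (s * Complex.I) - Complex.exp (t * Complex.I)
      = Complex.exp (t * Complex.I) * (Complex.exp (Complex.I * ((s - t : ℝ) : ℂ)) - 1) := by
    rw [mul_sub, ← Complex.exp_add, mul_one]; push_cast; ring_nf
  rw [e, norm_mul, Complex.norm_exp_ofReal_mul_I, one_mul]
  exact Real.norm_exp_I_mul_ofReal_sub_one_le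

/-- Stability of the nonlinear flow, uniformly in `ε`. -/
lemma norm_nonlinFlow_sub_le (hε : 0 < ε) (lam t : ℝ) (z w : ℂ) :
    ‖nonlinFlow lam ε t z - nonlinFlow lam ε t w‖ ≤ (1 + 2 * |t * lam|) * ‖z - w‖ := by
  -- With `w` of smaller modulus, the difference of the phases is weighted by `‖w‖ ≤ ε + ‖w‖`, which
  -- cancels the Lipschitz constant of the logarithm there, whatever `ε` is.
  wlog hle : ‖w‖ ≤ ‖z‖ generalizing z w
  · rw [norm_sub_rev, norm_sub_rev z]
    exact this _ _ (not_le.1 hle).le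
  have e : nonlinFlow lam ε t z - nonlinFlow lam ε t w
      = (z - w) * Complex.exp (((-(t * lam * logPhase ε z) : ℝ) : ℂ) * Complex.I)
        + w * (Complex.exp (((-(t * lam * logPhase ε z) : ℝ) : ℂ) * Complex.I)
          - Complex.exp (((-(t * lam * logPhase ε w) : ℝ) : ℂ) * Complex.I)) := by
    simp only [nonlinFlow]; ring
  have h1 := norm_exp_mul_I_sub_exp_mul_I_le (-(t * lam * logPhase ε z)) (-(t * lam * logPhase ε w))
  have h2 : |-(t * lam * logPhase ε z) - -(t * lam * logPhase ε w)|
      = 2 * |t * lam| * |Real.log (ε + ‖z‖) - Real.log (ε + ‖w‖)| := by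
    rw [logPhase_eq, logPhase_eq, ← abs_two (α := ℝ), ← abs_mul, ← abs_mul, ← abs_neg]
    congr 1; rw [abs_two]; ring
  have h3 : |Real.log (ε + ‖z‖) - Real.log (ε + ‖w‖)| * ‖w‖ ≤ ‖z - w‖ := by
    calc _ ≤ |Real.log (ε + ‖z‖) - Real.log (ε + ‖w‖)| * (ε + ‖w‖) := by gcongr; linarith
      _ ≤ ε + ‖z‖ - (ε + ‖w‖) := log_sub_log_le (by positivity) (by gcongr)
      _ ≤ ‖z - w‖ := by rw [add_sub_add_left_eq_sub]; exact norm_sub_norm_le z w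
  rw [e]
  refine (norm_add_le _ _).trans ?_
  rw [norm_mul, norm_mul, Complex.norm_exp_ofReal_mul_I, mul_one, add_mul, one_mul]
  refine add_le_add le_rfl ?_
  calc _ ≤ ‖w‖ * (2 * |t * lam| * |Real.log (ε + ‖z‖) - Real.log (ε + ‖w‖)|) := by
        rw [← h2]; exact mul_le_mul_of_nonneg_left h1 (norm_nonneg w)
    _ = 2 * |t * lam| * (|Real.log (ε + ‖z‖) - Real.log (ε + ‖w‖)| * ‖w‖) := by ring
    _ ≤ _ := mul_le_mul_of_nonneg_left h3 (by positivity)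

/-- Expansion of the nonlinear flow to first order. -/
lemma norm_nonlinFlow_sub_sub_le (hε : 0 < ε) {K : ℝ} (hK : ε + K ≤ ε⁻¹) (lam t : ℝ) {z : ℂ}
    (hz : ‖z‖ ≤ K) : ‖nonlinFlow lam ε t z - z - (t : ℂ) * (-Complex.I * lam * regNonlin ε z)‖
      ≤ 12 * (t * lam * Real.log ε⁻¹) ^ 2 * ‖z‖ := by
  set θ : ℝ := -(t * lam * logPhase ε z) with hθ
  have e : nonlinFlow lam ε t z - z - (t : ℂ) * (-Complex.I * lam * regNonlin ε z)
      = z * (Complex.exp (θ * Complex.I) - 1 - θ * Complex.I) := by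
    rw [nonlinFlow, regNonlin, ← hθ, hθ]; push_cast; ring
  -- Second order remainder for `|θ| ≤ 1`, triangle inequality otherwise; together with `θ² ≤ 4(tλ
  -- ln(1/ε))²` this gives the `12`.
  have h1 : ‖Complex.exp (θ * Complex.I) - 1 - θ * Complex.I‖ ≤ 3 * θ ^ 2 := by
    rcases le_total |θ| 1 with h | h
    · have := Complex.norm_exp_sub_one_sub_id_le (x := θ * Complex.I) (by simpa using h)
      rw [norm_mul, Complex.norm_real, Complex.norm_I, mul_one, Real.norm_eq_abs, sq_abs] at this
      nlinarith [sq_nonneg θ]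
    · have h2 : ‖Complex.exp (θ * Complex.I) - 1 - θ * Complex.I‖ ≤ 1 + 1 + |θ| := by
        refine (norm_sub_le _ _).trans (add_le_add ((norm_sub_le _ _).trans ?_) ?_)
        · rw [Complex.norm_exp_ofReal_mul_I, norm_one]
        · simp
      rw [← sq_abs]
      nlinarith
  have h2 : θ ^ 2 ≤ 4 * (t * lam * Real.log ε⁻¹) ^ 2 := by
    have := abs_log_le_of_mem (a := ε + ‖z‖) hε (by linarith [norm_nonneg z]) (by linarith)
    have h3 := pow_le_pow_left₀ (abs_nonneg _) this 2
    rw [sq_abs] at h3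
    have e1 : θ ^ 2 = 4 * ((t * lam) ^ 2 * Real.log (ε + ‖z‖) ^ 2) := by
      rw [hθ, logPhase_eq]; ring
    rw [e1, mul_pow (t * lam)]
    gcongr
  rw [e, norm_mul, mul_comm]
  gcongr
  linarith

/-- A smooth nonexpansive (up to a constant) retraction onto a disc. -/
lemma exists_retraction : ∃ C : NNReal, ∀ K : ℝ, 0 < K → ∃ G : ℂ → ℂ, ContDiff ℝ ∞ G ∧
    LipschitzWith C G ∧ (∀ z, ‖z‖ ≤ K → G z = z) ∧ ∀ z, ‖G z‖ ≤ 2 * K := by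
  let f : ContDiffBump (0 : ℂ) := ⟨1, 2, one_pos, one_lt_two⟩
  have hs : ContDiff ℝ ∞ fun z : ℂ => f z • z := f.contDiff.smul contDiff_id
  have hc : HasCompactSupport fun z : ℂ => f z • z := f.hasCompactSupport.smul_right
  obtain ⟨C, hC⟩ := ContDiff.lipschitzWith_of_hasCompactSupport hc hs (by simp)
  -- Conjugating one fixed cutoff map by the dilation of ratio `K` leaves its Lipschitz constant
  -- unchanged, so `C` serves all radii.
  refine ⟨C, fun K hK => ⟨fun z => K • (f (K⁻¹ • z) • (K⁻¹ • z)), ?_, ?_, fun z hz => ?_, fun z => ?_⟩⟩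
  · have h1 : ContDiff ℝ ∞ fun z : ℂ => K⁻¹ • z := contDiff_id.const_smul K⁻¹
    exact (hs.comp h1).const_smul K
  · refine LipschitzWith.of_dist_le_mul fun z w => ?_
    have := hC.dist_le_mul (K⁻¹ • z) (K⁻¹ • w)
    rw [dist_smul₀, Real.norm_eq_abs, abs_of_pos hK]
    rw [dist_smul₀ K⁻¹, Real.norm_eq_abs, abs_of_pos (inv_pos.2 hK)] at this
    calc _ ≤ K * (C * (K⁻¹ * dist z w)) := by gcongr
      _ = C * dist z w := by field_simp
  · have : f (K⁻¹ • z) = 1 := f.one_of_mem_closedBall (by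
      rw [mem_closedBall_zero_iff, norm_smul, norm_inv, Real.norm_eq_abs, abs_of_pos hK,
        inv_mul_le_iff₀ hK]
      exact hz.trans_eq (mul_one K).symm)
    dsimp only
    rw [this, one_smul, smul_inv_smul₀ hK.ne']
  · rw [norm_smul, Real.norm_eq_abs, abs_of_pos hK, mul_comm]
    gcongr
    rw [norm_smul, Real.norm_eq_abs, abs_of_nonneg f.nonneg]
    by_cases h : ‖K⁻¹ • z‖ ≤ 2
    · calc _ ≤ 1 * (2 : ℝ) := by gcongr; exact f.le_one
        _ = 2 := one_mul 2
    · rw [f.zero_of_le_dist (by simpa using (not_le.1 h).le), zero_mul]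
      norm_num

end Nonlinearity

end

noncomputable section

/-! ### The nonlinearity and the Schrödinger group on the energy space -/

namespace Setting

open Filter Topology

variable {d : ℕ} {D : Setting d}

lemma norm_testPair_comp_snd_le {F : ℂ → ℂ} {K : NNReal} (hF : LipschitzWith K F) (h0 : F 0 = 0)
    (hF' : ContDiff ℝ ∞ F) {ψ : Space d → ℂ} (hψ : D.IsTest ψ) :
    ‖(testPair (hψ.comp hF' h0)).snd‖ ≤ K * ‖(testPair hψ).snd‖ := by
  have h (j : Fin d) : ‖testL2 ((hψ.comp hF' h0).partialDeriv j)‖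
      ≤ K * ‖testL2 (hψ.partialDeriv j)‖ := by
    refine Lp.norm_le_mul_norm_of_ae_le_mul ?_
    filter_upwards [coeFn_testL2 ((hψ.comp hF' h0).partialDeriv j),
      coeFn_testL2 (hψ.partialDeriv j)] with x h1 h2
    rw [h1, h2]
    exact norm_partialDeriv_comp_le hF (hF'.differentiable (by simp)) hψ.differentiable j x
  refine (sq_le_sq₀ (norm_nonneg _) (by positivity)).1 ?_
  rw [mul_pow, PiLp.norm_sq_eq_of_L2, PiLp.norm_sq_eq_of_L2, Finset.mul_sum]
  refine Finset.sum_le_sum fun j _ => ?_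
  rw [← mul_pow]
  gcongr
  exact h j

/-- Composition with a smooth Lipschitz map preserves the regularity along the group. -/
lemma norm_graphGroup_lipComp_sub_le {F : ℂ → ℂ} {K : NNReal} (hF : LipschitzWith K F)
    (h0 : F 0 = 0) (hF' : ContDiff ℝ ∞ F) (t : ℝ) {p : D.Pairs} (hp : p ∈ D.gradGraph) :
    ‖graphGroup D.gradGraph t (lipComp hF h0 p.fst) - lipComp hF h0 p.fst‖
      ≤ 3 * Real.sqrt |t| * (K * ‖p.snd‖) := by
  refine gradGraph_induction (P := fun p : D.Pairs =>
    ‖graphGroup D.gradGraph t (lipComp hF h0 p.fst) - lipComp hF h0 p.fst‖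
      ≤ 3 * Real.sqrt |t| * (K * ‖p.snd‖)) ?_ (fun ψ hψ => ?_) hp
  · have h1 : Continuous fun p : D.Pairs => lipComp hF h0 p.fst :=
      (continuous_lipComp hF h0).comp (by fun_prop)
    exact isClosed_le (((graphGroup D.gradGraph t).continuous.comp h1).sub h1).norm (by fun_prop)
  · have h1 := norm_graphGroup_sub_le isClosed_gradGraph isResolvent_gradGraph
      (testPair_mem (hψ.comp hF' h0)) t
    refine (le_of_eq ?_).trans (h1.trans ?_)
    · change ‖graphGroup D.gradGraph t (lipComp hF h0 (testL2 hψ)) - lipComp hF h0 (testL2 hψ)‖ = _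
      rw [← testL2_comp hF h0 hF' hψ]
    · gcongr
      exact norm_testPair_comp_snd_le hF h0 hF' hψ

/-- The same for a limit of smooth Lipschitz maps. -/
lemma norm_graphGroup_lipComp_sub_le_of_approx {F : ℂ → ℂ} {K : NNReal} (hF : LipschitzWith K F)
    (h0 : F 0 = 0) {B : ℝ} (happ : ∀ δ : ℝ, 0 < δ → δ ≤ 1 → ∃ F' : ℂ → ℂ, ContDiff ℝ ∞ F' ∧
      LipschitzWith K F' ∧ F' 0 = 0 ∧ ∀ z, ‖F z - F' z‖ ≤ B * δ * ‖z‖)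
    (t : ℝ) {p : D.Pairs} (hp : p ∈ D.gradGraph) :
    ‖graphGroup D.gradGraph t (lipComp hF h0 p.fst) - lipComp hF h0 p.fst‖
      ≤ 3 * Real.sqrt |t| * (K * ‖p.snd‖) := by
  -- The approximants share the Lipschitz constant `K`, so only the vanishing `L²` error depends on
  -- `δ`.
  have hlim : Tendsto (fun δ : ℝ => 3 * Real.sqrt |t| * (K * ‖p.snd‖) + 2 * (B * δ * ‖p.fst‖))
      (𝓝[>] 0) (𝓝 (3 * Real.sqrt |t| * (K * ‖p.snd‖))) := by
    have : Continuous fun δ : ℝ => 3 * Real.sqrt |t| * (K * ‖p.snd‖) + 2 * (B * δ * ‖p.fst‖) := by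
      fun_prop
    have h := (this.tendsto 0).mono_left (nhdsWithin_le_nhds (s := Ioi (0 : ℝ)))
    simpa using h
  refine ge_of_tendsto hlim ?_
  filter_upwards [Ioc_mem_nhdsGT (zero_lt_one' ℝ)] with δ hδ
  obtain ⟨F', hs, hF', h0', hd⟩ := happ δ hδ.1 hδ.2
  have h1 := norm_graphGroup_lipComp_sub_le hF' h0' hs t hp
  have h2 : ‖lipComp hF h0 p.fst - lipComp hF' h0' p.fst‖ ≤ B * δ * ‖p.fst‖ := by
    refine Lp.norm_le_mul_norm_of_ae_le_mul ?_
    filter_upwards [coeFn_lipComp hF h0 p.fst, coeFn_lipComp hF' h0' p.fst,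
      Lp.coeFn_sub (lipComp hF h0 p.fst) (lipComp hF' h0' p.fst)] with x e1 e2 e3
    rw [e3, Pi.sub_apply, e1, e2]
    exact hd _
  have h3 : ‖graphGroup D.gradGraph t (lipComp hF h0 p.fst - lipComp hF' h0' p.fst)‖
      = ‖lipComp hF h0 p.fst - lipComp hF' h0' p.fst‖ := isResolvent_gradGraph.norm_unitaryGroup t _
  calc _ = ‖graphGroup D.gradGraph t (lipComp hF h0 p.fst - lipComp hF' h0' p.fst)
        + (graphGroup D.gradGraph t (lipComp hF' h0' p.fst) - lipComp hF' h0' p.fst)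
        - (lipComp hF h0 p.fst - lipComp hF' h0' p.fst)‖ := by rw [map_sub]; congr 1; abel
    _ ≤ _ := (norm_sub_le _ _).trans (add_le_add (norm_add_le _ _) le_rfl)
    _ ≤ _ := by rw [h3]; linarith

lemma lipComp_sub_norm_le {F : ℂ → ℂ} {K : NNReal} (hF : LipschitzWith K F) (h0 : F 0 = 0)
    (u v : D.L2) : ‖lipComp hF h0 u - lipComp hF h0 v‖ ≤ K * ‖u - v‖ :=
  hF.norm_compLp_sub_le h0 u v

lemma norm_lipComp_le {F : ℂ → ℂ} {K : NNReal} (hF : LipschitzWith K F) (h0 : F 0 = 0)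
    (u : D.L2) : ‖lipComp hF h0 u‖ ≤ K * ‖u‖ := hF.norm_compLp_le h0 u

lemma coeFn_flowB (lam ε t : ℝ) (z : D.L2) :
    D.flowB lam ε t z =ᵐ[D.meas] fun x => nonlinFlow lam ε t (z x) := MemLp.coeFn_toLp _

lemma norm_flowB (lam ε t : ℝ) (z : D.L2) : ‖D.flowB lam ε t z‖ = ‖z‖ := by
  refine le_antisymm (Lp.norm_le_norm_of_ae_le ?_) (Lp.norm_le_norm_of_ae_le ?_) <;>
  · filter_upwards [coeFn_flowB lam ε t z] with x hx
    rw [hx, norm_nonlinFlow]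

lemma norm_flowB_sub_le {ε : ℝ} (hε : 0 < ε) (lam t : ℝ) (z w : D.L2) :
    ‖D.flowB lam ε t z - D.flowB lam ε t w‖ ≤ (1 + 2 * |t * lam|) * ‖z - w‖ := by
  refine Lp.norm_le_mul_norm_of_ae_le_mul ?_
  filter_upwards [coeFn_flowB lam ε t z, coeFn_flowB lam ε t w, Lp.coeFn_sub z w,
    Lp.coeFn_sub (D.flowB lam ε t z) (D.flowB lam ε t w)] with x h1 h2 h3 h4
  rw [h3, h4, Pi.sub_apply, Pi.sub_apply, h1, h2]
  exact norm_nonlinFlow_sub_le hε lam t _ _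

lemma norm_flowA (t : ℝ) (v : D.L2) : ‖D.flowA t v‖ = ‖v‖ := by
  rw [flowA_eq]; exact isResolvent_gradGraph.norm_unitaryGroup t v

lemma norm_lieTrotter (lam ε τ : ℝ) (u₀ : D.L2) (n : ℕ) : ‖D.lieTrotter lam ε τ u₀ n‖ = ‖u₀‖ := by
  induction n with
  | zero => rfl
  | succ n ih => rw [lieTrotter, norm_flowA, norm_flowB, ih]

/-- A globally Lipschitz nonlinearity that coincides with the regularized one on a disc. -/
structure IsCutoffNonlin (ε K : ℝ) (L : NNReal) (F : ℂ → ℂ) : Prop where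
  lipschitz : LipschitzWith L F
  zero : F 0 = 0
  eq : ∀ z, ‖z‖ ≤ K → F z = regNonlin ε z
  approx : ∃ B, ∀ δ : ℝ, 0 < δ → δ ≤ 1 → ∃ F' : ℂ → ℂ, ContDiff ℝ ∞ F' ∧
      LipschitzWith L F' ∧ F' 0 = 0 ∧ ∀ z, ‖F z - F' z‖ ≤ B * δ * ‖z‖

/-- The cutoff is the nonlinearity composed with a retraction of values in the disc of radius `2K`;
the size condition leaves room for this radius and for a smoothing parameter up to `1`. Thus the
Lipschitz constant is `O(ln(1/ε))`, whatever `K` is. -/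
lemma exists_isCutoffNonlin : ∃ C : NNReal, ∀ ε K : ℝ, 0 < ε → 1 ≤ Real.log ε⁻¹ → 0 < K →
    ε + 2 * K + 1 ≤ ε⁻¹ → ∃ F, IsCutoffNonlin ε K (C * (Real.log ε⁻¹).toNNReal) F := by
  obtain ⟨C, hC⟩ := exists_retraction
  refine ⟨4 * C, fun ε K hε hL hK h => ?_⟩
  obtain ⟨G, hG, hlip, heq, hb⟩ := hC K hK
  have hG0 : G 0 = 0 := heq 0 (by simpa using hK.le)
  have hGn (z : ℂ) : ‖G z‖ ≤ C * ‖z‖ := by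
    have := hlip.dist_le_mul z 0
    rwa [hG0, dist_zero_right, dist_zero_right] at this
  have hF (δ : ℝ) (h0 : 0 ≤ δ) (h1 : δ ≤ 1) :
      LipschitzWith (4 * C * (Real.log ε⁻¹).toNNReal) fun z => smoothNonlin ε δ (G z) := by
    refine LipschitzWith.of_dist_le_mul fun z w => ?_
    have := norm_smoothNonlin_sub_le hε hL h0 (K := 2 * K) (by linarith) (hb z) (hb w)
    have h2 := hlip.dist_le_mul z w
    push_cast
    rw [Real.coe_toNNReal _ (by linarith), dist_eq_norm]
    rw [dist_eq_norm (G z)] at h2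
    calc _ ≤ _ := this
      _ ≤ 4 * Real.log ε⁻¹ * (C * dist z w) := by gcongr
      _ = _ := by ring
  refine ⟨fun z => smoothNonlin ε 0 (G z), hF 0 le_rfl zero_le_one,
    by simp only [hG0, smoothNonlin_apply_zero], fun z hz => ?_, 2 * C / ε, fun δ h0 h1 =>
    ⟨fun z => smoothNonlin ε δ (G z), (contDiff_smoothNonlin hε h0).comp hG, hF δ h0.le h1,
      by simp only [hG0, smoothNonlin_apply_zero], fun z => ?_⟩⟩
  · simp only [heq z hz, smoothNonlin_zero_right]
  · rw [norm_sub_rev]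
    calc _ ≤ 2 * δ / ε * ‖G z‖ := norm_smoothNonlin_sub_regNonlin_le hε h0.le _
      _ ≤ 2 * δ / ε * (C * ‖z‖) := by gcongr; exact hGn z
      _ = _ := by ring

end Setting

end

noncomputable section

/-! ### Consequences of the regularity of the solution -/

/-- A closed condition that holds almost everywhere along a continuous curve holds everywhere. -/
lemma ContinuousOn.forall_of_ae {X : Type*} [TopologicalSpace X] {u : ℝ → X} {T : ℝ} (hT : 0 < T)
    (hu : ContinuousOn u (Icc 0 T)) {P : X → Prop} (hP : IsClosed {x | P x})
    (h : ∀ᵐ t ∂(volume.restrict (Ioo 0 T)), P (u t)) : ∀ t ∈ Icc 0 T, P (u t) := by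
  have hcl : Icc 0 T ⊆ closure ({t | P (u t)} ∩ Ioo 0 T) := by
    have h1 : Dense {t : ℝ | t ∈ Ioo 0 T → P (u t)} :=
      Measure.dense_of_ae ((ae_restrict_iff' measurableSet_Ioo).1 h)
    have h2 := h1.open_subset_closure_inter (isOpen_Ioo (a := (0 : ℝ)) (b := T))
    have h3 : Ioo 0 T ∩ {t : ℝ | t ∈ Ioo 0 T → P (u t)} ⊆ {t | P (u t)} ∩ Ioo 0 T :=
      fun t ht => ⟨ht.2 ht.1, ht.1⟩
    rw [← closure_Ioo hT.ne]
    exact closure_minimal (h2.trans (closure_mono h3)) isClosed_closure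
  intro t ht
  have hc : ContinuousWithinAt u ({t | P (u t)} ∩ Ioo 0 T) t :=
    (hu t ht).mono (inter_subset_right.trans Ioo_subset_Icc_self)
  exact hP.closure_subset_iff.2 (by rintro _ ⟨s, hs, rfl⟩; exact hs.1) (hc.mem_closure_image (hcl ht))

namespace Setting

open Filter Topology

variable {d : ℕ} {D : Setting d}

lemma isClosed_ae_norm_le (K : ℝ) : IsClosed {u : D.L2 | ∀ᵐ x ∂D.meas, ‖u x‖ ≤ K} := by
  refine IsSeqClosed.isClosed fun v u hv hlim => ?_
  obtain ⟨ns, -, hns⟩ := exists_subseq_ae_tendsto hlim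
  filter_upwards [hns, ae_all_iff.2 fun n => hv (ns n)] with x h1 h2
  exact le_of_tendsto' h1.norm h2

lemma eq_of_hasWeakDeriv {u : D.L2} {γ : PiLp 2 fun _ : Fin d => D.L2}
    (h : WithLp.toLp 2 (u, γ) ∈ D.gradGraph) {g : Fin d → D.L2}
    (hg : ∀ j, D.HasWeakDeriv j u (g j)) : γ = WithLp.toLp 2 g := by
  ext1 j
  exact (hasWeakDeriv_of_mem_gradGraph h j).unique (hg j)

/-- Functions of the energy space with bounded `H¹` norm. -/
lemma exists_mem_gradGraph_of_h1Norm_le {u : D.L2} (hu : D.MemEnergy u) {m : ℝ}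
    (h : D.h1Norm u ≤ ENNReal.ofReal m) :
    ∃ p ∈ D.gradGraph, p.fst = u ∧ ‖p‖ ≤ |m| + 1 := by
  -- A strict inequality is needed to pick gradients from the infimum; this, and possibly negative
  -- `m`, is why `|m| + 1` appears.
  have hlt : D.h1Norm u < ENNReal.ofReal (|m| + 1) :=
    h.trans_lt ((ENNReal.ofReal_lt_ofReal_iff (by positivity)).2 (by linarith [le_abs_self m]))
  simp only [h1Norm, iInf_lt_iff] at hlt
  obtain ⟨g, hg, hlt⟩ := hlt
  rw [ENNReal.ofReal_lt_ofReal_iff (by positivity)] at hlt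
  obtain ⟨γ, hγ⟩ := memEnergy_iff.1 hu
  rw [eq_of_hasWeakDeriv hγ hg] at hγ
  refine ⟨_, hγ, rfl, ?_⟩
  rw [WithLp.prod_norm_eq_of_L2, PiLp.norm_sq_eq_of_L2]
  exact hlt.le

/-- Functions of the energy space with bounded `H²` norm are in the domain of the Laplacian. -/
lemma exists_graphLaplacian_of_h2Norm_le {u : D.L2} (hu : D.MemEnergy u) {M : ℝ}
    (h : D.h2Norm u ≤ ENNReal.ofReal M) :
    ∃ f, GraphLaplacian D.gradGraph u f ∧ ‖u‖ ≤ |M| + 1 ∧ ‖f‖ ≤ d * (|M| + 1) := by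
  have hlt : D.h2Norm u < ENNReal.ofReal (|M| + 1) :=
    h.trans_lt ((ENNReal.ofReal_lt_ofReal_iff (by positivity)).2 (by linarith [le_abs_self M]))
  simp only [h2Norm, iInf_lt_iff] at hlt
  obtain ⟨g, k, hg, hk, hlt⟩ := hlt
  rw [ENNReal.ofReal_lt_ofReal_iff (by positivity), Real.sqrt_lt' (by positivity)] at hlt
  obtain ⟨γ, hγ⟩ := memEnergy_iff.1 hu
  rw [eq_of_hasWeakDeriv hγ hg] at hγ
  have hgs : 0 ≤ ∑ j, ‖g j‖ ^ 2 := Finset.sum_nonneg fun _ _ => sq_nonneg _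
  have hki (j : Fin d) : 0 ≤ ∑ i, ‖k j i‖ ^ 2 := Finset.sum_nonneg fun _ _ => sq_nonneg _
  have hks : 0 ≤ ∑ j, ∑ i, ‖k j i‖ ^ 2 := Finset.sum_nonneg fun j _ => hki j
  have hj (j : Fin d) : ‖k j j‖ ≤ |M| + 1 := by
    refine (sq_le_sq₀ (norm_nonneg _) (by positivity)).1 ?_
    have h1 : ‖k j j‖ ^ 2 ≤ ∑ i, ‖k j i‖ ^ 2 :=
      Finset.single_le_sum (f := fun i => ‖k j i‖ ^ 2) (fun i _ => sq_nonneg _) (Finset.mem_univ j)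
    have h2 : ∑ i, ‖k j i‖ ^ 2 ≤ ∑ j, ∑ i, ‖k j i‖ ^ 2 :=
      Finset.single_le_sum (f := fun j => ∑ i, ‖k j i‖ ^ 2) (fun i _ => hki i)
        (Finset.mem_univ j)
    nlinarith [sq_nonneg ‖u‖]
  -- The Laplacian is the trace of the weak Hessian, and membership in the energy space supplies the
  -- boundary condition.
  refine ⟨∑ j, k j j, ⟨_, hγ, fun p hp => ?_⟩, ?_, ?_⟩
  · refine gradGraph_induction (P := fun p : D.Pairs => inner ℂ (WithLp.toLp 2 g) p.snd
      = -inner ℂ (∑ j, k j j) p.fst) (isClosed_eq (by fun_prop) (by fun_prop)) (fun ψ hψ => ?_) hp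
    rw [← inner_conj_symm, ← inner_conj_symm (∑ j, k j j), ← map_neg]
    congr 1
    rw [PiLp.inner_apply, inner_sum, ← Finset.sum_neg_distrib]
    refine Finset.sum_congr rfl fun j _ => ?_
    have := hasWeakDeriv_iff.1 (hk j j) ψ hψ
    exact this
  · refine (sq_le_sq₀ (norm_nonneg _) (by positivity)).1 ?_
    linarith
  · refine (norm_sum_le _ _).trans ((Finset.sum_le_sum fun j _ => hj j).trans (le_of_eq ?_))
    rw [Finset.sum_const, Finset.card_univ, Fintype.card_fin, nsmul_eq_mul]

/-- The norm in which the solution is assumed bounded controls the maximum norm. -/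
lemma exists_ae_norm_le_of_regNorm_le (hd : d = 1 ∨ d = 2 ∨ d = 3) (D : Setting d) :
    ∃ K : ℝ → ℝ, (∀ M, 0 < K M) ∧ ∀ (M : ℝ) (u : D.L2), D.MemEnergy u →
      D.regNorm u ≤ ENNReal.ofReal M → ∀ᵐ x ∂D.meas, ‖u x‖ ≤ K M := by
  rcases hd with rfl | hd
  · obtain ⟨A, B, hA, hB, h⟩ := exists_ae_norm_le_one_dim D
    refine ⟨fun M => A + B * (|M| + 1) ^ 2 + 1, fun M => by positivity, fun M u hu hM => ?_⟩
    rw [regNorm, if_pos rfl] at hM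
    obtain ⟨p, hp, rfl, hb⟩ := exists_mem_gradGraph_of_h1Norm_le hu hM
    filter_upwards [h p hp] with x hx
    have : B * ‖p‖ ^ 2 ≤ B * (|M| + 1) ^ 2 := by gcongr
    linarith
  -- Only the energy space and the Laplacian are used here, not an embedding of `H²(Ω)`, so the
  -- boundary of `Ω` may be irregular.
  · obtain ⟨C, hC⟩ := exists_sobolev6 hd D
    obtain ⟨B, hB, h⟩ := ae_norm_le_of_graphLaplacian hC
    refine ⟨fun M => 2 * (|M| + 1 + B * (|M| + 1 + d * (|M| + 1)) + 2), fun M => by positivity,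
      fun M u hu hM => ?_⟩
    rw [regNorm, if_neg (by omega)] at hM
    obtain ⟨f, hf, h1, h2⟩ := exists_graphLaplacian_of_h2Norm_le hu hM
    filter_upwards [h u f hf] with x hx
    refine hx.trans ?_
    gcongr
    exact (norm_sub_le _ _).trans (add_le_add h1 h2)

/-- The properties of the solution that enter the error analysis: `K` bounds it pointwise, `m` is
its modulus of regularity along the group, and `F` is the nonlinearity. -/
structure IsRegularSolution (D : Setting d) (lam T K m : ℝ) {L : NNReal} {F : ℂ → ℂ}
    (hF : LipschitzWith L F) (h0 : F 0 = 0) (u : ℝ → D.L2) : Prop where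
  continuousOn : ContinuousOn u (Icc 0 T)
  ae_norm_le : ∀ t ∈ Icc 0 T, ∀ᵐ x ∂D.meas, ‖u t x‖ ≤ K
  norm_le : ∀ t ∈ Icc 0 T, ‖u t‖ ≤ m
  group : ∀ t ∈ Icc 0 T, ∀ s, ‖graphGroup D.gradGraph s (u t) - u t‖ ≤ 3 * Real.sqrt |s| * m
  group_nonlin : ∀ t ∈ Icc 0 T, ∀ s, ‖graphGroup D.gradGraph s (lipComp hF h0 (u t))
    - lipComp hF h0 (u t)‖ ≤ 3 * Real.sqrt |s| * (L * m)
  hasDerivAt : ∀ w f, GraphLaplacian D.gradGraph w f → ∀ t ∈ Ioo 0 T,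
    HasDerivAt (fun s => inner ℂ w (u s)) (Complex.I * inner ℂ f (u t)
      + inner ℂ w ((-Complex.I * lam) • lipComp hF h0 (u t))) t

lemma integral_regNonlin_eq {ε K : ℝ} {L : NNReal} {F : ℂ → ℂ} (hF : IsCutoffNonlin ε K L F)
    {u : D.L2} (hu : ∀ᵐ x ∂D.meas, ‖u x‖ ≤ K) {ψ : Space d → ℂ} (hψ : D.IsTest ψ) :
    ∫ x, regNonlin ε (u x) * starRingEnd ℂ (ψ x) ∂D.meas
      = inner ℂ (testL2 hψ) (lipComp hF.lipschitz hF.zero u) := by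
  rw [inner_testL2]
  refine integral_congr_ae ?_
  filter_upwards [hu, coeFn_lipComp hF.lipschitz hF.zero u] with x h1 h2
  rw [h2, Function.comp_apply, hF.eq _ h1]

/-- The equation tested with test functions, in terms of the scalar product of `L²`. -/
lemma IsSolution.hasDerivAt_testL2 {lam ε T K : ℝ} {u₀ : D.L2} {u : ℝ → D.L2}
    (h : D.IsSolution lam ε T u₀ u) {L : NNReal} {F : ℂ → ℂ} (hF : IsCutoffNonlin ε K L F)
    (hK : ∀ t ∈ Icc 0 T, ∀ᵐ x ∂D.meas, ‖u t x‖ ≤ K) {ψ : Space d → ℂ} (hψ : D.IsTest ψ)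
    {t : ℝ} (ht : t ∈ Ioo 0 T) :
    HasDerivAt (fun s => inner ℂ (testL2 hψ) (u s)) (Complex.I * inner ℂ (testL2 hψ.laplacian) (u t)
      + inner ℂ (testL2 hψ) ((-Complex.I * lam) • lipComp hF.lipschitz hF.zero (u t))) t := by
  have := h.equation _ hψ.conj t ht
  rw [laplacian_conj, ← inner_testL2 hψ.laplacian,
    integral_regNonlin_eq hF (hK t (Ioo_subset_Icc_self ht)) hψ] at this
  simp_rw [← inner_testL2 hψ] at this
  convert this using 1
  rw [inner_smul_right]
  ring

/-- The weak equation holds for all elements of the domain of the Laplacian. -/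
lemma IsSolution.hasDerivAt_graphLaplacian {lam ε T K m : ℝ} {u₀ : D.L2} {u : ℝ → D.L2}
    (h : D.IsSolution lam ε T u₀ u) {L : NNReal} {F : ℂ → ℂ} (hF : IsCutoffNonlin ε K L F)
    (hK : ∀ t ∈ Icc 0 T, ∀ᵐ x ∂D.meas, ‖u t x‖ ≤ K) (hT : 0 < T) (hN : ∀ t ∈ Icc 0 T, ‖u t‖ ≤ m)
    (hm : ∀ᵐ t ∂(volume.restrict (Ioo 0 T)), ∃ p ∈ D.gradGraph, p.fst = u t ∧ ‖p‖ ≤ m)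
    {w f : D.L2} (hw : GraphLaplacian D.gradGraph w f) {t : ℝ} (ht : t ∈ Ioo 0 T) :
    HasDerivAt (fun s => inner ℂ w (u s)) (Complex.I * inner ℂ f (u t)
      + inner ℂ w ((-Complex.I * lam) • lipComp hF.lipschitz hF.zero (u t))) t := by
  obtain ⟨γ, hγ, hf⟩ := hw
  obtain ⟨ψ, hψ, hlim⟩ := exists_testPair_tendsto hγ
  have hm0 : 0 ≤ m := (norm_nonneg _).trans (hN t (Ioo_subset_Icc_self ht))
  have hlim0 : Tendsto (fun n => ‖testPair (hψ n) - WithLp.toLp 2 (w, γ)‖) atTop (𝓝 0) :=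
    tendsto_iff_norm_sub_tendsto_zero.1 hlim
  have hfst (n : ℕ) : ‖testL2 (hψ n) - w‖ ≤ ‖testPair (hψ n) - WithLp.toLp 2 (w, γ)‖ :=
    WithLp.norm_fst_le _ (testPair (hψ n) - WithLp.toLp 2 (w, γ))
  have hsnd (n : ℕ) : ‖(testPair (hψ n)).snd - γ‖ ≤ ‖testPair (hψ n) - WithLp.toLp 2 (w, γ)‖ :=
    WithLp.norm_snd_le _ (testPair (hψ n) - WithLp.toLp 2 (w, γ))
  -- The functions `Δψ_n` need not converge in `L²`. Paired with `u t` in the energy space they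
  -- involve only gradients, which do converge, uniformly in `t` thanks to the bound `m`.
  have hlap (n : ℕ) : ∀ t ∈ Icc 0 T, ‖inner ℂ (testL2 (hψ n).laplacian) (u t) - inner ℂ f (u t)‖
      ≤ ‖testPair (hψ n) - WithLp.toLp 2 (w, γ)‖ * m := by
    refine h.continuousOn.forall_of_ae hT (P := fun v =>
      ‖inner ℂ (testL2 (hψ n).laplacian) v - inner ℂ f v‖
        ≤ ‖testPair (hψ n) - WithLp.toLp 2 (w, γ)‖ * m) (isClosed_le (by fun_prop) (by fun_prop)) ?_
    filter_upwards [hm] with t ht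
    obtain ⟨p, hp, hpu, hpm⟩ := ht
    have h1 := inner_testL2_laplacian (hψ n) hp
    have h2 := hf p hp
    rw [← hpu, h1, eq_neg_iff_add_eq_zero.2 ((neg_eq_iff_add_eq_zero.1 h2.symm)), neg_sub_neg,
      ← inner_sub_left]
    refine (norm_inner_le_norm _ _).trans ?_
    rw [norm_sub_rev]
    exact mul_le_mul (hsnd n) ((WithLp.norm_snd_le _ p).trans hpm) (norm_nonneg _) (norm_nonneg _)
  have hcoef : ‖(-Complex.I * lam : ℂ)‖ = |lam| := by simp
  refine hasDerivAt_of_tendstoUniformlyOn (l := atTop) isOpen_Ioo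
    (f := fun n s => inner ℂ (testL2 (hψ n)) (u s))
    (f' := fun n t => Complex.I * inner ℂ (testL2 (hψ n).laplacian) (u t)
      + inner ℂ (testL2 (hψ n)) ((-Complex.I * lam) • lipComp hF.lipschitz hF.zero (u t)))
    (g' := fun t => Complex.I * inner ℂ f (u t)
      + inner ℂ w ((-Complex.I * lam) • lipComp hF.lipschitz hF.zero (u t)))
    ?_ (Eventually.of_forall fun n s hs => h.hasDerivAt_testL2 hF hK (hψ n) hs) ?_ ht
  · rw [Metric.tendstoUniformlyOn_iff]
    intro η hη
    have h3 : Tendsto (fun n => ‖testPair (hψ n) - WithLp.toLp 2 (w, γ)‖ * (m + |lam| * (L * m)))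
        atTop (𝓝 0) := by simpa using hlim0.mul_const (m + |lam| * (L * m))
    filter_upwards [h3.eventually (gt_mem_nhds hη)] with n hn s hs
    refine lt_of_le_of_lt ?_ hn
    have hs' := Ioo_subset_Icc_self hs
    rw [dist_eq_norm', add_sub_add_comm, ← mul_sub,
      ← inner_sub_left (testL2 (hψ n)) w]
    refine (norm_add_le _ _).trans ?_
    rw [norm_mul, Complex.norm_I, one_mul, mul_add]
    refine add_le_add (hlap n s hs') ((norm_inner_le_norm _ _).trans ?_)
    rw [norm_smul, hcoef]
    have h4 : ‖lipComp hF.lipschitz hF.zero (u s)‖ ≤ L * m :=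
      (norm_lipComp_le _ _ _).trans (by gcongr; exact hN s hs')
    gcongr
    exact hfst n
  · intro s _
    have h5 : Tendsto (fun n => testL2 (hψ n)) atTop (𝓝 w) :=
      tendsto_iff_norm_sub_tendsto_zero.2
        (squeeze_zero (fun _ => norm_nonneg _) hfst hlim0)
    exact h5.inner tendsto_const_nhds

/-- The regularity is given only for almost every time. Each bound needed is a closed condition in
`L²`, so continuity of `u` extends it to all times. -/
lemma IsSolution.isRegularSolution {lam ε T K m : ℝ} {u₀ : D.L2} {u : ℝ → D.L2}
    (h : D.IsSolution lam ε T u₀ u) {L : NNReal} {F : ℂ → ℂ} (hF : IsCutoffNonlin ε K L F)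
    (hT : 0 < T) (hK : ∀ᵐ t ∂(volume.restrict (Ioo 0 T)), ∀ᵐ x ∂D.meas, ‖u t x‖ ≤ K)
    (hm : ∀ᵐ t ∂(volume.restrict (Ioo 0 T)), ∃ p ∈ D.gradGraph, p.fst = u t ∧ ‖p‖ ≤ m) :
    D.IsRegularSolution lam T K m hF.lipschitz hF.zero u := by
  have hK' := h.continuousOn.forall_of_ae hT (isClosed_ae_norm_le K) hK
  have hN : ∀ t ∈ Icc 0 T, ‖u t‖ ≤ m :=
    h.continuousOn.forall_of_ae hT (P := fun v => ‖v‖ ≤ m)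
      (isClosed_le continuous_norm continuous_const) (by
        filter_upwards [hm] with t ht
        obtain ⟨p, hp, hpu, hpm⟩ := ht
        rw [← hpu]
        exact (WithLp.norm_fst_le _ p).trans hpm)
  obtain ⟨B, hB⟩ := hF.approx
  refine ⟨h.continuousOn, hK', hN, fun t ht s => ?_, fun t ht s => ?_, fun w f hw t ht =>
    h.hasDerivAt_graphLaplacian hF hK' hT hN hm hw ht⟩
  · refine h.continuousOn.forall_of_ae hT (P := fun v =>
      ‖graphGroup D.gradGraph s v - v‖ ≤ 3 * Real.sqrt |s| * m)
      (isClosed_le (by fun_prop) (by fun_prop)) ?_ t ht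
    filter_upwards [hm] with r hr
    obtain ⟨p, hp, hpu, hpm⟩ := hr
    rw [← hpu]
    refine (norm_graphGroup_sub_le isClosed_gradGraph isResolvent_gradGraph
      (u := p.fst) (g := p.snd) hp s).trans ?_
    gcongr
    exact (WithLp.norm_snd_le _ p).trans hpm
  · have hc : Continuous (lipComp (D := D) hF.lipschitz hF.zero) := continuous_lipComp _ _
    refine h.continuousOn.forall_of_ae hT (P := fun v =>
      ‖graphGroup D.gradGraph s (lipComp hF.lipschitz hF.zero v)
        - lipComp hF.lipschitz hF.zero v‖ ≤ 3 * Real.sqrt |s| * (L * m))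
      (isClosed_le (by fun_prop) (by fun_prop)) ?_ t ht
    filter_upwards [hm] with r hr
    obtain ⟨p, hp, hpu, hpm⟩ := hr
    rw [← hpu]
    refine (norm_graphGroup_lipComp_sub_le_of_approx hF.lipschitz hF.zero hB s hp).trans ?_
    gcongr
    exact (WithLp.norm_snd_le _ p).trans hpm

end Setting

end

noncomputable section

/-! ### Error analysis of the splitting -/

namespace Setting

variable {d : ℕ} {D : Setting d}

namespace IsRegularSolution

variable {lam T K m : ℝ} {L : NNReal} {F : ℂ → ℂ} {hF : LipschitzWith L F} {h0 : F 0 = 0}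
  {u : ℝ → D.L2}

lemma norm_nonlin_le (h : D.IsRegularSolution lam T K m hF h0 u) {t : ℝ} (ht : t ∈ Icc 0 T) :
    ‖lipComp hF h0 (u t)‖ ≤ L * m :=
  (norm_lipComp_le _ _ _).trans (by gcongr; exact h.norm_le t ht)

lemma norm_graphGroup_neg_sub_le (h : D.IsRegularSolution lam T K m hF h0 u) {t s B : ℝ} {c : D.L2}
    (ht : 0 ≤ t) (hs : 0 ≤ s) (hts : t + s ≤ T)
    (hB : ∀ r ∈ Ioo 0 s, ‖graphGroup D.gradGraph (-r) ((-Complex.I * lam) •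
      lipComp hF h0 (u (t + r))) - c‖ ≤ B) :
    ‖graphGroup D.gradGraph (-s) (u (t + s)) - u t - (s : ℂ) • c‖ ≤ B * s := by
  have := _root_.norm_graphGroup_neg_sub_le (G := D.gradGraph) isResolvent_gradGraph (v := u)
    (N := fun r => (-Complex.I * lam) • lipComp hF h0 (u r)) (c := c) (a := t) (b := t + s) (B := B)
    (by linarith) (h.continuousOn.mono (Icc_subset_Icc ht hts))
    (fun w f hw r hr => h.hasDerivAt w f hw r ⟨ht.trans_lt hr.1, hr.2.trans_le hts⟩)
    (fun r hr => by
      have h1 := hB (r - t) ⟨by linarith [hr.1], by linarith [hr.2]⟩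
      rwa [neg_sub, add_sub_cancel] at h1)
  rwa [show t - (t + s) = -s by ring, add_sub_cancel_left] at this

lemma norm_graphGroup_neg_sub_le_mul (h : D.IsRegularSolution lam T K m hF h0 u) {t s : ℝ}
    (ht : 0 ≤ t) (hs : 0 ≤ s) (hts : t + s ≤ T) :
    ‖graphGroup D.gradGraph (-s) (u (t + s)) - u t‖ ≤ |lam| * (L * m) * s := by
  have := h.norm_graphGroup_neg_sub_le (c := 0) (B := |lam| * (L * m)) ht hs hts fun r hr => by
    have e : ‖graphGroup D.gradGraph (-r) ((-Complex.I * lam) • lipComp hF h0 (u (t + r)))‖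
        = ‖(-Complex.I * lam) • lipComp hF h0 (u (t + r))‖ :=
      isResolvent_gradGraph.norm_unitaryGroup _ _
    rw [sub_zero, e, norm_smul]
    have e1 : ‖(-Complex.I * lam : ℂ)‖ = |lam| := by simp
    rw [e1]
    gcongr
    exact h.norm_nonlin_le ⟨by linarith [hr.1], by linarith [hr.2]⟩
  simpa using this

/-- Hölder continuity in time. -/
lemma norm_sub_le (h : D.IsRegularSolution lam T K m hF h0 u) {t s : ℝ}
    (ht : 0 ≤ t) (hs : 0 ≤ s) (hts : t + s ≤ T) :
    ‖u (t + s) - u t‖ ≤ |lam| * (L * m) * s + 3 * Real.sqrt s * m := by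
  have h1 := h.norm_graphGroup_neg_sub_le_mul ht hs hts
  have h2 := h.group (t + s) ⟨by linarith, hts⟩ (-s)
  rw [abs_neg, abs_of_nonneg hs, norm_sub_rev] at h2
  calc _ = ‖(graphGroup D.gradGraph (-s) (u (t + s)) - u t)
        + (u (t + s) - graphGroup D.gradGraph (-s) (u (t + s)))‖ := by congr 1; abel
    _ ≤ _ := (norm_add_le _ _).trans (add_le_add h1 h2)

/-- First order expansion of the solution in the interaction picture. -/
lemma norm_graphGroup_neg_sub_sub_le (h : D.IsRegularSolution lam T K m hF h0 u) {t τ : ℝ}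
    (ht : 0 ≤ t) (hτ : 0 ≤ τ) (htτ : t + τ ≤ T) :
    ‖graphGroup D.gradGraph (-τ) (u (t + τ)) - u t
        - (τ : ℂ) • ((-Complex.I * lam) • lipComp hF h0 (u t))‖
      ≤ |lam| * L * (|lam| * (L * m) * τ + 6 * Real.sqrt τ * m) * τ := by
  refine h.norm_graphGroup_neg_sub_le ht hτ htτ fun r hr => ?_
  have hm : 0 ≤ m := (norm_nonneg _).trans (h.norm_le t ⟨ht, by linarith⟩)
  have hr0 := hr.1.le
  have hrτ := hr.2.le
  have h1 := h.group_nonlin (t + r) ⟨by linarith, by linarith⟩ (-r)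
  have h2 := (lipComp_sub_norm_le hF h0 (u (t + r)) (u t)).trans
    (mul_le_mul_of_nonneg_left (h.norm_sub_le ht hr0 (by linarith)) L.2)
  rw [abs_neg, abs_of_nonneg hr0] at h1
  have e1 : ‖(-Complex.I * lam : ℂ)‖ = |lam| := by simp
  rw [map_smul, ← smul_sub, norm_smul, e1, mul_assoc]
  refine mul_le_mul_of_nonneg_left ?_ (abs_nonneg lam)
  -- Two sources of `3√r L m`: the group moving the nonlinearity, and the Hölder continuity of `u`
  -- in time carried through the Lipschitz map. Together they give the `6`.
  calc _ = ‖(graphGroup D.gradGraph (-r) (lipComp hF h0 (u (t + r))) - lipComp hF h0 (u (t + r)))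
        + (lipComp hF h0 (u (t + r)) - lipComp hF h0 (u t))‖ := by congr 1; abel
    _ ≤ 3 * Real.sqrt r * (L * m) + L * (|lam| * (L * m) * r + 3 * Real.sqrt r * m) :=
      (norm_add_le _ _).trans (add_le_add h1 h2)
    _ ≤ 3 * Real.sqrt τ * (L * m) + L * (|lam| * (L * m) * τ + 3 * Real.sqrt τ * m) := by
      gcongr
    _ = _ := by ring

end IsRegularSolution

/-- First order expansion of the nonlinear flow. -/
lemma norm_flowB_sub_sub_le {ε K : ℝ} {L : NNReal} {F : ℂ → ℂ} (hε : 0 < ε)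
    (hF : IsCutoffNonlin ε K L F) (hK : ε + K ≤ ε⁻¹) (lam t : ℝ) {z : D.L2}
    (hz : ∀ᵐ x ∂D.meas, ‖z x‖ ≤ K) :
    ‖D.flowB lam ε t z - z - (t : ℂ) • ((-Complex.I * lam) • lipComp hF.lipschitz hF.zero z)‖
      ≤ 12 * (t * lam * Real.log ε⁻¹) ^ 2 * ‖z‖ := by
  refine Lp.norm_le_mul_norm_of_ae_le_mul ?_
  filter_upwards [hz, coeFn_flowB lam ε t z, coeFn_lipComp hF.lipschitz hF.zero z,
    Lp.coeFn_sub (D.flowB lam ε t z) z,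
    Lp.coeFn_sub (D.flowB lam ε t z - z)
      ((t : ℂ) • ((-Complex.I * lam) • lipComp hF.lipschitz hF.zero z)),
    Lp.coeFn_smul (t : ℂ) ((-Complex.I * lam : ℂ) • lipComp hF.lipschitz hF.zero z),
    Lp.coeFn_smul (-Complex.I * lam : ℂ) (lipComp hF.lipschitz hF.zero z)]
    with x h1 h2 h3 h4 h5 h6 h7
  rw [h5, Pi.sub_apply, h4, Pi.sub_apply, h6, Pi.smul_apply, h7, Pi.smul_apply, h2, h3,
    Function.comp_apply, hF.eq _ h1, smul_eq_mul, smul_eq_mul]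
  exact norm_nonlinFlow_sub_sub_le hε hK lam t h1

/-- The local error of the splitting. -/
lemma IsRegularSolution.norm_step_sub_le {lam ε T K m : ℝ} {C : NNReal} {F : ℂ → ℂ} (hε : 0 < ε)
    (hL : 1 ≤ Real.log ε⁻¹) (hF : IsCutoffNonlin ε K (C * (Real.log ε⁻¹).toNNReal) F)
    (hK : ε + K ≤ ε⁻¹) {u : ℝ → D.L2}
    (h : D.IsRegularSolution lam T K m hF.lipschitz hF.zero u) {t τ : ℝ}
    (ht : 0 ≤ t) (hτ : 0 ≤ τ) (htτ : t + τ ≤ T) (hs : Real.log ε⁻¹ * Real.sqrt τ ≤ 1) :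
    ‖D.flowA τ (D.flowB lam ε τ (u t)) - u (t + τ)‖
      ≤ (|lam| * C * (|lam| * C + 6) + 12 * lam ^ 2) * m * Real.log ε⁻¹ * Real.sqrt τ * τ := by
  set ℓ := Real.log ε⁻¹ with hℓ
  set c : D.L2 := (-Complex.I * lam : ℂ) • lipComp hF.lipschitz hF.zero (u t)
  have hm : 0 ≤ m := (norm_nonneg _).trans (h.norm_le t ⟨ht, by linarith⟩)
  have hsq : Real.sqrt τ * Real.sqrt τ = τ := Real.mul_self_sqrt hτ
  have h1 := h.norm_graphGroup_neg_sub_sub_le ht hτ htτ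
  have h2 := norm_flowB_sub_sub_le hε hF hK lam τ (h.ae_norm_le t ⟨ht, by linarith⟩)
  -- After the unitary factor is pulled out, the numerical and the exact step are expanded around
  -- the same point `u t + τ c`.
  have e : D.flowA τ (D.flowB lam ε τ (u t)) - u (t + τ) = graphGroup D.gradGraph τ
      ((D.flowB lam ε τ (u t) - u t - (τ : ℂ) • c)
        - (graphGroup D.gradGraph (-τ) (u (t + τ)) - u t - (τ : ℂ) • c)) := by
    have e1 : graphGroup D.gradGraph τ (graphGroup D.gradGraph (-τ) (u (t + τ))) = u (t + τ) :=
      isResolvent_gradGraph.unitaryGroup_apply_neg τ _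
    rw [sub_sub_sub_cancel_right, sub_sub_sub_cancel_right, map_sub, e1, flowA_eq]
  have e2 : ‖graphGroup D.gradGraph τ ((D.flowB lam ε τ (u t) - u t - (τ : ℂ) • c)
        - (graphGroup D.gradGraph (-τ) (u (t + τ)) - u t - (τ : ℂ) • c))‖ = _ :=
    isResolvent_gradGraph.norm_unitaryGroup τ _
  rw [e, e2]
  refine (_root_.norm_sub_le _ _).trans ((add_le_add h2 h1).trans ?_)
  rw [← hℓ]
  push_cast
  rw [Real.coe_toNNReal ℓ (by linarith)]
  -- Under the step restriction one factor `ℓ` is absorbed into `√τ`; this turns the terms quadratic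
  -- in `ℓ` into linear ones.
  have h3 : ℓ * τ ≤ Real.sqrt τ := by
    calc ℓ * τ = ℓ * Real.sqrt τ * Real.sqrt τ := by rw [mul_assoc, hsq]
      _ ≤ 1 * Real.sqrt τ := by gcongr
      _ = _ := one_mul _
  have h4 : 12 * (τ * lam * ℓ) ^ 2 * ‖u t‖ ≤ 12 * lam ^ 2 * m * ℓ * Real.sqrt τ * τ := by
    calc _ = 12 * lam ^ 2 * ‖u t‖ * ℓ * (ℓ * τ) * τ := by ring
      _ ≤ _ := by
        gcongr
        exact h.norm_le t ⟨ht, by linarith⟩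
  have h5 : |lam| * (C * ℓ) * (|lam| * (C * ℓ * m) * τ + 6 * Real.sqrt τ * m) * τ
      ≤ |lam| * C * (|lam| * C + 6) * m * ℓ * Real.sqrt τ * τ := by
    calc _ = |lam| * C * ℓ * (|lam| * C * m * (ℓ * τ) + 6 * Real.sqrt τ * m) * τ := by ring
      _ ≤ |lam| * C * ℓ * (|lam| * C * m * Real.sqrt τ + 6 * Real.sqrt τ * m) * τ := by gcongr
      _ = _ := by ring
  linarith

end Setting

/-- Discrete Gronwall, each of the `n` accumulated errors being amplified at most by the largest
power. -/
lemma le_mul_pow_mul_of_le {e : ℕ → ℝ} {a δ : ℝ} (ha : 0 ≤ a) (hδ : 0 ≤ δ) {N : ℕ} (h0 : e 0 = 0)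
    (h : ∀ n < N, e (n + 1) ≤ (1 + a) * e n + δ) : ∀ n ≤ N, e n ≤ n * (1 + a) ^ n * δ := by
  intro n
  induction n with
  | zero => simp [h0]
  | succ n ih =>
    intro hn
    have h1 := mul_le_mul_of_nonneg_left (ih (by omega)) (by positivity : 0 ≤ 1 + a)
    have h2 : 1 * δ ≤ (1 + a) ^ (n + 1) * δ := by
      gcongr
      exact one_le_pow₀ (by linarith)
    refine (h n (by omega)).trans ?_
    push_cast
    rw [pow_succ] at h2 ⊢
    linarith

namespace Setting

variable {d : ℕ} {D : Setting d}

/-- The global error for small time steps. -/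
lemma IsRegularSolution.norm_lieTrotter_sub_le {lam ε T K m : ℝ} {C : NNReal} {F : ℂ → ℂ}
    (hε : 0 < ε) (hL : 1 ≤ Real.log ε⁻¹) (hF : IsCutoffNonlin ε K (C * (Real.log ε⁻¹).toNNReal) F)
    (hK : ε + K ≤ ε⁻¹) {u : ℝ → D.L2}
    (h : D.IsRegularSolution lam T K m hF.lipschitz hF.zero u) (hT : 0 ≤ T) {τ : ℝ} {n : ℕ}
    (hτ : 0 ≤ τ) (hn : n * τ ≤ T) (hs : Real.log ε⁻¹ * Real.sqrt τ ≤ 1) :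
    ‖D.lieTrotter lam ε τ (u 0) n - u (n * τ)‖
      ≤ T * Real.exp (2 * |lam| * T) * (|lam| * C * (|lam| * C + 6) + 12 * lam ^ 2) * m
        * Real.log ε⁻¹ * Real.sqrt τ := by
  set c := |lam| * C * (|lam| * C + 6) + 12 * lam ^ 2
  have hm : 0 ≤ m := (norm_nonneg _).trans (h.norm_le 0 ⟨le_rfl, hT⟩)
  have hc : 0 ≤ c := by positivity
  have key := le_mul_pow_mul_of_le (a := 2 * |τ * lam|) (N := n)
    (δ := c * m * Real.log ε⁻¹ * Real.sqrt τ * τ)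
    (e := fun k => ‖D.lieTrotter lam ε τ (u 0) k - u (k * τ)‖) (by positivity) (by positivity)
    (by simp [lieTrotter]) (fun k hk => ?_) n le_rfl
  · refine key.trans ?_
    have h1 : (1 + 2 * |τ * lam|) ^ n ≤ Real.exp (2 * |lam| * T) := by
      calc _ ≤ Real.exp (2 * |τ * lam|) ^ n := by
            gcongr
            rw [add_comm]
            exact Real.add_one_le_exp _
        _ = Real.exp (2 * |lam| * (n * τ)) := by
          rw [← Real.exp_nat_mul, abs_mul, abs_of_nonneg hτ]; ring_nf
        _ ≤ _ := by gcongr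
    -- The local error carries a full factor `τ`, so `n` of them cost only `nτ ≤ T`.
    calc _ = (n * τ) * (1 + 2 * |τ * lam|) ^ n * c * m * Real.log ε⁻¹ * Real.sqrt τ := by ring
      _ ≤ _ := by gcongr
  · have hk' : ((k : ℝ) + 1) * τ ≤ n * τ := by
      gcongr
      exact_mod_cast hk
    have h1 := h.norm_step_sub_le hε hL hF hK (t := k * τ) (by positivity) hτ (by linarith) hs
    have h2 := norm_flowB_sub_le hε lam τ (D.lieTrotter lam ε τ (u 0) k) (u (k * τ))
    have e : ((k + 1 : ℕ) : ℝ) * τ = k * τ + τ := by push_cast; ring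
    have h3 : D.flowA τ (D.flowB lam ε τ (D.lieTrotter lam ε τ (u 0) k))
        - D.flowA τ (D.flowB lam ε τ (u (k * τ))) = D.flowA τ
          (D.flowB lam ε τ (D.lieTrotter lam ε τ (u 0) k) - D.flowB lam ε τ (u (k * τ))) := by
      simp only [flowA_eq, map_sub]
    rw [e, lieTrotter]
    calc _ = ‖D.flowA τ (D.flowB lam ε τ (D.lieTrotter lam ε τ (u 0) k)
          - D.flowB lam ε τ (u (k * τ)))
          + (D.flowA τ (D.flowB lam ε τ (u (k * τ))) - u (k * τ + τ))‖ := by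
          rw [← h3]; congr 1; abel
      _ ≤ _ := (norm_add_le _ _).trans (add_le_add (by rwa [norm_flowA]) h1)

/-- The global error of the splitting for solutions bounded pointwise. -/
lemma exists_norm_lieTrotter_sub_le (D : Setting d) (lam : ℝ) : ∃ C : ℝ → ℝ → ℝ,
    ∀ T ε K m : ℝ, 0 < T → 0 < ε → 1 ≤ Real.log ε⁻¹ → 0 < K → ε + 2 * K + 1 ≤ ε⁻¹ →
      ∀ (u₀ : D.L2) (u : ℝ → D.L2), D.IsSolution lam ε T u₀ u →
      (∀ᵐ t ∂(volume.restrict (Ioo 0 T)), ∀ᵐ x ∂D.meas, ‖u t x‖ ≤ K) →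
      (∀ᵐ t ∂(volume.restrict (Ioo 0 T)), ∃ p ∈ D.gradGraph, p.fst = u t ∧ ‖p‖ ≤ m) →
      ∀ (τ : ℝ) (n : ℕ), 0 < τ → n * τ ≤ T →
        ‖D.lieTrotter lam ε τ u₀ n - u (n * τ)‖ ≤ C T m * Real.log ε⁻¹ * Real.sqrt τ := by
  obtain ⟨C, hC⟩ := exists_isCutoffNonlin
  refine ⟨fun T m => 2 * m + T * Real.exp (2 * |lam| * T)
    * (|lam| * C * (|lam| * C + 6) + 12 * lam ^ 2) * m,
    fun T ε K m hT hε hL hK hεK u₀ u hu hb hm τ n hτ hn => ?_⟩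
  obtain ⟨F, hF⟩ := hC ε K hε hL hK hεK
  have h := hu.isRegularSolution hF hT hb hm
  have hm0 : 0 ≤ m := (norm_nonneg _).trans (h.norm_le 0 ⟨le_rfl, hT.le⟩)
  rw [add_mul, add_mul]
  rcases le_total (Real.log ε⁻¹ * Real.sqrt τ) 1 with hs | hs
  · rw [← hu.initial]
    exact (h.norm_lieTrotter_sub_le hε hL hF (by linarith) hT.le hτ.le hn hs).trans
      (le_add_of_nonneg_left (by positivity))
  -- For large steps the scheme keeps its initial `L²` norm and the solution is bounded by `m`, so
  -- the error is at most `2m ≤ 2m ln(1/ε) √τ`.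
  · refine le_trans ?_ (le_add_of_nonneg_right (by positivity))
    calc _ ≤ ‖D.lieTrotter lam ε τ u₀ n‖ + ‖u (n * τ)‖ := _root_.norm_sub_le _ _
      _ ≤ m + m := by
        rw [norm_lieTrotter, ← hu.initial]
        exact add_le_add (h.norm_le 0 ⟨le_rfl, hT.le⟩) (h.norm_le _ ⟨by positivity, hn⟩)
      _ = 2 * m * 1 := by ring
      _ ≤ 2 * m * (Real.log ε⁻¹ * Real.sqrt τ) := by gcongr
      _ = _ := by ring

end Setting

end

/-! ### Choice of `ε₀` and conclusion -/

theorem theorem2p1 (d : ℕ) (hd : d = 1 ∨ d = 2 ∨ d = 3) (D : Setting d)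
    (lam : ℝ) (hlam : lam ≠ 0) :
    ∃ (ε₀ : ℝ → ℝ) (C : ℝ → ℝ → ℝ), (∀ M, 0 < ε₀ M) ∧
      ∀ T : ℝ, 0 < T → ∀ M m ε : ℝ, 0 < ε → ε ≤ ε₀ M →
      ∀ (u₀ : D.L2) (u : ℝ → D.L2), D.IsSolution lam ε T u₀ u →
        D.linftyNorm T D.regNorm u ≤ ENNReal.ofReal M →
        D.linftyNorm T D.h1Norm u ≤ ENNReal.ofReal m →
        ∀ (τ : ℝ) (n : ℕ), 0 < τ → n * τ ≤ T →
          ‖D.lieTrotter lam ε τ u₀ n - u (n * τ)‖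
            ≤ C T m * Real.log ε⁻¹ * τ ^ (1 / 2 : ℝ) := by
  obtain ⟨K, hK, hKu⟩ := Setting.exists_ae_norm_le_of_regNorm_le hd D
  obtain ⟨C, hC⟩ := Setting.exists_norm_lieTrotter_sub_le D lam
  -- The first bound gives `ln(1/ε) ≥ 1` and `ε ≤ 1`; the second then gives `ε + 2K + 1 ≤ 1/ε`. This
  -- is the only place where `M` acts.
  refine ⟨fun M => min (Real.exp (-1)) (2 * K M + 2)⁻¹, fun T m => C T (|m| + 1), fun M => ?_,
    fun T hT M m ε hε hεM u₀ u hu hM hm τ n hτ hn => ?_⟩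
  · have := hK M
    positivity
  have hKM := hK M
  have hL : 1 ≤ Real.log ε⁻¹ := by
    rw [Real.log_inv, le_neg, Real.log_le_iff_le_exp hε]
    exact hεM.trans (min_le_left _ _)
  have hε1 : ε ≤ 1 := hεM.trans ((min_le_left _ _).trans (Real.exp_le_one_iff.2 (by norm_num)))
  have hεK : ε + 2 * K M + 1 ≤ ε⁻¹ := by
    have := (le_inv_comm₀ hε (by positivity)).1 (hεM.trans (min_le_right _ _))
    linarith
  rw [← Real.sqrt_eq_rpow]
  refine hC T ε (K M) (|m| + 1) hT hε hL hKM hεK u₀ u hu ?_ ?_ τ n hτ hn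
  · filter_upwards [hu.boundary, ENNReal.ae_le_essSup fun t => D.regNorm (u t)] with t h1 h2
    exact hKu M _ h1 (h2.trans hM)
  · filter_upwards [hu.boundary, ENNReal.ae_le_essSup fun t => D.h1Norm (u t)] with t h1 h2
    exact Setting.exists_mem_gradGraph_of_h1Norm_le h1 (h2.trans hm)
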